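/- Let $k$ be a field with algebraic closure $\bar k$, and let $P$ be a Severi--Brauer variety over $k$, that is, a $k$-variety such that $P_{\bar k}\cong \mathbb P^N_{\bar k}$ for some $N\ge 0$. For a field $F$, a closed subscheme $Q$ of a Severi--Brauer variety $P'$ over $F$ is a *twisted linear subvariety* if $Q_{\bar F}\subset P'_{\bar F}\cong\mathbb P^N_{\bar F}$ is a (non-empty) linear subvariety. For a $k$-scheme $B$, a closed subscheme $Z\subset B\times_k P$ is a *twisted linear subbundle* if $Z_{\bar k}\subset B_{\bar k}\times_{\bar k} P_{\bar k}\cong B_{\bar k}\times_{\bar k}\mathbb P^N_{\bar k}$ is a linear subbundle of some constant rank $m$, that is, if Zariski locally over affine open subsets $U=\operatorname{Spec}A$ of $B_{\bar k}$ it is the image of a linear embedding $\mathbb P^m_A\hookrightarrow \mathbb P^N_A$ given by an $(N+1)\times(m+1)$ matrix over $A$ that has a left inverse. Let $K/k$ be a finite separable field extension and $L\subset P_K$ a twisted linear subvariety. For each $k$-embedding $\sigma:K\to\bar k$ let $L^\sigma\subset P_{\bar k}$ be the conjugate of $L$, that is, the base change of $L$ along $\sigma$. Assume that the $[K:k]$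 conjugates $L^\sigma$ (one for each $\sigma$) are linearly independent and span $P_{\bar k}$; that is, under an isomorphism $P_{\bar k}\cong \mathbb P(V)$ with $V=\bar k^{N+1}$ we have $L^\sigma=\mathbb P(W_\sigma)$ for linear subspaces $W_\sigma\subset V$ such that $V=\bigoplus_\sigma W_\sigma$. Let $\Re_{K/k}(L)$ denote the Weil restriction of $L$, that is, the $k$-scheme representing the functor $T\mapsto \operatorname{Hom}_K(T\times_k K, L)$ on $k$-schemes. Then there is a twisted linear subbundle $$R_L(P)\subset \Re_{K/k}(L)\times_k P$$ such that the coordinate projection $R_L(P)\to P$ is birational, that is, it restricts to an isomorphism between dense open subschemes. -/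

import Mathlib

universe u

open CategoryTheory CategoryTheory.Limits AlgebraicGeometry

attribute [local instance] MvPolynomial.gradedAlgebra

noncomputable section

namespace SeveriBrauer

/-! ### Projective space over a commutative ring and linear embeddings -/

/-- The grading by degree of the polynomial ring `A[x₀, …, x_N]`. -/
abbrev grading (N : ℕ) (A : Type u) [CommRing A] :
    ℕ → Submodule A (MvPolynomial (Fin (N + 1)) A) :=
  MvPolynomial.homogeneousSubmodule (Fin (N + 1)) A

/-- Projective space `ℙ^N_A = Proj A[x₀, …, x_N]`. -/
def projSpace (N : ℕ) (A : Type u) [CommRing A] : Scheme.{u} :=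
  Proj (grading N A)

/-- The structure morphism `ℙ^N_A ⟶ Spec A`. -/
def projSpaceStr (N : ℕ) (A : Type u) [CommRing A] :
    projSpace N A ⟶ Spec (CommRingCat.of A) :=
  Proj.toSpecZero (grading N A) ≫
    Spec.map (CommRingCat.ofHom (algebraMap A (grading N A 0)))

/-- The graded ring homomorphism `R[x₀, …, x_N] → A[y₀, …, y_m]` that is `f` on coefficients and
sends `x_i` to the linear form `∑ j, M i j * y_j`. -/
def linearSubst {N m : ℕ} {R A : Type u} [CommRing R] [CommRing A] (f : R →+* A)
    (M : Matrix (Fin (N + 1)) (Fin (m + 1)) A) :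
    GradedRingHom (grading N R) (grading m A) where
  toRingHom := MvPolynomial.eval₂Hom (MvPolynomial.C.comp f)
    (fun i => ∑ j, MvPolynomial.C (M i j) * MvPolynomial.X j)
  map_mem := by
    intro d x hx
    have h := MvPolynomial.IsHomogeneous.eval₂ (n := 1)
      ((MvPolynomial.mem_homogeneousSubmodule _ _).1 hx)
      (MvPolynomial.C.comp f) (fun i => ∑ j, MvPolynomial.C (M i j) * MvPolynomial.X j)
      (fun r => MvPolynomial.isHomogeneous_C _ _)
      (fun i => MvPolynomial.IsHomogeneous.sum _ _ _ fun j _ =>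
        MvPolynomial.isHomogeneous_C_mul_X _ _)
    rw [one_mul] at h
    exact h

/-- If `M` has a left inverse, the linear forms `∑ j, M i j * y_j` generate the irrelevant ideal,
so that they define a morphism on all of `ℙ^m_A`. -/
theorem irrelevant_le_map_linearSubst {N m : ℕ} {R A : Type u} [CommRing R] [CommRing A]
    (f : R →+* A) (M : Matrix (Fin (N + 1)) (Fin (m + 1)) A)
    (hM : ∃ D : Matrix (Fin (m + 1)) (Fin (N + 1)) A, D * M = 1) :
    HomogeneousIdeal.irrelevant (grading m A) ≤
      (HomogeneousIdeal.irrelevant (grading N R)).map (linearSubst f M) := by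
  obtain ⟨D, hD⟩ := hM
  have hX : ∀ j : Fin (m + 1), (MvPolynomial.X j : MvPolynomial (Fin (m + 1)) A) ∈
      ((HomogeneousIdeal.irrelevant (grading N R)).map (linearSubst f M)).toIdeal := by
    intro j
    have hmem : ∀ i : Fin (N + 1), linearSubst f M (MvPolynomial.X i) ∈
        ((HomogeneousIdeal.irrelevant (grading N R)).map (linearSubst f M)).toIdeal := fun i =>
      Ideal.mem_map_of_mem _ (HomogeneousIdeal.mem_irrelevant_of_mem (grading N R) one_pos
        (MvPolynomial.isHomogeneous_X R i))
    have hval : ∀ i : Fin (N + 1), linearSubst f M (MvPolynomial.X i) =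
        ∑ l, MvPolynomial.C (M i l) * MvPolynomial.X l := fun i =>
      MvPolynomial.eval₂Hom_X' _ _ _
    have hsum : (MvPolynomial.X j : MvPolynomial (Fin (m + 1)) A) =
        ∑ i, MvPolynomial.C (D j i) * linearSubst f M (MvPolynomial.X i) := by
      simp_rw [hval, Finset.mul_sum, ← mul_assoc, ← MvPolynomial.C_mul]
      rw [Finset.sum_comm]
      simp_rw [← Finset.sum_mul, ← map_sum]
      have : ∀ l, ∑ i, D j i * M i l = if j = l then 1 else 0 := fun l => by
        rw [← Matrix.mul_apply, hD, Matrix.one_apply]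
      simp [this]
    rw [hsum]
    exact Ideal.sum_mem _ fun i _ => Ideal.mul_mem_left _ _ (hmem i)
  rw [HomogeneousIdeal.irrelevant_le]
  intro d hd x hx
  have hle : (grading m A d : Set (MvPolynomial (Fin (m + 1)) A)) ⊆
      ((HomogeneousIdeal.irrelevant (grading N R)).map (linearSubst f M)).toIdeal := by
    intro p hp
    rw [p.as_sum]
    refine Ideal.sum_mem _ fun s hs => ?_
    have hdeg : s.degree = d := by
      rw [Finsupp.degree_eq_weight_one (R := ℕ)]
      exact hp (MvPolynomial.mem_support_iff.1 hs)
    have hs0 : s ≠ 0 := by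
      rintro rfl
      simp at hdeg
      omega
    obtain ⟨j, hj⟩ := Finsupp.ne_iff.1 hs0
    have hdvd : (MvPolynomial.X j : MvPolynomial (Fin (m + 1)) A) ∣
        MvPolynomial.monomial s (p.coeff s) :=
      MvPolynomial.X_dvd_monomial.2 (Or.inr (by simpa using hj))
    exact Ideal.mem_of_dvd _ hdvd (hX j)
  exact hle hx

/-- For a ring homomorphism `f : R → A` and an `(N+1) × (m+1)`-matrix `M` over `A` with a left
inverse, the morphism `ℙ^m_A ⟶ ℙ^N_R` given on points by `y ↦ M y`. It is the linear embedding
`ℙ^m_A ⟶ ℙ^N_A` defined by `M`, followed by the base change map `ℙ^N_A ⟶ ℙ^N_R`. -/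
def linearMap {N m : ℕ} {R A : Type u} [CommRing R] [CommRing A] (f : R →+* A)
    (M : Matrix (Fin (N + 1)) (Fin (m + 1)) A)
    (hM : ∃ D : Matrix (Fin (m + 1)) (Fin (N + 1)) A, D * M = 1) :
    projSpace m A ⟶ projSpace N R :=
  Proj.map (linearSubst f M) (irrelevant_le_map_linearSubst f M hM)

/-- `j : Q ⟶ ℙ^N_F` is (the inclusion of) the linear subvariety `ℙ(W)`, where `W ⊆ F^{N+1}`: it is
isomorphic over `ℙ^N_F` to a linear embedding of some `ℙ^m_F` with image `ℙ(W)`. -/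
def IsLinearSubvarietyOf {N : ℕ} {F : Type u} [Field F] (W : Submodule F (Fin (N + 1) → F))
    {Q : Scheme.{u}} (j : Q ⟶ projSpace N F) : Prop :=
  ∃ (m : ℕ) (M : Matrix (Fin (N + 1)) (Fin (m + 1)) F)
    (hM : ∃ D : Matrix (Fin (m + 1)) (Fin (N + 1)) F, D * M = 1)
    (e : Q ≅ projSpace m F),
    e.hom ≫ linearMap (RingHom.id F) M hM = j ∧ LinearMap.range M.mulVecLin = W

/-- `j : Q ⟶ ℙ^N_F` is (the inclusion of) a linear subvariety. -/
def IsLinearSubvariety {N : ℕ} {F : Type u} [Field F] {Q : Scheme.{u}}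
    (j : Q ⟶ projSpace N F) : Prop :=
  ∃ W, IsLinearSubvarietyOf W j

/-- Let `b : B ⟶ Spec F`. The morphism `(z, j) : Z ⟶ B × ℙ^N_F` is (the inclusion of) a linear
subbundle of rank `m` (that is, with fibres of dimension `m`): every point of `B` has an affine
open neighbourhood `U = Spec A` over which it is isomorphic to a linear embedding
`ℙ^m_A ⟶ ℙ^N_A = U × ℙ^N_F`, defined by a matrix over `A` that has a left inverse. -/
def IsLinearSubbundle {N : ℕ} {F : Type u} [Field F] {B Z : Scheme.{u}}
    (b : B ⟶ Spec (CommRingCat.of F)) (m : ℕ) (z : Z ⟶ B) (j : Z ⟶ projSpace N F) : Prop :=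
  ∀ x : B, ∃ (A : Type u) (_ : CommRing A) (v : Spec (CommRingCat.of A) ⟶ B) (f : F →+* A)
    (M : Matrix (Fin (N + 1)) (Fin (m + 1)) A)
    (hM : ∃ D : Matrix (Fin (m + 1)) (Fin (N + 1)) A, D * M = 1) (e : projSpace m A ⟶ Z),
    IsOpenImmersion v ∧ x ∈ Set.range v ∧ v ≫ b = Spec.map (CommRingCat.ofHom f) ∧
      IsPullback e (projSpaceStr m A) z v ∧ e ≫ j = linearMap f M hM

/-! ### Severi–Brauer varieties and their twisted linear subvarieties -/

/-- The morphism `Spec K ⟶ Spec k` of a field extension `K/k`. -/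
abbrev specExt (k K : Type u) [Field k] [Field K] [Algebra k K] :
    Spec (CommRingCat.of K) ⟶ Spec (CommRingCat.of k) :=
  Spec.map (CommRingCat.ofHom (algebraMap k K))

/-- `x : X ⟶ Spec k` is a `k`-variety: integral, separated and of finite type over `k`. -/
structure IsVariety {k : Type u} [Field k] {X : Scheme.{u}} (x : X ⟶ Spec (CommRingCat.of k)) :
    Prop where
  isIntegral : IsIntegral X
  isSeparated : IsSeparated x
  locallyOfFiniteType : LocallyOfFiniteType x
  quasiCompact : QuasiCompact x

/-- An isomorphism `P_k̄ ≅ ℙ^N_k̄` of schemes over the algebraic closure `k̄` of `k`. -/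
structure GeometricTrivialization {k : Type u} [Field k] {P : Scheme.{u}}
    (p : P ⟶ Spec (CommRingCat.of k)) (N : ℕ) where
  iso : pullback p (specExt k (AlgebraicClosure k)) ≅ projSpace N (AlgebraicClosure k)
  isOver : iso.hom ≫ projSpaceStr N (AlgebraicClosure k) = pullback.snd _ _

/-- `P` is a Severi–Brauer variety of dimension `N` over `k`. -/
structure IsSeveriBrauer {k : Type u} [Field k] {P : Scheme.{u}}
    (p : P ⟶ Spec (CommRingCat.of k)) (N : ℕ) : Prop where
  isVariety : IsVariety p
  trivialization : Nonempty (GeometricTrivialization p N)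

/-- The base change `Q_K ⟶ P_K` of a morphism `i : Q ⟶ P` of `k`-schemes. -/
def baseChangeMap {k : Type u} [Field k] (K : Type u) [Field K] [Algebra k K]
    {Q P : Scheme.{u}} (q : Q ⟶ Spec (CommRingCat.of k)) (p : P ⟶ Spec (CommRingCat.of k))
    (i : Q ⟶ P) (hi : i ≫ p = q) :
    pullback q (specExt k K) ⟶ pullback p (specExt k K) :=
  pullback.lift (pullback.fst _ _ ≫ i) (pullback.snd _ _)
    (by rw [Category.assoc, hi, pullback.condition])

/-- `i : Q ⟶ P` is (the inclusion of) a twisted linear subvariety of the Severi–Brauer variety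
`P`: a closed subscheme such that `Q_k̄ ⊆ P_k̄ ≅ ℙ^N_k̄` is a linear subvariety. -/
structure IsTwistedLinear {k : Type u} [Field k] {Q P : Scheme.{u}}
    (p : P ⟶ Spec (CommRingCat.of k)) (N : ℕ) (i : Q ⟶ P) : Prop where
  isClosedImmersion : IsClosedImmersion i
  linear : ∃ φ : GeometricTrivialization p N,
    IsLinearSubvariety (baseChangeMap (AlgebraicClosure k) (i ≫ p) p i rfl ≫ φ.iso.hom)

/-- `i : Z ⟶ B × P` is (the inclusion of) a twisted linear subbundle: a closed subscheme such that
`Z_k̄ ⊆ B_k̄ × P_k̄ ≅ B_k̄ × ℙ^N_k̄` is a linear subbundle. -/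
structure IsTwistedLinearSubbundle {k : Type u} [Field k] {Z B P : Scheme.{u}}
    (b : B ⟶ Spec (CommRingCat.of k)) (p : P ⟶ Spec (CommRingCat.of k)) (N : ℕ)
    (i : Z ⟶ pullback b p) : Prop where
  isClosedImmersion : IsClosedImmersion i
  linear : ∃ (φ : GeometricTrivialization p N) (m : ℕ),
    IsLinearSubbundle (pullback.snd b (specExt k (AlgebraicClosure k))) m
      (baseChangeMap (AlgebraicClosure k) (i ≫ pullback.fst b p ≫ b) b (i ≫ pullback.fst b p)
        (Category.assoc _ _ _))
      (baseChangeMap (AlgebraicClosure k) (i ≫ pullback.fst b p ≫ b) p (i ≫ pullback.snd b p)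
        (by rw [Category.assoc, pullback.condition]) ≫ φ.iso.hom)

/-! ### Conjugates, Weil restriction, birational morphisms -/

/-- Let `i : L ⟶ P_K` and let `σ : K → k̄` be a `k`-embedding. This is the conjugate
`L^σ ⟶ P_k̄`, the base change of `i` along `σ` (note that `P_K ⊗_{K,σ} k̄ = P_k̄`). -/
def conjugate {k K : Type u} [Field k] [Field K] [Algebra k K] {L P : Scheme.{u}}
    (p : P ⟶ Spec (CommRingCat.of k)) (i : L ⟶ pullback p (specExt k K))
    (σ : K →ₐ[k] AlgebraicClosure k) :
    pullback (i ≫ pullback.snd _ _) (Spec.map (CommRingCat.ofHom (σ : K →+* AlgebraicClosure k))) ⟶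
      pullback p (specExt k (AlgebraicClosure k)) :=
  pullback.lift (pullback.fst _ _ ≫ i ≫ pullback.fst _ _) (pullback.snd _ _) (by
    have h : specExt k (AlgebraicClosure k) =
        Spec.map (CommRingCat.ofHom (σ : K →+* AlgebraicClosure k)) ≫ specExt k K := by
      rw [← Spec.map_comp, ← CommRingCat.ofHom_comp, σ.comp_algebraMap]
    have h' := pullback.condition (f := i ≫ pullback.snd p (specExt k K))
      (g := Spec.map (CommRingCat.ofHom (σ : K →+* AlgebraicClosure k)))
    simp only [Category.assoc] at h' ⊢
    rw [h, pullback.condition, reassoc_of% h'])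

/-- The conjugates `L^σ`, indexed by the `k`-embeddings `σ : K → k̄`, span `P_k̄` and are linearly
independent: in suitable linear coordinates `L^σ = ℙ(W_σ)`, where the subspaces `W_σ` of
`k̄^{N+1}` are linearly independent and span `k̄^{N+1}`. -/
def ConjugatesSpanIndependently {k K : Type u} [Field k] [Field K] [Algebra k K]
    {L P : Scheme.{u}} (p : P ⟶ Spec (CommRingCat.of k)) (N : ℕ)
    (i : L ⟶ pullback p (specExt k K)) : Prop :=
  ∃ (φ : GeometricTrivialization p N)
    (W : (K →ₐ[k] AlgebraicClosure k) →
      Submodule (AlgebraicClosure k) (Fin (N + 1) → AlgebraicClosure k)),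
    (∀ σ, IsLinearSubvarietyOf (W σ) (conjugate p i σ ≫ φ.iso.hom)) ∧
      iSupIndep W ∧ ⨆ σ, W σ = ⊤

/-- `r : R ⟶ Spec k`, together with the universal morphism `ev : R_K ⟶ L`, is the Weil restriction
of `l : L ⟶ Spec K`: for every `k`-scheme `T`, the `K`-morphisms `T_K ⟶ L` correspond bijectively
to the `k`-morphisms `T ⟶ R`, where `g` corresponds to `g_K ≫ ev`. -/
structure IsWeilRestriction {k K : Type u} [Field k] [Field K] [Algebra k K] {L R : Scheme.{u}}
    (l : L ⟶ Spec (CommRingCat.of K)) (r : R ⟶ Spec (CommRingCat.of k))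
    (ev : pullback r (specExt k K) ⟶ L) : Prop where
  isOver : ev ≫ l = pullback.snd _ _
  existsUnique : ∀ (T : Scheme.{u}) (t : T ⟶ Spec (CommRingCat.of k))
    (h : pullback t (specExt k K) ⟶ L), h ≫ l = pullback.snd _ _ →
    ∃! g : T ⟶ R, ∃ hg : g ≫ r = t,
      baseChangeMap K t r g hg ≫ ev = h

/-- The morphism `f` is birational: it restricts to an isomorphism between dense open subschemes
of `X` and `Y`. -/
def IsBirationalMorphism {X Y : Scheme.{u}} (f : X ⟶ Y) : Prop :=
  ∃ g : Scheme.PartialIso X Y, g.iso.hom ≫ g.target.ι = g.source.ι ≫ f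

end SeveriBrauer

end

universe v w

set_option linter.unusedSectionVars false

open scoped TensorProduct

/-! Write `F` for the algebraic closure of `k` and `P_F = ℙ(V)`, `V = ⨁ W_σ`. The linear projections
`V → W_σ` define a rational map from `ℙ(V)` to `∏ ℙ(W_σ)`, and this product is the base change to
`F` of the Weil restriction `R` of `L`. A point of the product is one point on each `ℙ(W_σ)`; these
points span a linear subspace of dimension `[K : k] - 1`. The spans form a linear subbundle of `R_F
× ℙ(V)`. Since a vector is the sum of its components, this subbundle is the closure of the graph of
the rational map. Hence, once the rational map is defined over `k`, the closure `Z` of its graph in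
`R × P` is the required subbundle: it is birational to `P` because it is a graph, and `Z_F` is the
bundle of spans because two closed subschemes with a common scheme-theoretically dominant point
agree (`exists_iso_of_isClosedImmersion`, `isLinearSubbundle`).

The main point is the descent of the rational map. By the universal property of `R`, it amounts to a
homomorphism `ψ : K ⊗ A → K ⊗ Ω` that kills the ideal `I` of `L`, where `Spec A` is a chart of `P`
and `Ω` the function field of `P`, such that the conjugate of `ψ` by `σ` is evaluation at the
projection to `ℙ(W_σ)` of the generic point (`exists_algHom`). Galois descent is not at hand, as `F
/ k` may be inseparable, and `𝒪(1)` need not exist on `P`. The substitutes are as follows.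

Instead of `𝒪(1)`, take a function `u` on the chart, over `F` a reduced fraction `g / f` of forms of
degree `e > 0`. That the poles of a function are at most `j` times those of `u` is a condition over
`k` (`Bounded`), and over `F` it describes the fractions `p / f ^ j` with `p` a form of degree `e *
j`.

A form of degree `n` is a form in the coordinates of `W_σ` exactly if it vanishes to order `n` along
`ℙ(W_τ)` for all `τ ≠ σ` (`matSubst_of_mem_pow`, `mem_pow_of_matSubst_eq`). This is a condition on
powers of the conjugates of `I`.

Instead of Galois averages, apply to `F ⊗ A` the functionals `Λ : F → K` that are linear over `σ`.
If `b = p / f ^ j` with `p` a form in the coordinates of `W_σ`, then every conjugate of `Λ b` is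
again such a fraction, for its own embedding (`descended_rTensor`); this rests on the splitting of
`F ⊗ K` (`mapLeft_rTensor_mem_map`). The ratio of two such descended functions has the same value at
the generic point and at its projections (`Descended.eq`), and each `r` in `K ⊗ A` is such a ratio
modulo `I` (`exists_value`). This defines `ψ`. -/

namespace SeveriBrauer

/-! ### Descent along linear functionals on the extension field -/

section Functionals

variable {k K : Type*} {F : Type v} [Field k] [Field K] [Field F] [Algebra k K] [Algebra k F]

/-- A `k`-linear map `F → K` is linear over `σ : K → F` if it is `K`-linear for the structure of a
`K`-algebra that `σ` defines on `F`. -/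
def IsLinearOver (σ : K →ₐ[k] F) (Λ : F →ₗ[k] K) : Prop :=
  ∀ c x, Λ (σ c * x) = c * Λ x

/-- Through `σ`, the field `F` is a `K`-vector space. Expand the left factor in a basis; the `Λ i`
are the coordinate functions. -/
theorem exists_functional_expansion (σ : K →ₐ[k] F) {M : Type*} [AddCommGroup M] [Module k M]
    (x : F ⊗[k] M) :
    ∃ (ι : Type v) (s : Finset ι) (c : ι → F) (Λ : ι → F →ₗ[k] K), (∀ i, IsLinearOver σ (Λ i)) ∧
      x = ∑ i ∈ s, c i • (σ.toLinearMap.rTensor M) ((Λ i).rTensor M x) := by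
  let := σ.toRingHom.toAlgebra
  have : IsScalarTower k K F := IsScalarTower.of_algebraMap_eq fun r => (σ.commutes r).symm
  let b := Module.Basis.ofVectorSpace K F
  have hsm : ∀ (c : K) (y : F), c • y = σ c * y := fun c y => rfl
  -- The expansion is claimed for all larger index sets so that the sum of two elements can use the
  -- union of theirs.
  suffices h : ∃ s : Finset (Module.Basis.ofVectorSpaceIndex K F), ∀ t, s ⊆ t → x = ∑ i ∈ t, b i • (σ.toLinearMap.rTensor M)
      (((b.coord i).restrictScalars k).rTensor M x) by
    obtain ⟨s, hs⟩ := h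
    refine ⟨_, s, fun i => b i, fun i => (b.coord i).restrictScalars k, fun i c y => ?_,
      hs s subset_rfl⟩
    have := (b.coord i).map_smul c y
    simpa [hsm] using this
  induction x using TensorProduct.induction_on with
  | zero => exact ⟨∅, fun t _ => by simp⟩
  | tmul y m =>
    refine ⟨(b.repr y).support, fun t ht => ?_⟩
    have hy : y = ∑ i ∈ t, b i * σ (b.coord i y) := by
      conv_lhs => rw [← b.linearCombination_repr y, Finsupp.linearCombination_apply,
        Finsupp.sum_of_support_subset _ ht _ (by simp)]
      exact Finset.sum_congr rfl fun i _ => by rw [hsm, mul_comm]; rfl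
    conv_lhs => rw [hy, TensorProduct.sum_tmul]
    refine Finset.sum_congr rfl fun i _ => ?_
    simp [TensorProduct.smul_tmul']
  | add x y hx hy =>
    classical
    obtain ⟨s, hs⟩ := hx
    obtain ⟨s', hs'⟩ := hy
    refine ⟨s ∪ s', fun t ht => ?_⟩
    conv_lhs => rw [hs t (Finset.union_subset_left ht), hs' t (Finset.union_subset_right ht)]
    simp [Finset.sum_add_distrib]

/-- A vector of `F ⊗ M` lies in `F ⊗ X` if all `k`-linear functionals on `F` map it to `X`. -/
theorem mem_baseChange_of_forall {M : Type*} [AddCommGroup M] [Module k M] (X : Submodule k M)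
    (x : F ⊗[k] M) (h : ∀ Λ : F →ₗ[k] k, TensorProduct.lid k M (Λ.rTensor M x) ∈ X) :
    x ∈ X.baseChange F := by
  obtain ⟨ι, s, c, Λ, -, hx⟩ := exists_functional_expansion (Algebra.ofId k F) x
  rw [hx]
  refine Submodule.sum_mem _ fun i _ => Submodule.smul_mem _ _ ?_
  have : ∀ y : k ⊗[k] M, TensorProduct.lid k M y ∈ X →
      ((Algebra.ofId k F).toLinearMap.rTensor M) y ∈ X.baseChange F := by
    intro y hy
    have : y = 1 ⊗ₜ TensorProduct.lid k M y := by
      apply (TensorProduct.lid k M).injective; simp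
    rw [this]
    simpa using Submodule.tmul_mem_baseChange_of_mem (1 : F) hy
  exact this _ (h _)

/-- A condition defined over `k` survives every `k`-linear map on the left factor. It is applied to
`μ = σ' ∘ Λ`, which is neither `F`-linear nor multiplicative. -/
theorem rTensor_mem_baseChange {M : Type*} [AddCommGroup M] [Module k M] {X : Submodule k M}
    {x : F ⊗[k] M} (hx : x ∈ X.baseChange F) (μ : F →ₗ[k] F) :
    μ.rTensor M x ∈ X.baseChange F := by
  rw [Submodule.baseChange_eq_span] at hx
  induction hx using Submodule.closure_induction with
  | zero => simp
  | add x y _ _ hx hy => rw [map_add]; exact add_mem hx hy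
  | smul_mem c x hx =>
    obtain ⟨m, hm, rfl⟩ := hx
    simpa [TensorProduct.smul_tmul'] using Submodule.tmul_mem_baseChange_of_mem _ hm

theorem lid_rTensor_mem {M : Type*} [AddCommGroup M] [Module k M] {X : Submodule k M}
    {x : F ⊗[k] M} (hx : x ∈ X.baseChange F) (Λ : F →ₗ[k] k) :
    TensorProduct.lid k M (Λ.rTensor M x) ∈ X := by
  rw [Submodule.baseChange_eq_span] at hx
  induction hx using Submodule.closure_induction with
  | zero => simp
  | add x y _ _ hx hy => rw [map_add, map_add]; exact add_mem hx hy
  | smul_mem c x hx =>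
    obtain ⟨m, hm, rfl⟩ := hx
    simpa [TensorProduct.smul_tmul'] using X.smul_mem _ hm

variable {A : Type*} [CommRing A] [Algebra k A]

/-- The map `K ⊗ A → F ⊗ A` that a homomorphism `σ : K → F` induces. -/
noncomputable abbrev mapLeft (A : Type*) [CommRing A] [Algebra k A] (σ : K →ₐ[k] F) :
    K ⊗[k] A →ₐ[k] F ⊗[k] A :=
  Algebra.TensorProduct.map σ (AlgHom.id k A)

theorem rTensor_eq_mapLeft (σ : K →ₐ[k] F) (x : K ⊗[k] A) :
    σ.toLinearMap.rTensor A x = mapLeft A σ x := rfl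

/-- Together with `rTensor_mem_of_mem_map`, membership in the conjugate of `I` is tested by the
functionals linear over `σ`. In this direction it yields a functional that keeps a given element
outside of `I`. -/
theorem mem_map_of_forall (σ : K →ₐ[k] F) (I : Ideal (K ⊗[k] A)) (x : F ⊗[k] A)
    (h : ∀ Λ : F →ₗ[k] K, IsLinearOver σ Λ → Λ.rTensor A x ∈ I) :
    x ∈ I.map (mapLeft A σ) := by
  obtain ⟨ι, s, c, Λ, hΛ, hx⟩ := exists_functional_expansion σ x
  rw [hx]
  refine Ideal.sum_mem _ fun i _ => ?_
  rw [Algebra.smul_def]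
  exact Ideal.mul_mem_left _ _ (Ideal.mem_map_of_mem _ (h _ (hΛ i)))

theorem rTensor_mul_mapLeft {σ : K →ₐ[k] F} {Λ : F →ₗ[k] K} (hΛ : IsLinearOver σ Λ)
    (x : F ⊗[k] A) (r : K ⊗[k] A) :
    Λ.rTensor A (x * mapLeft A σ r) = Λ.rTensor A x * r := by
  induction x using TensorProduct.induction_on with
  | zero => simp
  | add x y hx hy => simp only [add_mul, map_add, hx, hy]
  | tmul c a =>
    induction r using TensorProduct.induction_on with
    | zero => simp
    | add x y hx hy => simp only [mul_add, map_add, hx, hy]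
    | tmul d b =>
      simp [mul_comm c, hΛ _ _, mul_comm d]

/-- As `Λ` is linear over `σ`, it induces a `K ⊗ A`-linear map, and the extended ideal is spanned by
products of elements of `F ⊗ A` and images of elements of `I`. -/
theorem rTensor_mem_of_mem_map {σ : K →ₐ[k] F} {Λ : F →ₗ[k] K} (hΛ : IsLinearOver σ Λ)
    {I : Ideal (K ⊗[k] A)} {x : F ⊗[k] A} (hx : x ∈ I.map (mapLeft A σ)) :
    Λ.rTensor A x ∈ I := by
  rw [Ideal.map, Ideal.span] at hx
  induction hx using Submodule.span_induction with
  | zero => simp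
  | add x y _ _ hx hy => rw [map_add]; exact add_mem hx hy
  | mem x hx =>
    obtain ⟨r, hr, rfl⟩ := hx
    rw [← one_mul (mapLeft A σ r)]
    exact (rTensor_mul_mapLeft hΛ 1 r).symm ▸ Ideal.mul_mem_left _ _ hr
  | smul a x hx' hx =>
    -- Knowing that `x` itself goes to `I` says nothing about `a • x`, so a second induction is run
    -- on `x` with `a` arbitrary.
    clear hx
    rw [← Ideal.span] at hx'
    induction hx' using Submodule.span_induction generalizing a with
    | zero => simp
    | add x y _ _ hx hy => rw [smul_add, map_add]; exact add_mem (hx a) (hy a)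
    | mem x hx =>
      obtain ⟨r, hr, rfl⟩ := hx
      exact (rTensor_mul_mapLeft hΛ a r).symm ▸ Ideal.mul_mem_left _ _ hr
    | smul b x _ hx => rw [smul_smul]; exact hx _

end Functionals

/-! ### The splitting of `F ⊗ K` for a finite separable extension -/

section Etale

variable (k K F : Type*) [Field k] [Field K] [Field F] [Algebra k K] [Algebra k F]
  [FiniteDimensional k K] [Algebra.IsSeparable k K] [IsAlgClosed F]

/-- Since `K / k` is étale and `F` is algebraically closed, `F ⊗ K` is a finite product of copies of
`F`. Each factor gives an embedding of `K`, and on the factor `K` acts through this embedding. -/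
theorem exists_idempotents : ∃ e : (K →ₐ[k] F) → F ⊗[k] K, ∑ τ, e τ = 1 ∧
    ∀ τ c, e τ * (1 ⊗ₜ c) = e τ * (τ c ⊗ₜ 1) := by
  classical
  have : Algebra.FormallyEtale k K := Algebra.FormallyEtale.of_isSeparable k K
  let Ψ := Algebra.FormallyEtale.equivPiOfIsSepClosed F (F ⊗[k] K)
  have : Finite (PrimeSpectrum (F ⊗[k] K)) := by
    have : IsArtinianRing (F ⊗[k] K) := isArtinian_of_tower F inferInstance
    infer_instance
  have := Fintype.ofFinite (PrimeSpectrum (F ⊗[k] K))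
  let T : PrimeSpectrum (F ⊗[k] K) → (K →ₐ[k] F) := fun p =>
    ((Pi.evalAlgHom F (fun _ => F) p).comp Ψ.toAlgHom).restrictScalars k |>.comp
      Algebra.TensorProduct.includeRight
  have hT : ∀ p c, T p c = Ψ (1 ⊗ₜ c) p := fun p c => rfl
  -- Summing over the fibres of `T` makes it unnecessary to know that `T` is bijective.
  refine ⟨fun τ => ∑ p with T p = τ, Ψ.symm (Pi.single p 1), ?_, fun τ c => ?_⟩
  · simp only []
    rw [Finset.sum_fiberwise (s := Finset.univ) (g := T) (f := fun p => Ψ.symm (Pi.single p 1)),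
      ← map_sum, Finset.univ_sum_single (fun _ => (1 : F))]
    exact map_one _
  · rw [Finset.sum_mul, Finset.sum_mul]
    refine Finset.sum_congr rfl fun p hp => ?_
    obtain rfl := (Finset.mem_filter.1 hp).2
    apply Ψ.injective
    rw [map_mul, map_mul, AlgEquiv.apply_symm_apply]
    have h1 : Ψ (T p c ⊗ₜ 1) = algebraMap F _ (T p c) := Ψ.commutes (T p c)
    ext q
    rw [h1, Pi.mul_apply, Pi.mul_apply]
    by_cases hq : q = p
    · subst hq
      simp [hT]
    · simp [hq]

variable {k K F} {A : Type*} [CommRing A] [Algebra k A]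

/-- An element of `F ⊗ (K ⊗ A) = ∏ F ⊗ A` lies in `F ⊗ Y` if its components lie in the extensions
of `Y` along the homomorphisms `K → F`. -/
theorem mem_map_includeRight_of_forall (Y : Ideal (K ⊗[k] A)) (ξ : F ⊗[k] (K ⊗[k] A))
    (h : ∀ τ : K →ₐ[k] F, Algebra.TensorProduct.lift (Algebra.ofId F _) (mapLeft A τ)
      (fun _ _ => Commute.all _ _) ξ ∈ Y.map (mapLeft A τ)) :
    ξ ∈ Y.map (Algebra.TensorProduct.includeRight : _ →ₐ[k] F ⊗[k] (K ⊗[k] A)) := by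
  obtain ⟨e, he, hτ⟩ := exists_idempotents k K F
  let m := fun τ : K →ₐ[k] F => Algebra.TensorProduct.lift (Algebra.ofId F (F ⊗[k] A))
    (mapLeft A τ) (fun _ _ => Commute.all _ _)
  let ε := fun τ => Algebra.TensorProduct.map (AlgHom.id k F)
    (Algebra.TensorProduct.includeLeft : K →ₐ[k] K ⊗[k] A) (e τ)
  let ι := Algebra.TensorProduct.map (AlgHom.id k F)
    (Algebra.TensorProduct.includeRight : A →ₐ[k] K ⊗[k] A)
  have hε : ∀ τ c, ε τ * (1 ⊗ₜ (c ⊗ₜ 1)) = ε τ * (τ c ⊗ₜ 1) := fun τ c => by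
    have := congrArg (Algebra.TensorProduct.map (AlgHom.id k F)
      (Algebra.TensorProduct.includeLeft : K →ₐ[k] K ⊗[k] A)) (hτ τ c)
    simpa [ε, Algebra.TensorProduct.one_def] using this
  -- On the component cut out by `ε τ` the factor `K` acts through `τ`, so `ζ` may be replaced there
  -- by its component `m τ ζ`.
  have key : ∀ τ ζ, ε τ * ι (m τ ζ) = ε τ * ζ := by
    intro τ ζ
    induction ζ using TensorProduct.induction_on with
    | zero => simp
    | add x y hx hy => simp only [map_add, mul_add, hx, hy]
    | tmul c b =>
      induction b using TensorProduct.induction_on with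
      | zero => simp
      | add x y hx hy => simp only [map_add, mul_add, hx, hy, TensorProduct.tmul_add]
      | tmul d a =>
        have h1 : m τ (c ⊗ₜ (d ⊗ₜ a)) = (c * τ d) ⊗ₜ a := by
          simp [m, Algebra.ofId_apply, Algebra.TensorProduct.algebraMap_apply]
        have h2 : ι ((c * τ d) ⊗ₜ a) = (τ d ⊗ₜ 1) * (c ⊗ₜ (1 ⊗ₜ a)) := by
          simp [ι, mul_comm]
        have h3 : (c ⊗ₜ (d ⊗ₜ a) : F ⊗[k] (K ⊗[k] A)) =
            (1 ⊗ₜ (d ⊗ₜ 1)) * (c ⊗ₜ (1 ⊗ₜ a)) := by simp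
        rw [h1, h2, h3, ← mul_assoc, ← mul_assoc, hε]
  have hsum : ξ = ∑ τ, ε τ * ι (m τ ξ) := by
    simp_rw [key, ← Finset.sum_mul]
    rw [← map_sum, he, map_one, one_mul]
  rw [hsum]
  refine Ideal.sum_mem _ fun τ _ => ?_
  have hm : m τ ξ ∈ Ideal.span (mapLeft A τ '' (Y : Set (K ⊗[k] A))) := h τ
  rw [Ideal.span] at hm
  generalize m τ ξ = ζ at hm
  induction hm using Submodule.span_induction with
  | zero => simp
  | add x y _ _ hx hy => rw [map_add, mul_add]; exact add_mem hx hy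
  | smul a x _ hx =>
    rw [smul_eq_mul, map_mul, mul_left_comm]
    exact Ideal.mul_mem_left _ _ hx
  | mem x hx =>
    obtain ⟨y, hy, rfl⟩ := hx
    have : mapLeft A τ y = m τ (1 ⊗ₜ y) := by
      simp [m, ← Algebra.TensorProduct.one_def]
    rw [this, key]
    exact Ideal.mul_mem_left _ _ (Ideal.mem_map_of_mem
      (Algebra.TensorProduct.includeRight : _ →ₐ[k] F ⊗[k] (K ⊗[k] A)) hy)

/-- If `b ∈ F ⊗ A` lies in the `τ`-conjugate of `Y` for all `τ ≠ σ₀`, and `Λ : F → K` is linear over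
`σ₀`, then the `σ`-conjugate of `Λ b ∈ K ⊗ A` lies in the `τ`-conjugate of `Y` for all `τ ≠ σ`. -/
theorem mapLeft_rTensor_mem_map (Y : Ideal (K ⊗[k] A)) (σ₀ : K →ₐ[k] F) (b : F ⊗[k] A)
    (hb : ∀ τ : K →ₐ[k] F, τ ≠ σ₀ → b ∈ Y.map (mapLeft A τ)) {Λ : F →ₗ[k] K}
    (hΛ : IsLinearOver σ₀ Λ) {σ τ : K →ₐ[k] F} (hστ : τ ≠ σ) :
    mapLeft A σ (Λ.rTensor A b) ∈ Y.map (mapLeft A τ) := by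
  obtain ⟨α, hα⟩ : ∃ α, σ α ≠ τ α := by
    by_contra! H
    exact hστ (AlgHom.ext fun x => (H x).symm)
  let ι := Algebra.TensorProduct.map (AlgHom.id k F)
    (Algebra.TensorProduct.includeRight : A →ₐ[k] K ⊗[k] A)
  -- The component of `ξ` at `ρ` is `(σ₀ α - ρ α) b`. It vanishes at `ρ = σ₀`, the one place where
  -- nothing is known about `b`, so all components lie in the conjugates of `Y`.
  let ξ : F ⊗[k] (K ⊗[k] A) := (σ₀ α ⊗ₜ 1 - 1 ⊗ₜ (α ⊗ₜ 1)) * ι b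
  have hξ : ξ ∈ Y.map (Algebra.TensorProduct.includeRight : _ →ₐ[k] F ⊗[k] (K ⊗[k] A)) := by
    refine mem_map_includeRight_of_forall Y ξ fun ρ => ?_
    have hι : ∀ x, Algebra.TensorProduct.lift (Algebra.ofId F (F ⊗[k] A)) (mapLeft A ρ)
        (fun _ _ => Commute.all _ _) (ι x) = x := by
      intro x
      induction x using TensorProduct.induction_on with
      | zero => simp
      | add x y hx hy => simp only [map_add, hx, hy]
      | tmul c a => simp [ι, Algebra.ofId_apply, Algebra.TensorProduct.algebraMap_apply]
    rw [map_mul, hι]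
    by_cases hρ : ρ = σ₀
    · subst hρ
      simp [Algebra.ofId_apply, Algebra.TensorProduct.algebraMap_apply]
    · exact Ideal.mul_mem_left _ _ (hb ρ hρ)
  -- After `Λ`, embed the left factor by `σ` and the right one by `τ`. The factor `σ₀ α ⊗ 1 - 1 ⊗ α`
  -- turns into the scalar `σ α - τ α`, which is invertible by the choice of `α`.
  let θ : K ⊗[k] (K ⊗[k] A) →ₐ[k] F ⊗[k] A := Algebra.TensorProduct.lift
    ((Algebra.TensorProduct.includeLeft : F →ₐ[k] F ⊗[k] A).comp σ) (mapLeft A τ)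
    (fun _ _ => Commute.all _ _)
  have hmem : ∀ ζ ∈ Y.map (Algebra.TensorProduct.includeRight : _ →ₐ[k] F ⊗[k] (K ⊗[k] A)),
      θ (Λ.rTensor _ ζ) ∈ Y.map (mapLeft A τ) := by
    intro ζ hζ
    rw [Ideal.map, Ideal.span] at hζ
    induction hζ using Submodule.closure_induction with
    | zero => simp
    | add x y _ _ hx hy => rw [map_add, map_add]; exact add_mem hx hy
    | smul_mem c x hx =>
      obtain ⟨y, hy, rfl⟩ := hx
      induction c using TensorProduct.induction_on with
      | zero => simp
      | add x y hx hy => rw [add_smul, map_add, map_add]; exact add_mem hx hy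
      | tmul c r =>
        have : Λ.rTensor _ ((c ⊗ₜ[k] r) • (Algebra.TensorProduct.includeRight :
            K ⊗[k] A →ₐ[k] F ⊗[k] (K ⊗[k] A)) y) = Λ c ⊗ₜ (r * y) := by simp
        rw [this, Algebra.TensorProduct.lift_tmul]
        exact Ideal.mul_mem_left _ _ (Ideal.mem_map_of_mem _ (Ideal.mul_mem_left _ _ hy))
  have hθ : θ (Λ.rTensor _ ξ) = ((σ α - τ α) ⊗ₜ 1) * mapLeft A σ (Λ.rTensor A b) := by
    simp only [ξ]
    clear hξ hb ξ
    induction b using TensorProduct.induction_on with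
    | zero => simp
    | add x y hx hy => simp only [map_add, mul_add, hx, hy]
    | tmul c a =>
      simp [ι, sub_mul, θ, hΛ _ _, TensorProduct.sub_tmul, Algebra.TensorProduct.one_def,
        mul_comm (τ α)]
  have h := hmem ξ hξ
  rw [hθ] at h
  have h2 := Ideal.mul_mem_left _ (((σ α - τ α)⁻¹ ⊗ₜ 1 : F ⊗[k] A)) h
  rw [← mul_assoc, Algebra.TensorProduct.tmul_mul_tmul,
    inv_mul_cancel₀ (sub_ne_zero.2 hα), mul_one, ← Algebra.TensorProduct.one_def, one_mul] at h2
  exact h2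

end Etale

end SeveriBrauer

namespace SeveriBrauer

/-! ### Homogeneous polynomials and their factors -/

section Homogeneous

open Polynomial in
-- Forms of degree `n` are sums of products of `n` linear forms, and a linear form takes `a + T b`
-- to a polynomial of degree at most one with leading term its value at `b`.
theorem natDegree_aeval_le_and_coeff {R ι : Type*} [CommRing R] {B : Type*} [CommRing B]
    [Algebra R B] (a b : ι → B) {n : ℕ} {p : MvPolynomial ι R} (hp : p.IsHomogeneous n) :
    (MvPolynomial.aeval (fun i => C (a i) + X * C (b i)) p : B[X]).natDegree ≤ n ∧
      (MvPolynomial.aeval (fun i => C (a i) + X * C (b i)) p : B[X]).coeff n =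
        MvPolynomial.aeval b p := by
  rw [← MvPolynomial.mem_homogeneousSubmodule, ← MvPolynomial.homogeneousSubmodule_one_pow] at hp
  induction hp using Submodule.pow_induction_on_left' with
  | algebraMap r => simp [Polynomial.algebraMap_apply]
  | add x y i hx hy h1 h2 =>
    rw [map_add, map_add, coeff_add, h1.2, h2.2]
    exact ⟨natDegree_add_le_of_degree_le h1.1 h2.1, rfl⟩
  | mem_mul m hm i x hx h =>
    have hm' : (MvPolynomial.aeval (fun i => C (a i) + X * C (b i)) m : B[X]).natDegree ≤ 1 ∧
      (MvPolynomial.aeval (fun i => C (a i) + X * C (b i)) m : B[X]).coeff 1 =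
        MvPolynomial.aeval b m := by
      rw [MvPolynomial.homogeneousSubmodule_one_eq_span_X] at hm
      induction hm using Submodule.span_induction with
      | zero => simp
      | mem x hx =>
        obtain ⟨j, rfl⟩ := hx
        rw [MvPolynomial.aeval_X, MvPolynomial.aeval_X]
        refine ⟨?_, by simp⟩
        rw [add_comm, mul_comm]
        exact natDegree_linear_le
      | add x y hx hy h1 h2 =>
        rw [map_add, map_add, coeff_add, h1.2, h2.2]
        exact ⟨natDegree_add_le_of_degree_le h1.1 h2.1, rfl⟩
      | smul r x hx h1 =>
        rw [map_smul, map_smul, coeff_smul, h1.2]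
        exact ⟨(natDegree_smul_le _ _).trans h1.1, rfl⟩
    rw [map_mul, map_mul, Nat.succ_eq_one_add, coeff_mul_add_eq_of_natDegree_le hm'.1 h.1,
      hm'.2, h.2]
    exact ⟨natDegree_mul_le.trans (add_le_add hm'.1 h.1), rfl⟩

variable {R ι : Type*} [CommRing R]

/-- The substitution `x_i ↦ x_i T`. -/
noncomputable def scaleVar (R ι : Type*) [CommRing R] :
    MvPolynomial ι R →ₐ[R] Polynomial (MvPolynomial ι R) :=
  MvPolynomial.aeval (fun i => Polynomial.X * Polynomial.C (MvPolynomial.X i))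

theorem scaleVar_of_isHomogeneous {n : ℕ} {p : MvPolynomial ι R} (hp : p.IsHomogeneous n) :
    scaleVar R ι p = Polynomial.C p * Polynomial.X ^ n := by
  rw [p.as_sum, map_sum, map_sum, Finset.sum_mul]
  refine Finset.sum_congr rfl fun s hs => ?_
  have hdeg : s.degree = n := by
    rw [Finsupp.degree_eq_weight_one (R := ℕ)]
    exact hp (MvPolynomial.mem_support_iff.1 hs)
  rw [scaleVar, MvPolynomial.aeval_monomial]
  simp_rw [mul_pow]
  rw [Finsupp.prod_mul, MvPolynomial.monomial_eq, map_mul, Finsupp.prod, Finset.prod_pow_eq_pow_sum,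
    ← hdeg, Finsupp.degree_apply]
  simp only [Polynomial.algebraMap_apply, MvPolynomial.algebraMap_eq, Finsupp.prod, map_prod,
    map_pow]
  ring

theorem coeff_scaleVar (p : MvPolynomial ι R) (n : ℕ) :
    (scaleVar R ι p).coeff n = MvPolynomial.homogeneousComponent n p := by
  conv_lhs => rw [← MvPolynomial.sum_homogeneousComponent p, map_sum, Polynomial.finsetSum_coeff]
  simp_rw [scaleVar_of_isHomogeneous (MvPolynomial.homogeneousComponent_isHomogeneous _ p),
    Polynomial.coeff_C_mul_X_pow]
  rw [Finset.sum_ite_eq]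
  split_ifs with h
  · rfl
  · rw [MvPolynomial.homogeneousComponent_eq_zero]
    simpa [Nat.lt_succ_iff] using h

/-- The coefficients of `scaleVar` are the homogeneous components; if the highest and lowest
exponents agree, there is only one. -/
theorem isHomogeneous_of_natDegree_eq {p : MvPolynomial ι R}
    (h : (scaleVar R ι p).natDegree = (scaleVar R ι p).natTrailingDegree) :
    p.IsHomogeneous (scaleVar R ι p).natDegree := by
  have : p = MvPolynomial.homogeneousComponent (scaleVar R ι p).natDegree p := by
    conv_lhs => rw [← MvPolynomial.sum_homogeneousComponent p]
    have h0 : ∀ i, i ≠ (scaleVar R ι p).natDegree → MvPolynomial.homogeneousComponent i p = 0 := by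
      intro i hi
      rw [← coeff_scaleVar]
      rcases hi.lt_or_gt with h1 | h1
      · exact Polynomial.coeff_eq_zero_of_lt_natTrailingDegree (h ▸ h1)
      · exact Polynomial.coeff_eq_zero_of_natDegree_lt h1
    refine Finset.sum_eq_single _ (fun i _ hi => h0 i hi) fun hi => ?_
    rw [MvPolynomial.homogeneousComponent_eq_zero]
    simpa [Nat.lt_succ_iff] using hi
  rw [this]
  convert MvPolynomial.homogeneousComponent_isHomogeneous _ _
  rw [← this]

theorem scaleVar_injective : Function.Injective (scaleVar R ι) := by
  intro p q h
  ext d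
  have := congrArg (fun r => (r.coeff d.degree).coeff d) h
  simpa [coeff_scaleVar, MvPolynomial.coeff_homogeneousComponent] using this

/-- The factors of a non-zero homogeneous polynomial are homogeneous. -/
theorem isHomogeneous_of_mul [IsDomain R] {n : ℕ} {p q : MvPolynomial ι R}
    (h : (p * q).IsHomogeneous n) (h0 : p * q ≠ 0) :
    ∃ i j, i + j = n ∧ p.IsHomogeneous i ∧ q.IsHomogeneous j := by
  have hp : scaleVar R ι p ≠ 0 := fun h' =>
    h0 (by rw [scaleVar_injective (h'.trans (map_zero _).symm), zero_mul])
  have hq : scaleVar R ι q ≠ 0 := fun h' =>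
    h0 (by rw [scaleVar_injective (h'.trans (map_zero _).symm), mul_zero])
  have hm : scaleVar R ι p * scaleVar R ι q = Polynomial.monomial n (p * q) := by
    rw [← map_mul, scaleVar_of_isHomogeneous h, Polynomial.C_mul_X_pow_eq_monomial]
  -- Degree and order in `T` are both additive. They agree for the product and the order never
  -- exceeds the degree, hence they agree for each factor.
  have h1 := Polynomial.natDegree_mul hp hq
  have h2 := Polynomial.natTrailingDegree_mul hp hq
  rw [hm, Polynomial.natDegree_monomial_eq _ h0] at h1
  rw [hm, Polynomial.natTrailingDegree_monomial h0] at h2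
  have h3 := (scaleVar R ι p).natTrailingDegree_le_natDegree
  have h4 := (scaleVar R ι q).natTrailingDegree_le_natDegree
  exact ⟨_, _, h1.symm, isHomogeneous_of_natDegree_eq (by omega),
    isHomogeneous_of_natDegree_eq (by omega)⟩

/-- By the pigeonhole principle, a monomial of this degree is divisible by the `e`-th power of a
variable. -/
theorem exists_le_of_degree_eq {N e : ℕ} (s : Fin (N + 1) →₀ ℕ)
    (hs : s.degree = e * (N + 1)) : ∃ i, e ≤ s i := by
  by_contra! h
  have : s.degree < e * (N + 1) := by
    rw [Finsupp.degree_eq_sum]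
    calc ∑ i, s i < ∑ _i : Fin (N + 1), e := Finset.sum_lt_sum_of_nonempty ⟨0, by simp⟩ fun i _ => h i
      _ = e * (N + 1) := by simp [mul_comm]
  omega

theorem aeval_mem_pow_of_isHomogeneous {B : Type*} [CommRing B] [Algebra R B] {J : Ideal B}
    {a : ι → B} (ha : ∀ i, a i ∈ J) {n : ℕ} {p : MvPolynomial ι R} (hp : p.IsHomogeneous n) :
    MvPolynomial.aeval a p ∈ J ^ n := by
  rw [← MvPolynomial.mem_homogeneousSubmodule, ← MvPolynomial.homogeneousSubmodule_one_pow] at hp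
  induction hp using Submodule.pow_induction_on_left' with
  | algebraMap r => simp
  | add x y i hx hy h1 h2 => rw [map_add]; exact add_mem h1 h2
  | mem_mul m hm i x hx h =>
    rw [map_mul, pow_succ']
    refine Ideal.mul_mem_mul ?_ h
    rw [MvPolynomial.homogeneousSubmodule_one_eq_span_X] at hm
    induction hm using Submodule.span_induction with
    | zero => simp
    | mem x hx => obtain ⟨j, rfl⟩ := hx; simpa using ha j
    | add x y hx hy h1 h2 => rw [map_add]; exact add_mem h1 h2
    | smul r x hx h1 =>
      rw [map_smul, Algebra.smul_def]; exact Ideal.mul_mem_left _ _ h1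

theorem aeval_mul_of_isHomogeneous {B : Type*} [CommRing B] [Algebra R B] (c : B) (a : ι → B)
    {n : ℕ} {p : MvPolynomial ι R} (hp : p.IsHomogeneous n) :
    MvPolynomial.aeval (fun i => c * a i) p = c ^ n * MvPolynomial.aeval a p := by
  rw [p.as_sum, map_sum, map_sum, Finset.mul_sum]
  refine Finset.sum_congr rfl fun s hs => ?_
  have hdeg : s.degree = n := by
    rw [Finsupp.degree_eq_weight_one (R := ℕ)]
    exact hp (MvPolynomial.mem_support_iff.1 hs)
  rw [MvPolynomial.aeval_monomial, MvPolynomial.aeval_monomial]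
  simp_rw [mul_pow]
  rw [Finsupp.prod_mul, Finsupp.prod, Finset.prod_pow_eq_pow_sum,
    ← hdeg, Finsupp.degree_apply]
  ring

end Homogeneous

/-! ### Forms, projections, and order of vanishing along a linear subspace -/

section Matrices

variable {F : Type*} [Field F] {N : ℕ}

/-- The substitution `x ↦ E x` in a polynomial. -/
noncomputable def matSubst (E : Matrix (Fin (N + 1)) (Fin (N + 1)) F) :
    MvPolynomial (Fin (N + 1)) F →ₐ[F] MvPolynomial (Fin (N + 1)) F :=
  MvPolynomial.aeval (fun i => ∑ j, MvPolynomial.C (E i j) * MvPolynomial.X j)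

theorem matSubst_X (E : Matrix (Fin (N + 1)) (Fin (N + 1)) F) (i : Fin (N + 1)) :
    matSubst E (MvPolynomial.X i) = ∑ j, MvPolynomial.C (E i j) * MvPolynomial.X j := by
  simp [matSubst]

theorem matSubst_one : matSubst (1 : Matrix (Fin (N + 1)) (Fin (N + 1)) F) = AlgHom.id F _ := by
  ext i : 1
  rw [matSubst_X, Finset.sum_eq_single i] <;> simp +contextual [eq_comm]

theorem matSubst_matSubst (E E' : Matrix (Fin (N + 1)) (Fin (N + 1)) F)
    (p : MvPolynomial (Fin (N + 1)) F) :
    matSubst E' (matSubst E p) = matSubst (E * E') p := by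
  have : (matSubst E').comp (matSubst E) = matSubst (E * E') := by
    ext i : 1
    simp only [AlgHom.comp_apply, matSubst_X, map_sum, map_mul, Matrix.mul_apply, Finset.sum_mul,
      Finset.mul_sum, ← MvPolynomial.algebraMap_eq, AlgHom.commutes]
    rw [Finset.sum_comm]
    simp [mul_assoc]
  exact DFunLike.congr_fun this p

theorem isHomogeneous_matSubst (E : Matrix (Fin (N + 1)) (Fin (N + 1)) F) {n : ℕ}
    {p : MvPolynomial (Fin (N + 1)) F} (hp : p.IsHomogeneous n) :
    (matSubst E p).IsHomogeneous n := by
  have := hp.aeval (n := 1) (fun i => ∑ j, MvPolynomial.C (E i j) * MvPolynomial.X j)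
    (fun i => MvPolynomial.IsHomogeneous.sum _ _ _ fun j _ =>
        MvPolynomial.isHomogeneous_C_mul_X _ _)
  simpa [matSubst] using this

/-- The substitution `x ↦ E x + T (x - E x)` in a polynomial. -/
noncomputable def degenerate (E : Matrix (Fin (N + 1)) (Fin (N + 1)) F) :
    MvPolynomial (Fin (N + 1)) F →ₐ[F] Polynomial (MvPolynomial (Fin (N + 1)) F) :=
  MvPolynomial.aeval (fun i => Polynomial.C (matSubst E (MvPolynomial.X i)) +
    Polynomial.X * Polynomial.C (matSubst (1 - E) (MvPolynomial.X i)))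

/-- Setting `T = 0` contracts space onto the image of `E`. Thus the power of `T` that divides
`degenerate E p` measures the vanishing of `p` along that image. -/
theorem X_dvd_degenerate_iff (E : Matrix (Fin (N + 1)) (Fin (N + 1)) F)
    (p : MvPolynomial (Fin (N + 1)) F) :
    Polynomial.X ∣ degenerate E p ↔ matSubst E p = 0 := by
  have h : ((Polynomial.aeval 0 : Polynomial (MvPolynomial (Fin (N + 1)) F) →ₐ[MvPolynomial _ F]
      _).restrictScalars F).comp (degenerate E) = matSubst E := by
    ext i : 1
    simp [degenerate]
  rw [Polynomial.X_dvd_iff, Polynomial.coeff_zero_eq_eval_zero, ← Polynomial.coe_aeval_eq_eval,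
    ← DFunLike.congr_fun h p]
  rfl

theorem eval_one_degenerate (E : Matrix (Fin (N + 1)) (Fin (N + 1)) F)
    (p : MvPolynomial (Fin (N + 1)) F) : (degenerate E p).eval 1 = p := by
  have h : ((Polynomial.aeval 1 : Polynomial (MvPolynomial (Fin (N + 1)) F) →ₐ[MvPolynomial _ F]
      _).restrictScalars F).comp (degenerate E) = AlgHom.id F _ := by
    ext i : 1
    have : matSubst E (MvPolynomial.X i) + matSubst (1 - E) (MvPolynomial.X i) =
        matSubst 1 (MvPolynomial.X i) := by
      simp_rw [matSubst_X, ← Finset.sum_add_distrib, ← add_mul, ← map_add]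
      simp
    simpa [degenerate, matSubst_one] using this
  exact DFunLike.congr_fun h p

/-- A form of degree `n` that vanishes to order `n` along the image of `E` is a form in the
coordinates of `1 - E`. -/
theorem matSubst_one_sub_of_X_pow_dvd (E : Matrix (Fin (N + 1)) (Fin (N + 1)) F) {n : ℕ}
    {p : MvPolynomial (Fin (N + 1)) F} (hp : p.IsHomogeneous n)
    (h : Polynomial.X ^ n ∣ degenerate E p) : matSubst (1 - E) p = p := by
  have h1 := natDegree_aeval_le_and_coeff (fun i => matSubst E (MvPolynomial.X i))
    (fun i => matSubst (1 - E) (MvPolynomial.X i)) hp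
  change (degenerate E p).natDegree ≤ n ∧ (degenerate E p).coeff n = _ at h1
  -- The degree in `T` is at most `n` and `T ^ n` divides, so only one term is left; its coefficient
  -- is `p` at `x - E x`. Setting `T = 1` gives back `p`.
  have h2 : degenerate E p = Polynomial.C ((degenerate E p).coeff n) * Polynomial.X ^ n := by
    ext1 i
    rw [Polynomial.coeff_C_mul_X_pow]
    split_ifs with hi
    · rw [hi]
    · rcases Nat.lt_or_gt_of_ne hi with hi | hi
      · exact Polynomial.X_pow_dvd_iff.1 h i hi
      · exact Polynomial.coeff_eq_zero_of_natDegree_lt (h1.1.trans_lt hi)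
  have h3 := congrArg (Polynomial.eval 1) h2
  rw [eval_one_degenerate] at h3
  simp only [Polynomial.eval_mul, Polynomial.eval_C, Polynomial.eval_pow, Polynomial.eval_X,
    one_pow, mul_one] at h3
  rw [h1.2] at h3
  rw [h3]
  conv_lhs => rw [← h3]
  simp [matSubst]

end Matrices

end SeveriBrauer

namespace SeveriBrauer

/-! ### Regular functions and sections on projective space -/

section RegularFunctions

variable {F : Type u} [Field F] {N : ℕ} {𝓕 : Type w} [Field 𝓕]
  [Algebra (MvPolynomial (Fin (N + 1)) F) 𝓕]

/-- The rational function `b` on projective space is regular at `y`. -/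
def RegularAt (y : ProjectiveSpectrum (grading N F)) (b : 𝓕) : Prop :=
  ∃ (n : ℕ) (p q : MvPolynomial (Fin (N + 1)) F), p.IsHomogeneous n ∧ q.IsHomogeneous n ∧
    q ∉ y.asHomogeneousIdeal ∧ b * algebraMap _ 𝓕 q = algebraMap _ 𝓕 p

theorem mul_notMem {y : ProjectiveSpectrum (grading N F)} {p q : MvPolynomial (Fin (N + 1)) F}
    (hp : p ∉ y.asHomogeneousIdeal) (hq : q ∉ y.asHomogeneousIdeal) :
    p * q ∉ y.asHomogeneousIdeal := fun h =>
  (y.isPrime.mem_or_mem h).elim hp hq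

theorem RegularAt.mul {y : ProjectiveSpectrum (grading N F)} {b c : 𝓕} (hb : RegularAt y b)
    (hc : RegularAt y c) : RegularAt y (b * c) := by
  obtain ⟨n, p, q, hp, hq, hy, h⟩ := hb
  obtain ⟨n', p', q', hp', hq', hy', h'⟩ := hc
  refine ⟨_, _, _, hp.mul hp', hq.mul hq', mul_notMem hy hy', ?_⟩
  rw [map_mul, map_mul, ← h, ← h']
  ring

theorem exists_X_notMem {R : Type u} [CommRing R] (y : ProjectiveSpectrum (grading N R)) :
    ∃ i, (MvPolynomial.X i : MvPolynomial (Fin (N + 1)) R) ∉ y.asHomogeneousIdeal := by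
  by_contra! h
  refine y.not_irrelevant_le ?_
  rw [HomogeneousIdeal.irrelevant_le]
  intro d hd x hx
  change x ∈ y.asHomogeneousIdeal.toIdeal
  rw [x.as_sum]
  refine Ideal.sum_mem _ fun s hs => ?_
  have hdeg : s.degree = d := by
    rw [Finsupp.degree_eq_weight_one (R := ℕ)]
    exact hx (MvPolynomial.mem_support_iff.1 hs)
  have hs0 : s ≠ 0 := by
    rintro rfl
    simp at hdeg
    omega
  obtain ⟨j, hj⟩ := Finsupp.ne_iff.1 hs0
  exact Ideal.mem_of_dvd _ (MvPolynomial.X_dvd_monomial.2 (Or.inr (by simpa using hj))) (h j)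

variable [IsFractionRing (MvPolynomial (Fin (N + 1)) F) 𝓕]

/-- The denominator of a reduced fraction divides every other denominator, so it cannot vanish where
the function is regular. -/
theorem dvd_of_regularAt {y : ProjectiveSpectrum (grading N F)} {b : 𝓕} (hb : RegularAt y b)
    {f g : MvPolynomial (Fin (N + 1)) F} (hfg : IsRelPrime f g)
    (h : b * algebraMap _ 𝓕 f = algebraMap _ 𝓕 g) : f ∉ y.asHomogeneousIdeal := by
  obtain ⟨n, p, q, hp, hq, hy, h'⟩ := hb
  intro hf
  apply hy
  have : g * q = f * p := by
    apply IsFractionRing.injective _ 𝓕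
    rw [map_mul, map_mul, ← h, ← h']
    ring
  exact Ideal.mem_of_dvd _ (hfg.dvd_of_dvd_mul_left (Dvd.intro _ this.symm)) hf

end RegularFunctions

section OneVariable

theorem eq_C_mul_X_pow {F : Type*} [CommRing F] {p : MvPolynomial (Fin (0 + 1)) F} {n : ℕ}
    (hp : p.IsHomogeneous n) : ∃ c, p = MvPolynomial.C c * MvPolynomial.X 0 ^ n := by
  refine ⟨p.coeff (Finsupp.single 0 n), ?_⟩
  ext s
  rw [MvPolynomial.coeff_C_mul, MvPolynomial.coeff_X_pow]
  split_ifs with h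
  · rw [h, mul_one]
  · rw [mul_zero]
    by_contra h'
    apply h
    have : s.degree = n := by
      rw [Finsupp.degree_eq_weight_one (R := ℕ)]
      exact hp h'
    ext i
    fin_cases i
    rw [Finsupp.degree_eq_sum] at this
    simpa using this.symm

end OneVariable

section PrimePoint

variable {F : Type u} [Field F] {N : ℕ}

/-- A homogeneous prime polynomial is the generic point of a hypersurface. -/
theorem exists_point_of_prime (hN : N ≠ 0) {π : MvPolynomial (Fin (N + 1)) F} (hπ : Prime π)
    {d : ℕ} (hd : π.IsHomogeneous d) :
    ∃ y : ProjectiveSpectrum (grading N F), ∀ q, q ∈ y.asHomogeneousIdeal ↔ π ∣ q := by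
  have hom : (Ideal.span {π}).IsHomogeneous (grading N F) :=
    Ideal.homogeneous_span _ _ fun x hx => ⟨d, by rw [Set.mem_singleton_iff.1 hx]; exact hd⟩
  refine ⟨⟨⟨Ideal.span {π}, hom⟩, (Ideal.span_singleton_prime hπ.ne_zero).2 hπ, fun hle => ?_⟩,
    fun q => Ideal.mem_span_singleton⟩
  have h : ∀ i : Fin (N + 1), π ∣ MvPolynomial.X i := fun i =>
    Ideal.mem_span_singleton.1 (hle (HomogeneousIdeal.mem_irrelevant_of_mem (grading N F) one_pos
        (MvPolynomial.isHomogeneous_X F i)))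
  have h0 : Associated π (MvPolynomial.X 0) := hπ.associated_of_dvd (MvPolynomial.X_prime) (h 0)
  have h1 := h0.dvd'.trans (h (Fin.last N))
  rw [MvPolynomial.X_dvd_X, Fin.ext_iff] at h1
  exact hN (by simpa using h1.symm)

variable {𝓕 : Type w} [Field 𝓕] [Algebra (MvPolynomial (Fin (N + 1)) F) 𝓕]
  [IsFractionRing (MvPolynomial (Fin (N + 1)) F) 𝓕]

/-- A rational section of `𝒪(n)` that is regular everywhere is a form of degree `n`. -/
theorem exists_eq_of_forall_regular (y₀ : ProjectiveSpectrum (grading N F)) (n : ℕ) (β : 𝓕)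
    (h : ∀ y : ProjectiveSpectrum (grading N F), ∃ (d : ℕ) (P Q : MvPolynomial (Fin (N + 1)) F),
      P.IsHomogeneous (d + n) ∧ Q.IsHomogeneous d ∧ Q ∉ y.asHomogeneousIdeal ∧
        β * algebraMap _ 𝓕 Q = algebraMap _ 𝓕 P) :
    ∃ p : MvPolynomial (Fin (N + 1)) F, p.IsHomogeneous n ∧ β = algebraMap _ 𝓕 p := by
  have hinj := IsFractionRing.injective (MvPolynomial (Fin (N + 1)) F) 𝓕
  obtain ⟨d, P, Q, hP, hQ, hy, hβ⟩ := h y₀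
  have hQ0 : Q ≠ 0 := fun h => hy (h ▸ zero_mem _)
  by_cases hP0 : P = 0
  · refine ⟨0, MvPolynomial.isHomogeneous_zero _ _ _, ?_⟩
    rw [hP0, map_zero, mul_eq_zero, map_eq_zero_iff _ hinj] at hβ
    simpa [hQ0] using hβ
  obtain ⟨a, b, c, hab, rfl, rfl⟩ := UniqueFactorizationMonoid.exists_reduced_factors Q hQ0 P
  have hc0 : c ≠ 0 := left_ne_zero_of_mul hQ0
  have ha0 : a ≠ 0 := right_ne_zero_of_mul hQ0
  obtain ⟨i, d₁, hid, hci, had⟩ := isHomogeneous_of_mul hQ hQ0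
  obtain ⟨i', d₂, hid', hci', hbd⟩ := isHomogeneous_of_mul hP hP0
  obtain rfl : i = i' := hci.inj_right hci' hc0
  have hβ' : β * algebraMap _ 𝓕 a = algebraMap _ 𝓕 b := by
    rw [map_mul, map_mul] at hβ
    refine mul_left_cancel₀ ((map_ne_zero_iff _ hinj).2 hc0) ?_
    rw [← hβ]
    ring
  -- A prime factor of the reduced denominator would be the generic point of a hypersurface along
  -- which the section is not regular. For `N = 0` there are no hypersurfaces, but all forms are
  -- monomials and `a` divides `b`.
  have hunit : IsUnit a := by
    by_cases hN : N = 0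
    · subst hN
      obtain ⟨s, hs⟩ := eq_C_mul_X_pow had
      obtain ⟨t, ht⟩ := eq_C_mul_X_pow hbd
      have hs0 : s ≠ 0 := by rintro rfl; simp [hs] at ha0
      refine hab dvd_rfl ⟨MvPolynomial.C (t / s) * MvPolynomial.X 0 ^ n, ?_⟩
      have : d₂ = d₁ + n := by omega
      rw [ht, hs, this, pow_add, mul_mul_mul_comm, ← map_mul, mul_div_cancel₀ _ hs0]
    · by_contra hu
      obtain ⟨π, hπ, hπa⟩ := WfDvdMonoid.exists_irreducible_factor hu ha0
      obtain ⟨r, rfl⟩ := hπa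
      obtain ⟨e, -, -, he, -⟩ := isHomogeneous_of_mul had ha0
      obtain ⟨y, hyπ⟩ := exists_point_of_prime hN hπ.prime he
      obtain ⟨d', P', Q', -, -, hQ', hβQ⟩ := h y
      have : b * Q' = π * (r * P') := by
        apply hinj
        rw [map_mul, ← hβ', ← mul_assoc π, map_mul _ _ P', ← hβQ]
        ring
      rw [hyπ] at hQ'
      rcases hπ.prime.dvd_or_dvd (Dvd.intro _ this.symm) with h' | h'
      · exact hπ.not_isUnit (hab (dvd_mul_right _ _) h')
      · exact hQ' h'
  obtain ⟨s, hs, rfl⟩ := MvPolynomial.isUnit_iff_eq_C_of_isReduced.1 hunit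
  obtain rfl : d₁ = 0 := had.inj_right (MvPolynomial.isHomogeneous_C _ _) ha0
  obtain rfl : d₂ = n := by omega
  refine ⟨MvPolynomial.C s⁻¹ * b, hbd.C_mul _, ?_⟩
  rw [map_mul, ← hβ', mul_left_comm, ← map_mul, ← map_mul, inv_mul_cancel₀ hs.ne_zero]
  simp

end PrimePoint

end SeveriBrauer

/-! ### Functions with bounded poles on a form of projective space -/

namespace SeveriBrauer

/-- The function field `Ω` of a form of projective space over `k`, the `k`-spaces `G V ⊆ Ω` of
functions on the charts `V` of a covering, and the sets `O V` of points of projective space over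
`F` in these charts. -/
structure RationalCharts (k F : Type u) [Field k] [Field F] [Algebra k F] (N : ℕ)
    (Ω : Type u) [Field Ω] [Algebra k Ω] (𝓕 : Type u) [Field 𝓕]
    [Algebra (MvPolynomial (Fin (N + 1)) F) 𝓕] [Algebra F 𝓕] where
  E : F ⊗[k] Ω →ₐ[F] 𝓕
  injective : Function.Injective E
  ι : Type u
  G : ι → Submodule k Ω
  O : ι → Set (ProjectiveSpectrum (grading N F))
  cover : ∀ y, ∃ V, y ∈ O V
  mem_iff : ∀ V b, (∃ x ∈ (G V).baseChange F, E x = b) ↔ ∀ y ∈ O V, RegularAt y b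
  exists_denom : ∀ V, ∀ y ∈ O V, ∀ b, RegularAt y b → ∃ x ∈ (G V).baseChange F,
    ∃ s ∈ (G V).baseChange F, E s * b = E x ∧ E s ≠ 0 ∧ RegularAt y (E s) ∧ RegularAt y (E s)⁻¹

namespace RationalCharts

variable {k F : Type u} [Field k] [Field F] [Algebra k F] {N : ℕ}
    {Ω : Type u} [Field Ω] [Algebra k Ω] {𝓕 : Type u} [Field 𝓕]
    [Algebra (MvPolynomial (Fin (N + 1)) F) 𝓕] [Algebra F 𝓕]
    (D : RationalCharts k F N Ω 𝓕)

/-- If `u` has the divisor of poles `H`, these are the functions with poles bounded by `j H`. -/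
def Bounded (u : Ω) (j : ℕ) (b : F ⊗[k] Ω) : Prop :=
  ∀ V, ∀ c ∈ D.G V, c * u ^ j ∈ D.G V → (1 ⊗ₜ c) * b ∈ (D.G V).baseChange F

theorem one_tmul_mul_rTensor (μ : F →ₗ[k] F) (c : Ω) (b : F ⊗[k] Ω) :
    (1 ⊗ₜ c) * μ.rTensor Ω b = μ.rTensor Ω ((1 ⊗ₜ c) * b) := by
  induction b using TensorProduct.induction_on with
  | zero => simp
  | add x y hx hy => simp only [map_add, mul_add, hx, hy]
  | tmul x a => simp

variable {D} in
-- The bound on the poles only involves the `k`-spaces `G V` and elements of `Ω`, so it is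
-- insensitive to `k`-linear maps on `F`.
theorem Bounded.rTensor {u : Ω} {j : ℕ} {b : F ⊗[k] Ω} (hb : D.Bounded u j b) (μ : F →ₗ[k] F) :
    D.Bounded u j (μ.rTensor Ω b) := fun V c hc hu => by
  rw [one_tmul_mul_rTensor]
  exact rTensor_mem_baseChange (hb V c hc hu) μ

theorem lid_rTensor_mul (Λ : F →ₗ[k] k) (c : F ⊗[k] Ω) (a : Ω) :
    TensorProduct.lid k Ω (Λ.rTensor Ω c) * a =
      TensorProduct.lid k Ω (Λ.rTensor Ω (c * (1 ⊗ₜ a))) := by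
  induction c using TensorProduct.induction_on with
  | zero => simp
  | add x y hx hy => simp only [map_add, add_mul, hx, hy]
  | tmul x b => simp

variable {D} in
-- The definition tests only with functions `c` over `k`. The admissible `c` form a `k`-subspace,
-- and tests with elements of `F ⊗ G V` follow because the condition on `c` is detected by
-- functionals on `F`.
theorem Bounded.mul_mem {u : Ω} {j : ℕ} {b : F ⊗[k] Ω} (hb : D.Bounded u j b) {V : D.ι}
    {c : F ⊗[k] Ω} (hc : c ∈ (D.G V).baseChange F)
    (hu : c * (1 ⊗ₜ (u ^ j)) ∈ (D.G V).baseChange F) : c * b ∈ (D.G V).baseChange F := by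
  have h : c ∈ (D.G V ⊓ (D.G V).comap (LinearMap.mulRight k (u ^ j))).baseChange F := by
    refine mem_baseChange_of_forall _ _ fun Λ => ⟨lid_rTensor_mem hc Λ, ?_⟩
    rw [SetLike.mem_coe, Submodule.mem_comap, LinearMap.mulRight_apply, lid_rTensor_mul]
    exact lid_rTensor_mem hu Λ
  rw [Submodule.baseChange_eq_span] at h
  clear hc hu
  induction h using Submodule.span_induction with
  | zero => simp
  | add x y _ _ hx hy => rw [add_mul]; exact add_mem hx hy
  | smul a x _ hx => rw [smul_mul_assoc]; exact Submodule.smul_mem _ _ hx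
  | mem x hx =>
    obtain ⟨m, hm, rfl⟩ := hx
    exact hb V m hm.1 hm.2

variable {D} in
-- That the functions on a chart form a ring is not a field of the structure; it is recovered from
-- the description by regularity.
theorem mul_mem_baseChange {V : D.ι} {x y : F ⊗[k] Ω} (hx : x ∈ (D.G V).baseChange F)
    (hy : y ∈ (D.G V).baseChange F) : x * y ∈ (D.G V).baseChange F := by
  obtain ⟨z, hz, h⟩ := (D.mem_iff V (D.E (x * y))).2 fun y' hy' => by
    rw [map_mul]
    exact ((D.mem_iff V _).1 ⟨x, hx, rfl⟩ y' hy').mul ((D.mem_iff V _).1 ⟨y, hy, rfl⟩ y' hy')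
  rwa [← D.injective h]

/-- An expression `g / f` of a function `u` as a reduced fraction of forms of degree `e`. -/
structure Presentation (u : Ω) (e : ℕ) (f g : MvPolynomial (Fin (N + 1)) F) : Prop where
  pos : 0 < e
  hf : f.IsHomogeneous e
  hg : g.IsHomogeneous e
  -- On a point all functions are constant, so no reduced fraction has positive degree; there `X 0 /
  -- X 0` takes its place.
  relPrime : IsRelPrime f g ∨ N = 0
  ne_zero : f ≠ 0
  eq : D.E (1 ⊗ₜ u) * algebraMap _ 𝓕 f = algebraMap _ 𝓕 g

section

variable {D}
variable {u : Ω} {e : ℕ} {f g : MvPolynomial (Fin (N + 1)) F} (H : D.Presentation u e f g)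

include H

theorem Presentation.pow_eq (j : ℕ) :
    D.E (1 ⊗ₜ (u ^ j)) * algebraMap _ 𝓕 (f ^ j) = algebraMap _ 𝓕 (g ^ j) := by
  have : (1 ⊗ₜ (u ^ j) : F ⊗[k] Ω) = (1 ⊗ₜ u) ^ j := by simp
  rw [this, map_pow, map_pow, map_pow, ← mul_pow, H.eq]

variable [IsFractionRing (MvPolynomial (Fin (N + 1)) F) 𝓕]
  [IsScalarTower F (MvPolynomial (Fin (N + 1)) F) 𝓕]

theorem Presentation.map_ne_zero : algebraMap _ 𝓕 f ≠ 0 :=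
  (map_ne_zero_iff _ (IsFractionRing.injective _ 𝓕)).2 H.ne_zero

theorem Presentation.exists_scalar (hN : N = 0) {j : ℕ}
    {p : MvPolynomial (Fin (N + 1)) F} (hp : p.IsHomogeneous (e * j)) :
    ∃ s : F, algebraMap F 𝓕 s * algebraMap _ 𝓕 (f ^ j) = algebraMap _ 𝓕 p := by
  subst hN
  obtain ⟨s, hs⟩ := eq_C_mul_X_pow (H.hf.pow j)
  obtain ⟨t, ht⟩ := eq_C_mul_X_pow hp
  have hs0 : s ≠ 0 := by
    rintro rfl
    exact pow_ne_zero j H.ne_zero (by rw [hs]; simp)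
  refine ⟨t / s, ?_⟩
  rw [IsScalarTower.algebraMap_apply F (MvPolynomial (Fin (0 + 1)) F) 𝓕, ← map_mul, hs, ht,
    MvPolynomial.algebraMap_eq, ← mul_assoc, ← map_mul, div_mul_cancel₀ _ hs0]

/-- The function `u` is regular on `V₀`, so its reduced denominator `f` has no zeros there, and `p /
f ^ j` is regular. -/
theorem Presentation.exists_bounded {V₀ : D.ι} (hu : u ∈ D.G V₀) {j : ℕ}
    {p : MvPolynomial (Fin (N + 1)) F} (hp : p.IsHomogeneous (e * j)) :
    ∃ b ∈ (D.G V₀).baseChange F, D.E b * algebraMap _ 𝓕 (f ^ j) = algebraMap _ 𝓕 p := by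
  have hfj : algebraMap _ 𝓕 (f ^ j) ≠ 0 := by rw [map_pow]; exact pow_ne_zero _ H.map_ne_zero
  rcases H.relPrime with hrel | hN
  swap
  · obtain ⟨s, hs⟩ := H.exists_scalar hN hp
    obtain ⟨b, hb, h⟩ := (D.mem_iff V₀ (algebraMap F 𝓕 s)).2 fun y hy =>
      ⟨0, MvPolynomial.C s, 1, MvPolynomial.isHomogeneous_C _ _, MvPolynomial.isHomogeneous_one _ _,
        fun h => y.isPrime.ne_top ((Ideal.eq_top_iff_one _).2 h), by
        rw [map_one, mul_one, IsScalarTower.algebraMap_apply F (MvPolynomial (Fin (N + 1)) F) 𝓕]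
        rfl⟩
    exact ⟨b, hb, by rw [h, hs]⟩
  obtain ⟨b, hb, h⟩ := (D.mem_iff V₀ (algebraMap _ 𝓕 p / algebraMap _ 𝓕 (f ^ j))).2 fun y hy => by
    have hfy : f ∉ y.asHomogeneousIdeal := dvd_of_regularAt ((D.mem_iff V₀ _).1
      ⟨_, Submodule.tmul_mem_baseChange_of_mem 1 hu, rfl⟩ y hy) hrel H.eq
    refine ⟨_, p, f ^ j, hp, H.hf.pow j, fun h => hfy (y.isPrime.mem_of_pow_mem _ h), ?_⟩
    rw [div_mul_cancel₀ _ hfj]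
  exact ⟨b, hb, by rw [h, div_mul_cancel₀ _ hfj]⟩

/-- If `c = P / Q` and `c * u ^ j = P' / Q'` are regular at a point, then `g ^ j * P * Q' = f ^ j *
P' * Q`, so `f ^ j` divides `P * Q'`. The zeros of `c` thus cancel the denominator of `p / f ^ j`.
-/
theorem Presentation.bounded {j : ℕ} {p : MvPolynomial (Fin (N + 1)) F}
    (hp : p.IsHomogeneous (e * j)) {b : F ⊗[k] Ω}
    (hb : D.E b * algebraMap _ 𝓕 (f ^ j) = algebraMap _ 𝓕 p) : D.Bounded u j b := by
  have hinj := IsFractionRing.injective (MvPolynomial (Fin (N + 1)) F) 𝓕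
  have hfj : algebraMap _ 𝓕 (f ^ j) ≠ 0 := by rw [map_pow]; exact pow_ne_zero _ H.map_ne_zero
  intro V c hc hu
  rcases H.relPrime with hrel | hN
  swap
  · obtain ⟨s, hs⟩ := H.exists_scalar hN hp
    have : b = s • 1 := by
      apply D.injective
      refine mul_right_cancel₀ hfj ?_
      rw [hb, ← hs, map_smul, map_one, Algebra.smul_def, mul_one]
    rw [this, mul_smul_comm, mul_one]
    exact Submodule.smul_mem _ _ (Submodule.tmul_mem_baseChange_of_mem 1 hc)
  obtain ⟨x, hx, h⟩ := (D.mem_iff V (D.E ((1 ⊗ₜ c) * b))).2 fun y hy => by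
    obtain ⟨n, P, Q, hP, hQ, hQy, h1⟩ := (D.mem_iff V _).1
      ⟨_, Submodule.tmul_mem_baseChange_of_mem 1 hc, rfl⟩ y hy
    obtain ⟨n', P', Q', hP', hQ', hQy', h2⟩ := (D.mem_iff V _).1
      ⟨_, Submodule.tmul_mem_baseChange_of_mem 1 hu, rfl⟩ y hy
    have h3 : g ^ j * (P * Q') = f ^ j * (P' * Q) := by
      apply hinj
      have : (1 ⊗ₜ (c * u ^ j) : F ⊗[k] Ω) = (1 ⊗ₜ c) * (1 ⊗ₜ (u ^ j)) := by simp
      rw [this, map_mul] at h2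
      rw [map_mul, map_mul, map_mul, map_mul, ← H.pow_eq, ← h1, ← h2]
      ring
    obtain ⟨T, hT⟩ := (hrel.pow (m := j) (n := j)).dvd_of_dvd_mul_left (Dvd.intro _ h3.symm)
    have h4 : D.E ((1 ⊗ₜ c) * b) * algebraMap _ 𝓕 (Q * Q') = algebraMap _ 𝓕 (T * p) := by
      refine mul_right_cancel₀ hfj ?_
      rw [map_mul, map_mul, map_mul, ← hb, mul_right_comm (algebraMap _ 𝓕 T), mul_mul_mul_comm,
        h1, mul_right_comm, ← mul_assoc (algebraMap _ 𝓕 T * _)]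
      have : algebraMap _ 𝓕 P * algebraMap _ 𝓕 Q' = algebraMap _ 𝓕 T * algebraMap _ 𝓕 (f ^ j) := by
        rw [← map_mul, hT, mul_comm, map_mul]
      linear_combination (D.E b * algebraMap _ 𝓕 (f ^ j)) * this
    refine ⟨n + n', T * p, Q * Q', ?_, hQ.mul hQ', mul_notMem hQy hQy', h4⟩
    by_cases hP0 : P * Q' = 0
    · have : T = 0 := by
        rw [hP0, eq_comm, mul_eq_zero] at hT
        exact hT.resolve_left (pow_ne_zero _ H.ne_zero)
      rw [this, zero_mul]
      exact MvPolynomial.isHomogeneous_zero _ _ _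
    · have := hP.mul hQ'
      rw [hT] at this hP0
      obtain ⟨i, i', hi, h5, h6⟩ := isHomogeneous_of_mul this hP0
      obtain rfl : i = e * j := h5.inj_right (H.hf.pow j) (left_ne_zero_of_mul hP0)
      have h7 : n + n' = i' + e * j := by rw [← hi, add_comm]
      rw [h7]
      exact h6.mul hp
  rwa [← D.injective h]

/-- The product of `b` and `f ^ j` is shown to be a section of `𝒪(e * j)` that is regular at each
point, hence a form. -/
theorem Presentation.exists_of_bounded {j : ℕ} {b : F ⊗[k] Ω} (hb : D.Bounded u j b)
    (y₀ : ProjectiveSpectrum (grading N F)) : ∃ p : MvPolynomial (Fin (N + 1)) F,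
      p.IsHomogeneous (e * j) ∧ D.E b * algebraMap _ 𝓕 (f ^ j) = algebraMap _ 𝓕 p := by
  have hinj := IsFractionRing.injective (MvPolynomial (Fin (N + 1)) F) 𝓕
  refine exists_eq_of_forall_regular y₀ _ _ fun y => ?_
  obtain ⟨V, hy⟩ := D.cover y
  obtain ⟨i, hi⟩ := exists_X_notMem y
  let X : MvPolynomial (Fin (N + 1)) F := MvPolynomial.X i ^ (e * j)
  have hX : X.IsHomogeneous (e * j) := by
    simpa using (MvPolynomial.isHomogeneous_X F i).pow (e * j)
  have hXy : X ∉ y.asHomogeneousIdeal := fun h => hi (y.isPrime.mem_of_pow_mem _ h)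
  have hX0 : algebraMap _ 𝓕 X ≠ 0 := (map_ne_zero_iff _ hinj).2 fun h => hXy (h ▸ zero_mem _)
  have key : ∀ h : MvPolynomial (Fin (N + 1)) F, h.IsHomogeneous (e * j) →
      ∃ x ∈ (D.G V).baseChange F, ∃ s ∈ (D.G V).baseChange F,
        D.E s * algebraMap _ 𝓕 h = D.E x * algebraMap _ 𝓕 X ∧ D.E s ≠ 0 ∧ RegularAt y (D.E s) ∧
          RegularAt y (D.E s)⁻¹ := by
    intro h hh
    obtain ⟨x, hx, s, hs, h1, h2⟩ := D.exists_denom V y hy (algebraMap _ 𝓕 h / algebraMap _ 𝓕 X)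
      ⟨_, h, X, hh, hX, hXy, div_mul_cancel₀ _ hX0⟩
    refine ⟨x, hx, s, hs, ?_, h2⟩
    rw [← h1, mul_assoc, div_mul_cancel₀ _ hX0]
  obtain ⟨x, hx, s, hs, h1, hs0, hsr, hsr'⟩ := key (f ^ j) (H.hf.pow j)
  obtain ⟨x', hx', s', hs', h1', hs0', hsr1, hsr1'⟩ := key (g ^ j) (H.hg.pow j)
  -- Near `y`, the functions `f ^ j / X` and `g ^ j / X` are `x / s` and `x' / s'`, with `s` and
  -- `s'` invertible at `y`. So `s' * x` is a legitimate test function for the bound, and testing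
  -- with it shows that `b * f ^ j / X` is regular at `y`.
  have h2 : (s' * x) * (1 ⊗ₜ (u ^ j)) = s * x' := by
    apply D.injective
    refine mul_right_cancel₀ hX0 ?_
    simp only [map_mul]
    linear_combination (-D.E s' * D.E (1 ⊗ₜ (u ^ j))) * h1 + D.E s * h1' +
      (D.E s * D.E s') * H.pow_eq j
  have h3 := hb.mul_mem (mul_mem_baseChange hs' hx) (h2 ▸ mul_mem_baseChange hs hx')
  obtain ⟨n, p, q, hp, hq, hqy, h4⟩ := (D.mem_iff V _).1 ⟨_, h3, rfl⟩ y hy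
  have hreg : RegularAt y (D.E s * D.E s')⁻¹ := by
    rw [mul_inv]; exact hsr'.mul hsr1'
  obtain ⟨n', p', q', hp', hq', hqy', h5⟩ := hreg
  refine ⟨n + n', p * p' * X, q * q', (hp.mul hp').mul hX, hq.mul hq', mul_notMem hqy hqy', ?_⟩
  simp only [map_mul] at h4 ⊢
  rw [← h4, ← h5]
  have h6 : D.E s * D.E s' * (D.E s * D.E s')⁻¹ = 1 := mul_inv_cancel₀ (mul_ne_zero hs0 hs0')
  linear_combination (-D.E b * algebraMap _ 𝓕 (f ^ j) * algebraMap _ 𝓕 q * algebraMap _ 𝓕 q') * h6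
    + (D.E b * algebraMap _ 𝓕 q * algebraMap _ 𝓕 q' * (D.E s * D.E s')⁻¹ * D.E s') * h1

end

end RationalCharts

end SeveriBrauer

/-! ### Descended functions and vanishing along the conjugates -/

namespace SeveriBrauer

namespace RationalCharts

/-- A chart `A` and an ideal `I ⊆ K ⊗ A` whose conjugates are the ideals of the images of complementary
projections `M σ` of projective space. The map `ev σ` is the evaluation at a generic point of the
image of `M σ`. -/
structure Conjugates {k F : Type u} [Field k] [Field F] [Algebra k F] {N : ℕ}
    {Ω : Type u} [Field Ω] [Algebra k Ω] {𝓕 : Type u} [Field 𝓕]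
    [Algebra (MvPolynomial (Fin (N + 1)) F) 𝓕] [Algebra F 𝓕]
    (D : RationalCharts k F N Ω 𝓕) (K A : Type u) [Field K] [Algebra k K]
    [FiniteDimensional k K] [CommRing A] [Algebra k A] where
  V₀ : D.ι
  y₀ : ProjectiveSpectrum (grading N F)
  y₀_mem : y₀ ∈ D.O V₀
  a : A →ₐ[k] Ω
  a_injective : Function.Injective a
  range_a : LinearMap.range a.toLinearMap = D.G V₀
  M : (K →ₐ[k] F) → Matrix (Fin (N + 1)) (Fin (N + 1)) F
  M_mul_of_ne : ∀ σ τ, σ ≠ τ → M σ * M τ = 0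
  M_mul_self : ∀ σ, M σ * M σ = M σ
  sum_M : ∑ σ, M σ = 1
  M_ne_zero : ∀ σ, M σ ≠ 0
  ev : (K →ₐ[k] F) → F ⊗[k] A →ₐ[F] 𝓕
  ev_eq : ∀ σ b, ∃ (n : ℕ) (p q : MvPolynomial (Fin (N + 1)) F), p.IsHomogeneous n ∧
    q.IsHomogeneous n ∧ matSubst (M σ) q ≠ 0 ∧
    D.E (Algebra.TensorProduct.map (AlgHom.id F F) a b) * algebraMap _ 𝓕 q = algebraMap _ 𝓕 p ∧
    ev σ b * algebraMap _ 𝓕 (matSubst (M σ) q) = algebraMap _ 𝓕 (matSubst (M σ) p)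
  I : Ideal (K ⊗[k] A)
  ker_ev : ∀ σ, RingHom.ker (ev σ) = I.map (mapLeft A σ)

variable {k F : Type u} [Field k] [Field F] [Algebra k F] {N : ℕ}
    {Ω : Type u} [Field Ω] [Algebra k Ω] {𝓕 : Type u} [Field 𝓕]
    [Algebra (MvPolynomial (Fin (N + 1)) F) 𝓕] [Algebra F 𝓕]
    {D : RationalCharts k F N Ω 𝓕} {K A : Type u} [Field K] [Algebra k K]
    [FiniteDimensional k K] [CommRing A] [Algebra k A]

namespace Conjugates

variable (C : D.Conjugates K A)

/-- The inclusion `F ⊗ A → F ⊗ Ω`. -/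
noncomputable abbrev incl : F ⊗[k] A →ₐ[F] F ⊗[k] Ω :=
  Algebra.TensorProduct.map (AlgHom.id F F) C.a

theorem exists_incl_eq {x : F ⊗[k] Ω} (hx : x ∈ (D.G C.V₀).baseChange F) :
    ∃ b, C.incl b = x := by
  rw [Submodule.baseChange_eq_span] at hx
  induction hx using Submodule.span_induction with
  | zero => exact ⟨0, map_zero _⟩
  | add x y _ _ hx hy =>
    obtain ⟨b, rfl⟩ := hx
    obtain ⟨c, rfl⟩ := hy
    exact ⟨b + c, map_add _ _ _⟩
  | smul a x _ hx =>
    obtain ⟨b, rfl⟩ := hx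
    exact ⟨a • b, map_smul _ _ _⟩
  | mem x hx =>
    obtain ⟨m, hm, rfl⟩ := hx
    rw [← C.range_a] at hm
    obtain ⟨b, rfl⟩ := hm
    exact ⟨1 ⊗ₜ b, by simp⟩

theorem incl_injective : Function.Injective C.incl :=
  Module.Flat.lTensor_preserves_injective_linearMap (M := F) C.a.toLinearMap C.a_injective

theorem incl_mapLeft (σ : K →ₐ[k] F) (r : K ⊗[k] A) :
    C.incl (mapLeft A σ r) =
      mapLeft Ω σ (Algebra.TensorProduct.map (AlgHom.id k K) C.a r) := by
  induction r using TensorProduct.induction_on with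
  | zero => simp
  | add x y hx hy => simp only [map_add, hx, hy]
  | tmul c b => simp

theorem incl_rTensor (μ : F →ₗ[k] F) (b : F ⊗[k] A) :
    C.incl (μ.rTensor A b) = μ.rTensor Ω (C.incl b) := by
  induction b using TensorProduct.induction_on with
  | zero => simp
  | add x y hx hy => simp only [map_add, hx, hy]
  | tmul c b => simp

/-- The function on projective space that an element of `F ⊗ A` is. -/
noncomputable abbrev fn : F ⊗[k] A →ₐ[F] 𝓕 := D.E.comp C.incl

theorem fn_injective : Function.Injective C.fn := D.injective.comp C.incl_injective

variable [IsFractionRing (MvPolynomial (Fin (N + 1)) F) 𝓕]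
  [IsScalarTower F (MvPolynomial (Fin (N + 1)) F) 𝓕]

theorem map_ne_zero {p : MvPolynomial (Fin (N + 1)) F} : algebraMap _ 𝓕 p ≠ 0 ↔ p ≠ 0 :=
  map_ne_zero_iff _ (IsFractionRing.injective _ 𝓕)

/-- `ev_eq` supplies one fraction whose denominator survives on the image of `M σ`;
cross-multiplication transfers the formula to any other fraction. -/
theorem ev_eq_of_eq (σ : K →ₐ[k] F) {b : F ⊗[k] A} {p q : MvPolynomial (Fin (N + 1)) F}
    (h : C.fn b * algebraMap _ 𝓕 q = algebraMap _ 𝓕 p) :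
    C.ev σ b * algebraMap _ 𝓕 (matSubst (C.M σ) q) = algebraMap _ 𝓕 (matSubst (C.M σ) p) := by
  obtain ⟨n, p', q', -, -, hq', h1, h2⟩ := C.ev_eq σ b
  have h3 : p * q' = p' * q := by
    apply IsFractionRing.injective _ 𝓕
    rw [map_mul, map_mul, ← h1, ← h]
    simp
    ring
  have h4 := congrArg (fun r => algebraMap _ 𝓕 (matSubst (C.M σ) r)) h3
  simp only [map_mul] at h4
  refine mul_right_cancel₀ (map_ne_zero.2 hq') ?_
  rw [h4, ← h2]
  ring

/-- The matrices `M σ` for all `σ` outside of a finite set add up to the complementary projection. -/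
theorem matSubst_one_sub_sum {p : MvPolynomial (Fin (N + 1)) F} (s : Finset (K →ₐ[k] F))
    (h : ∀ τ ∈ s, matSubst (1 - C.M τ) p = p) : matSubst (1 - ∑ τ ∈ s, C.M τ) p = p := by
  classical
  induction s using Finset.induction_on with
  | empty => simp [matSubst_one]
  | insert τ s hτ ih =>
    have h1 := ih fun ρ hρ => h ρ (Finset.mem_insert_of_mem hρ)
    have h2 := h τ (Finset.mem_insert_self _ _)
    have h3 : (1 - ∑ ρ ∈ s, C.M ρ) * (1 - C.M τ) = 1 - ∑ ρ ∈ insert τ s, C.M ρ := by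
      have : (∑ ρ ∈ s, C.M ρ) * C.M τ = 0 := by
        rw [Finset.sum_mul]
        refine Finset.sum_eq_zero fun ρ hρ => C.M_mul_of_ne _ _ ?_
        rintro rfl
        exact hτ hρ
      rw [Finset.sum_insert hτ, sub_mul, one_mul, mul_sub, mul_one, this]
      abel
    rw [← h3, ← matSubst_matSubst, h1, h2]

/-- Because the projections sum to one, removing all of them except `M σ` leaves `M σ`. -/
theorem matSubst_eq_of_forall {p : MvPolynomial (Fin (N + 1)) F} (σ : K →ₐ[k] F)
    (h : ∀ τ, τ ≠ σ → matSubst (1 - C.M τ) p = p) : matSubst (C.M σ) p = p := by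
  classical
  have h1 := C.matSubst_one_sub_sum (Finset.univ.erase σ) fun τ hτ => h τ (Finset.ne_of_mem_erase hτ)
  rwa [← C.sum_M, ← Finset.add_sum_erase _ _ (Finset.mem_univ σ), add_sub_cancel_right] at h1

/-- The functions that vanish to order `n` along the image of `M σ`. -/
noncomputable def vanishing (σ : K →ₐ[k] F) (n : ℕ) : Ideal (F ⊗[k] A) where
  carrier := {b | ∃ p q, matSubst (C.M σ) q ≠ 0 ∧ C.fn b * algebraMap _ 𝓕 q = algebraMap _ 𝓕 p ∧
    Polynomial.X ^ n ∣ degenerate (C.M σ) p}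
  zero_mem' := ⟨0, 1, by simp, by simp, by simp⟩
  add_mem' := by
    rintro b c ⟨p, q, hq, h, hd⟩ ⟨p', q', hq', h', hd'⟩
    refine ⟨p * q' + p' * q, q * q', by rw [map_mul]; exact mul_ne_zero hq hq', ?_, ?_⟩
    · simp only [map_add, map_mul, ← h, ← h']
      ring
    · simp only [map_add, map_mul]
      exact dvd_add (hd.mul_right _) (hd'.mul_right _)
  smul_mem' := by
    rintro c b ⟨p, q, hq, h, hd⟩
    obtain ⟨n, p', q', -, -, hq', h', -⟩ := C.ev_eq σ c
    refine ⟨p' * p, q' * q, by rw [map_mul]; exact mul_ne_zero hq' hq, ?_, ?_⟩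
    · simp only [smul_eq_mul, map_mul, ← h, ← h']
      simp
      ring
    · rw [map_mul]
      exact hd.mul_left _

/-- An element of the kernel has a numerator that vanishes on the image of `M σ`, that is, to first
order; orders add up in products. -/
theorem ker_pow_le_vanishing (σ : K →ₐ[k] F) (n : ℕ) :
    RingHom.ker (C.ev σ) ^ n ≤ C.vanishing σ n := by
  induction n with
  | zero =>
    intro b _
    obtain ⟨n, p, q, -, -, hq, h, -⟩ := C.ev_eq σ b
    exact ⟨p, q, hq, h, by simp⟩
  | succ n ih =>
    rw [pow_succ, Ideal.mul_le]
    intro b hb c hc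
    obtain ⟨p, q, hq, h, hd⟩ := ih hb
    obtain ⟨n, p', q', -, -, hq', h', h''⟩ := C.ev_eq σ c
    rw [(RingHom.mem_ker).1 hc, zero_mul, eq_comm,
      map_eq_zero_iff _ (IsFractionRing.injective _ 𝓕), ← X_dvd_degenerate_iff] at h''
    refine ⟨p * p', q * q', by rw [map_mul]; exact mul_ne_zero hq hq', ?_, ?_⟩
    · simp only [map_mul, ← h, ← h']
      simp
      ring
    · rw [map_mul, pow_succ]
      exact mul_dvd_mul hd h''

/-- The denominator `q'` does not vanish on the image, and `T` is prime, so the full order of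
vanishing falls on `p`. The order equals the degree of `p`, which forces `p` to be a form in the
complementary coordinates. -/
theorem matSubst_of_mem_pow {σ : K →ₐ[k] F} {n : ℕ} {b : F ⊗[k] A}
    (hb : b ∈ RingHom.ker (C.ev σ) ^ n) {p f : MvPolynomial (Fin (N + 1)) F}
    (hp : p.IsHomogeneous n) (h : C.fn b * algebraMap _ 𝓕 f = algebraMap _ 𝓕 p) :
    matSubst (1 - C.M σ) p = p := by
  obtain ⟨p', q', hq', h', hd⟩ := C.ker_pow_le_vanishing σ n hb
  refine matSubst_one_sub_of_X_pow_dvd _ hp ?_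
  have h1 : p * q' = p' * f := by
    apply IsFractionRing.injective _ 𝓕
    rw [map_mul, map_mul, ← h, ← h']
    ring
  refine Prime.pow_dvd_of_dvd_mul_right Polynomial.prime_X n (b := degenerate (C.M σ) q') ?_ ?_
  · rwa [X_dvd_degenerate_iff]
  · rw [← map_mul, h1, map_mul]
    exact hd.mul_right _

section

variable {u : Ω} {e : ℕ} {f g : MvPolynomial (Fin (N + 1)) F} (H : D.Presentation u e f g)
  (hu : u ∈ D.G C.V₀)

include H hu

theorem exists_fn_eq {j : ℕ} {p : MvPolynomial (Fin (N + 1)) F} (hp : p.IsHomogeneous (e * j)) :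
    ∃ b, C.fn b * algebraMap _ 𝓕 (f ^ j) = algebraMap _ 𝓕 p := by
  obtain ⟨x, hx, h⟩ := H.exists_bounded hu hp
  obtain ⟨b, rfl⟩ := C.exists_incl_eq hx
  exact ⟨b, h⟩

theorem exists_fn_eq_one {p : MvPolynomial (Fin (N + 1)) F} (hp : p.IsHomogeneous e) :
    ∃ b, C.fn b * algebraMap _ 𝓕 f = algebraMap _ 𝓕 p := by
  simpa using C.exists_fn_eq H hu (j := 1) (p := p) (by simpa using hp)

/-- The image of `M σ` is not contained in the divisor of poles of `u`: it meets the chart, where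
`u` is regular. -/
theorem matSubst_f_ne_zero (σ : K →ₐ[k] F) : matSubst (C.M σ) f ≠ 0 := by
  rcases H.relPrime with hrel | hN
  · rw [← C.range_a] at hu
    obtain ⟨b, hb⟩ := hu
    obtain ⟨n, p, q, -, -, hq, h, -⟩ := C.ev_eq σ (1 ⊗ₜ b)
    have h1 : g * q = f * p := by
      apply IsFractionRing.injective _ 𝓕
      rw [map_mul, map_mul, ← h, ← H.eq, ← hb]
      simp
      ring
    obtain ⟨r, rfl⟩ := hrel.dvd_of_dvd_mul_left (Dvd.intro _ h1.symm)
    rw [map_mul] at hq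
    exact left_ne_zero_of_mul hq
  · intro h0
    subst hN
    obtain ⟨t, ht⟩ := eq_C_mul_X_pow H.hf
    have ht0 : t ≠ 0 := by
      rintro rfl
      exact H.ne_zero (by rw [ht]; simp)
    have h1 : matSubst (C.M σ) (MvPolynomial.X 0) = 0 := by
      rw [ht, map_mul, map_pow, ← MvPolynomial.algebraMap_eq, AlgHom.commutes, mul_eq_zero] at h0
      exact (pow_eq_zero_iff H.pos.ne').1 (h0.resolve_left (by simpa using ht0))
    refine C.M_ne_zero σ ?_
    ext i l
    fin_cases i
    fin_cases l
    simpa [matSubst_X] using h1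

/-- The descended functions `h` such that all conjugates of `h` are a form in the coordinates of the
respective image, divided by `f ^ j`. -/
def Descended (f : MvPolynomial (Fin (N + 1)) F) (n j : ℕ) (h : K ⊗[k] A) : Prop :=
  ∀ σ, ∃ p : MvPolynomial (Fin (N + 1)) F, p.IsHomogeneous n ∧ matSubst (C.M σ) p = p ∧
    C.fn (mapLeft A σ h) * algebraMap _ 𝓕 (f ^ j) = algebraMap _ 𝓕 p

/-- The coordinates of `M σ` vanish on the image of `M τ`, so a form of degree `n` in them lies in
the `n`-th power of the ideal. To make this precise for functions on the chart, it is checked where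
one of the functions `t i = X i ^ e / f` is inverted. -/
theorem mem_pow_of_matSubst_eq {j : ℕ} {b : F ⊗[k] A} {p : MvPolynomial (Fin (N + 1)) F}
    (hp : p.IsHomogeneous (e * j)) (h : C.fn b * algebraMap _ 𝓕 (f ^ j) = algebraMap _ 𝓕 p)
    {σ τ : K →ₐ[k] F} (hστ : σ ≠ τ) (hσ : matSubst (C.M σ) p = p) :
    b ∈ RingHom.ker (C.ev τ) ^ (e * j) := by
  have hf0 := H.map_ne_zero
  have hX : ∀ i, (MvPolynomial.X i ^ e : MvPolynomial (Fin (N + 1)) F).IsHomogeneous e := fun i => by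
    simpa using (MvPolynomial.isHomogeneous_X F i).pow e
  choose t ht using fun i => C.exists_fn_eq_one H hu (hX i)
  -- Every monomial of `f ^ (N + 1)`, which has degree `e * (N + 1)`, is divisible by some `X i ^
  -- e`. Dividing by `f ^ (N + 1)` writes `1` as a combination of the `t i`.
  have hspan : Ideal.span (Set.range t) = ⊤ := by
    rw [Ideal.eq_top_iff_one]
    have key : ∀ p : MvPolynomial (Fin (N + 1)) F, p.IsHomogeneous (e * (N + 1)) →
        ∃ b ∈ Ideal.span (Set.range t),
          C.fn b * algebraMap _ 𝓕 (f ^ (N + 1)) = algebraMap _ 𝓕 p := by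
      intro p hp
      rw [p.as_sum, map_sum]
      have : ∀ s ∈ p.support, ∃ b ∈ Ideal.span (Set.range t), C.fn b *
          algebraMap _ 𝓕 (f ^ (N + 1)) = algebraMap _ 𝓕 (MvPolynomial.monomial s (p.coeff s)) := by
        intro s hs
        have hdeg : s.degree = e * (N + 1) := by
          rw [Finsupp.degree_eq_weight_one (R := ℕ)]
          exact hp (MvPolynomial.mem_support_iff.1 hs)
        obtain ⟨i, hi⟩ := exists_le_of_degree_eq s hdeg
        have hs' : s = (s - Finsupp.single i e) + Finsupp.single i e :=
          (tsub_add_cancel_of_le (by simpa using hi)).symm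
        have hhom : (MvPolynomial.monomial (s - Finsupp.single i e) (p.coeff s)).IsHomogeneous
            (e * N) := by
          apply MvPolynomial.isHomogeneous_monomial
          have := congrArg Finsupp.degree hs'
          rw [map_add, hdeg, Finsupp.degree_single, mul_add, mul_one] at this
          exact (Nat.add_right_cancel this).symm
        obtain ⟨c, hc⟩ := C.exists_fn_eq H hu hhom
        refine ⟨c * t i, Ideal.mul_mem_left _ _ (Ideal.subset_span ⟨i, rfl⟩), ?_⟩
        have hmon : MvPolynomial.monomial s (p.coeff s) =
            MvPolynomial.monomial (s - Finsupp.single i e) (p.coeff s) * MvPolynomial.X i ^ e := by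
          rw [← MvPolynomial.monomial_add_single, ← hs']
        rw [hmon, map_mul _ _ (MvPolynomial.X i ^ e), ← hc, ← ht i]
        rw [pow_succ, map_mul, map_mul]
        ring
      choose! b hb hb' using this
      refine ⟨∑ s ∈ p.support, b s, Ideal.sum_mem _ hb, ?_⟩
      rw [map_sum, Finset.sum_mul]
      exact Finset.sum_congr rfl hb'
    obtain ⟨b, hb, h⟩ := key (f ^ (N + 1)) (H.hf.pow _)
    have : b = 1 := by
      apply C.fn_injective
      have h0 : algebraMap _ 𝓕 (f ^ (N + 1)) ≠ 0 := by rw [map_pow]; exact pow_ne_zero _ hf0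
      rw [map_one]
      exact mul_right_cancel₀ h0 (h.trans (one_mul _).symm)
    exact this ▸ hb
  -- The coordinates of `M σ` are raised to degree `e` by a power of `X i`, so that their quotients
  -- by `f` are functions on the chart, which lie in the kernel.
  have hlin : ∀ i l, (MvPolynomial.X i ^ (e - 1) * matSubst (C.M σ) (MvPolynomial.X l) :
      MvPolynomial (Fin (N + 1)) F).IsHomogeneous e := fun i l => by
    have h1 := ((MvPolynomial.isHomogeneous_X F i).pow (e - 1)).mul
      (isHomogeneous_matSubst (C.M σ) (MvPolynomial.isHomogeneous_X F l))
    have h2 : 1 * (e - 1) + 1 = e := by have := H.pos; omega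
    rwa [h2] at h1
  choose a ha using fun i l => C.exists_fn_eq_one H hu (hlin i l)
  have hker : ∀ i l, a i l ∈ RingHom.ker (C.ev τ) := by
    intro i l
    have h1 := C.ev_eq_of_eq τ (ha i l)
    rw [map_mul, matSubst_matSubst, C.M_mul_of_ne σ τ hστ] at h1
    have h2 : matSubst 0 (MvPolynomial.X l : MvPolynomial (Fin (N + 1)) F) = 0 := by
      simp [matSubst_X]
    rw [h2, mul_zero, map_zero, mul_eq_zero] at h1
    exact h1.resolve_right (map_ne_zero.2 (C.matSubst_f_ne_zero H hu τ))
  -- Both sides equal `X i ^ (e * (e * j)) * p` divided by `f ^ (e * j + j)`.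
  have hti : ∀ i, t i ^ (e * j) * b = t i ^ j * MvPolynomial.aeval (a i) p := by
    intro i
    apply C.fn_injective
    have h1 : C.fn (MvPolynomial.aeval (a i) p) * algebraMap _ 𝓕 (f ^ (e * j)) =
        algebraMap _ 𝓕 (MvPolynomial.X i ^ ((e - 1) * (e * j)) * p) := by
      rw [MvPolynomial.comp_aeval_apply, mul_comm, map_pow, ← aeval_mul_of_isHomogeneous _ _ hp]
      have h2 : (fun l => algebraMap _ 𝓕 f * (C.fn (a i l))) = fun l =>
          algebraMap (MvPolynomial (Fin (N + 1)) F) 𝓕 (MvPolynomial.X i ^ (e - 1)) *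
            algebraMap _ 𝓕 (matSubst (C.M σ) (MvPolynomial.X l)) := by
        funext l
        rw [mul_comm, ha, map_mul]
      change MvPolynomial.aeval (fun l => algebraMap _ 𝓕 f * (C.fn (a i l))) p = _
      have h5 : MvPolynomial.aeval (fun l => algebraMap (MvPolynomial (Fin (N + 1)) F) 𝓕
          (matSubst (C.M σ) (MvPolynomial.X l))) p = algebraMap _ 𝓕 p := by
        refine (MvPolynomial.aeval_algebraMap_apply 𝓕
          (fun l => matSubst (C.M σ) (MvPolynomial.X l)) p).trans ?_
        conv_rhs => rw [← hσ]
        congr 1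
        simp [matSubst]
      rw [h2, aeval_mul_of_isHomogeneous _ _ hp, map_mul, ← map_pow, ← pow_mul, h5]
    refine mul_right_cancel₀ (b := algebraMap _ 𝓕 (f ^ (e * j)) * algebraMap _ 𝓕 (f ^ j)) (by
      rw [map_pow, map_pow]
      exact mul_ne_zero (pow_ne_zero _ hf0) (pow_ne_zero _ hf0)) ?_
    have h3 : ∀ n, C.fn (t i ^ n) * algebraMap _ 𝓕 (f ^ n) =
        algebraMap (MvPolynomial (Fin (N + 1)) F) 𝓕 (MvPolynomial.X i ^ (e * n)) := by
      intro n
      rw [map_pow, map_pow, ← mul_pow, ht, ← map_pow, ← pow_mul]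
    have h4 : e * (e * j) = e * j + (e - 1) * (e * j) := by
      have : e = 1 + (e - 1) := by have := H.pos; omega
      conv_lhs => rw [this, add_mul, one_mul, ← this]
    calc _ = (C.fn (t i ^ (e * j)) * algebraMap _ 𝓕 (f ^ (e * j))) *
          (C.fn b * algebraMap _ 𝓕 (f ^ j)) := by rw [map_mul]; ring
      _ = (C.fn (t i ^ j) * algebraMap _ 𝓕 (f ^ j)) *
          (C.fn (MvPolynomial.aeval (a i) p) * algebraMap _ 𝓕 (f ^ (e * j))) := by
        rw [h1, h3, h3, h, ← map_mul, ← map_mul, h4, pow_add]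
        ring_nf
      _ = _ := by rw [map_mul]; ring
  have htop := Ideal.span_pow_eq_top _ hspan (e * j)
  have hle : Ideal.span ((fun x => x ^ (e * j)) '' Set.range t) ≤
      (RingHom.ker (C.ev τ) ^ (e * j)).colon {b} := by
    rw [Ideal.span_le]
    rintro _ ⟨_, ⟨i, rfl⟩, rfl⟩
    rw [SetLike.mem_coe, Submodule.mem_colon_singleton, smul_eq_mul, hti]
    exact Ideal.mul_mem_left _ _ (aeval_mem_pow_of_isHomogeneous (hker i) hp)
  rw [htop, top_le_iff, Ideal.eq_top_iff_one, Submodule.mem_colon_singleton, one_smul] at hle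
  exact hle

variable [Algebra.IsSeparable k K] [IsAlgClosed F]

/-- The conjugate of `Λ b` by `σ'` is the image of `b` under the `k`-linear map `σ' ∘ Λ`. The bound
on the poles is preserved, which yields the form `p'`. The vanishing along the other conjugates is
transported by `mapLeft_rTensor_mem_map`, and it forces `p'` into the coordinates of `M σ'`. -/
theorem descended_rTensor {j : ℕ} {b : F ⊗[k] A} {p : MvPolynomial (Fin (N + 1)) F}
    (hp : p.IsHomogeneous (e * j)) (h : C.fn b * algebraMap _ 𝓕 (f ^ j) = algebraMap _ 𝓕 p)
    {σ : K →ₐ[k] F} (hσ : matSubst (C.M σ) p = p) {Λ : F →ₗ[k] K} (hΛ : IsLinearOver σ Λ) :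
    C.Descended f (e * j) j (Λ.rTensor A b) := by
  intro σ'
  have h1 : mapLeft A σ' (Λ.rTensor A b) = (σ'.toLinearMap ∘ₗ Λ).rTensor A b := by
    rw [← rTensor_eq_mapLeft, LinearMap.rTensor_comp_apply]
  obtain ⟨p', hp', h'⟩ := H.exists_of_bounded
    ((H.bounded hp h).rTensor (σ'.toLinearMap ∘ₗ Λ)) C.y₀
  replace h' : C.fn (mapLeft A σ' (Λ.rTensor A b)) * algebraMap _ 𝓕 (f ^ j) =
      algebraMap _ 𝓕 p' := by
    rw [h1, ← h']
    exact congrArg (fun x => D.E x * _) (C.incl_rTensor _ b)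
  refine ⟨p', hp', C.matSubst_eq_of_forall σ' fun τ hτ => ?_, h'⟩
  refine C.matSubst_of_mem_pow (b := mapLeft A σ' (Λ.rTensor A b)) ?_ hp' h'
  rw [C.ker_ev, ← Ideal.map_pow]
  refine mapLeft_rTensor_mem_map (C.I ^ (e * j)) σ b (fun ρ hρ => ?_) hΛ hτ
  rw [Ideal.map_pow, ← C.ker_ev]
  exact C.mem_pow_of_matSubst_eq H hu hp h hρ.symm hσ

end

end Conjugates

end RationalCharts

end SeveriBrauer

/-! ### The rational map to the Weil restriction, on coordinate rings -/

namespace SeveriBrauer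

/-- A domain that is finite over the field `Ω` is a field. This permits division by a descended
function inside `K ⊗ Ω`. -/
theorem isField_tensorProduct_of_injective {k K Ω 𝓕 : Type*} [Field k] [Field K] [Field Ω]
    [Field 𝓕] [Algebra k K] [Algebra k Ω] [FiniteDimensional k K] (f : K ⊗[k] Ω →+* 𝓕)
    (hf : Function.Injective f) : IsField (K ⊗[k] Ω) := by
  let c := Algebra.TensorProduct.comm k Ω K
  have : IsDomain (Ω ⊗[k] K) := (hf.comp c.injective).isDomain (f.comp c.toAlgHom.toRingHom)
  have h : IsField (Ω ⊗[k] K) := isField_of_isIntegral_of_isField'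
    (R := Ω) (Field.toIsField Ω)
  exact MulEquiv.isField h c.symm.toMulEquiv

theorem exists_isLinearOver_apply_one {k K F : Type*} [Field k] [Field K] [Field F] [Algebra k K]
    [Algebra k F] (σ : K →ₐ[k] F) : ∃ Λ : F →ₗ[k] K, IsLinearOver σ Λ ∧ Λ 1 = 1 := by
  let := σ.toRingHom.toAlgebra
  have : IsScalarTower k K F := IsScalarTower.of_algebraMap_eq fun r => (σ.commutes r).symm
  obtain ⟨Λ, hΛ⟩ := LinearMap.exists_leftInverse_of_injective (Algebra.linearMap K F)
    (LinearMap.ker_eq_bot.2 (algebraMap K F).injective)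
  refine ⟨Λ.restrictScalars k, fun c x => Λ.map_smul c x, ?_⟩
  have := DFunLike.congr_fun hΛ 1
  simpa using this

/-- A functional linear over `σ` with `Λ 1 = 1` is a retraction of `σ`, and it brings the extended
ideal back to `I`. -/
theorem mem_of_mapLeft_mem_map {k K F A : Type*} [Field k] [Field K] [Field F] [Algebra k K]
    [Algebra k F] [CommRing A] [Algebra k A] {σ : K →ₐ[k] F} {I : Ideal (K ⊗[k] A)}
    {x : K ⊗[k] A} (h : mapLeft A σ x ∈ I.map (mapLeft A σ)) : x ∈ I := by
  obtain ⟨Λ, hΛ, h1⟩ := exists_isLinearOver_apply_one σ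
  have := rTensor_mem_of_mem_map hΛ h
  rw [← one_mul (mapLeft A σ x), rTensor_mul_mapLeft hΛ] at this
  have h2 : Λ.rTensor A 1 = 1 := by simp [Algebra.TensorProduct.one_def, h1]
  rwa [h2, one_mul] at this

namespace RationalCharts.Conjugates

variable {k F : Type u} [Field k] [Field F] [Algebra k F] {N : ℕ}
    {Ω : Type u} [Field Ω] [Algebra k Ω] {𝓕 : Type u} [Field 𝓕]
    [Algebra (MvPolynomial (Fin (N + 1)) F) 𝓕] [Algebra F 𝓕]
    {D : RationalCharts k F N Ω 𝓕} {K A : Type u} [Field K] [Algebra k K]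
    [FiniteDimensional k K] [CommRing A] [Algebra k A] (C : D.Conjugates K A)
    [IsFractionRing (MvPolynomial (Fin (N + 1)) F) 𝓕]
  [IsScalarTower F (MvPolynomial (Fin (N + 1)) F) 𝓕]

/-- Any function on the chart that is non-constant over `F` will do, as a reduced fraction; this is
where a substitute for a line bundle over `k` is chosen. -/
theorem exists_presentation : ∃ u ∈ D.G C.V₀, ∃ e f g, D.Presentation u e f g := by
  by_cases hN : N = 0
  · refine ⟨1, C.range_a ▸ ⟨1, map_one C.a⟩, 1, MvPolynomial.X 0, MvPolynomial.X 0, one_pos,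
      MvPolynomial.isHomogeneous_X _ _, MvPolynomial.isHomogeneous_X _ _, Or.inr hN,
      MvPolynomial.X_ne_zero _, ?_⟩
    rw [← Algebra.TensorProduct.one_def, map_one, one_mul]
  -- If all functions on the chart were constant, then so would be `X l / X i`, which is a fraction
  -- of two of them.
  · obtain ⟨u, hu⟩ : ∃ a : A, ∀ c : F, C.fn (1 ⊗ₜ a) ≠ algebraMap F 𝓕 c := by
      by_contra! H
      have H' : ∀ x ∈ (D.G C.V₀).baseChange F, ∃ c : F, D.E x = algebraMap F 𝓕 c := by
        intro x hx
        obtain ⟨b, rfl⟩ := C.exists_incl_eq hx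
        clear hx
        induction b using TensorProduct.induction_on with
        | zero => exact ⟨0, by simp⟩
        | add x y hx hy =>
          obtain ⟨c, hc⟩ := hx
          obtain ⟨d, hd⟩ := hy
          exact ⟨c + d, by rw [map_add, map_add, map_add, hc, hd]⟩
        | tmul c a =>
          obtain ⟨d, hd⟩ := H a
          refine ⟨c * d, ?_⟩
          have : (c ⊗ₜ a : F ⊗[k] A) = c • (1 ⊗ₜ a) := by simp [TensorProduct.smul_tmul']
          rw [this, map_smul, map_smul, map_mul, ← hd, Algebra.smul_def]
          rfl
      obtain ⟨i, hi⟩ := exists_X_notMem C.y₀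
      obtain ⟨l, hl⟩ : ∃ l : Fin (N + 1), l ≠ i := by
        by_cases h0 : i = 0
        · refine ⟨Fin.last N, fun h => hN ?_⟩
          rw [h0, Fin.ext_iff] at h
          simpa using h
        · exact ⟨0, Ne.symm h0⟩
      have hX : algebraMap (MvPolynomial (Fin (N + 1)) F) 𝓕 (MvPolynomial.X i) ≠ 0 :=
        map_ne_zero.2 (MvPolynomial.X_ne_zero _)
      obtain ⟨x, hx, s, hs, h1, hs0, -⟩ := D.exists_denom C.V₀ C.y₀ C.y₀_mem
        (algebraMap _ 𝓕 (MvPolynomial.X l) / algebraMap _ 𝓕 (MvPolynomial.X i)) ⟨1,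
          MvPolynomial.X l, MvPolynomial.X i, MvPolynomial.isHomogeneous_X _ _,
          MvPolynomial.isHomogeneous_X _ _, hi, div_mul_cancel₀ _ hX⟩
      obtain ⟨c, hc⟩ := H' x hx
      obtain ⟨d, hd⟩ := H' s hs
      rw [hc, hd, ← mul_div_assoc, div_eq_iff hX,
        IsScalarTower.algebraMap_apply F (MvPolynomial (Fin (N + 1)) F) 𝓕,
        IsScalarTower.algebraMap_apply F (MvPolynomial (Fin (N + 1)) F) 𝓕, ← map_mul, ← map_mul] at h1
      have h2 := congrArg (MvPolynomial.coeff (Finsupp.single l 1))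
        (IsFractionRing.injective (MvPolynomial (Fin (N + 1)) F) 𝓕 h1)
      rw [MvPolynomial.algebraMap_eq, MvPolynomial.coeff_C_mul, MvPolynomial.coeff_C_mul,
        MvPolynomial.coeff_X, MvPolynomial.coeff_X, if_pos rfl, if_neg fun h => hl
          (Finsupp.single_left_injective one_ne_zero h).symm, mul_one, mul_zero] at h2
      rw [hd, h2, map_zero] at hs0
      exact hs0 rfl
    have humem : C.a u ∈ D.G C.V₀ := C.range_a ▸ ⟨u, rfl⟩
    have hfn : C.fn (1 ⊗ₜ u) = D.E (1 ⊗ₜ C.a u) := by simp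
    obtain ⟨n, p, q, hp, hq, hqy, h⟩ := (D.mem_iff C.V₀ (D.E (1 ⊗ₜ C.a u))).1
      ⟨_, Submodule.tmul_mem_baseChange_of_mem 1 humem, rfl⟩ C.y₀ C.y₀_mem
    have hq0 : q ≠ 0 := fun h => hqy (h ▸ zero_mem _)
    rw [← hfn] at h
    have hp0 : p ≠ 0 := by
      rintro rfl
      rw [map_zero, mul_eq_zero] at h
      exact hu 0 (by rw [map_zero]; exact h.resolve_right (map_ne_zero.2 hq0))
    obtain ⟨f, g, c, hfg, rfl, rfl⟩ := UniqueFactorizationMonoid.exists_reduced_factors q hq0 p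
    obtain ⟨i, e, hie, hci, hf⟩ := isHomogeneous_of_mul hq hq0
    obtain ⟨i', e', hie', hci', hg⟩ := isHomogeneous_of_mul hp hp0
    have hc0 := left_ne_zero_of_mul hq0
    have hf0 := right_ne_zero_of_mul hq0
    obtain rfl : i = i' := hci.inj_right hci' hc0
    obtain rfl : e = e' := by omega
    have h1 : C.fn (1 ⊗ₜ u) * algebraMap _ 𝓕 f = algebraMap _ 𝓕 g := by
      rw [map_mul, map_mul] at h
      refine mul_left_cancel₀ (map_ne_zero.2 hc0) ?_
      rw [← h]
      ring
    refine ⟨C.a u, humem, e, f, g, Nat.pos_of_ne_zero ?_, hf, hg, Or.inl hfg, hf0, by rwa [← hfn]⟩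
    rintro rfl
    rw [← MvPolynomial.totalDegree_zero_iff_isHomogeneous,
      MvPolynomial.totalDegree_eq_zero_iff_eq_C] at hf hg
    generalize MvPolynomial.coeff 0 f = s at hf
    generalize MvPolynomial.coeff 0 g = t at hg
    subst hf hg
    have hs0 : s ≠ 0 := by rintro rfl; simp at hf0
    refine hu (t / s) (mul_right_cancel₀ (map_ne_zero.2 hf0) ?_)
    rw [h1, IsScalarTower.algebraMap_apply F (MvPolynomial (Fin (N + 1)) F) 𝓕, ← map_mul,
      MvPolynomial.algebraMap_eq, ← map_mul, div_mul_cancel₀ _ hs0]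

variable [Algebra.IsSeparable k K] [IsAlgClosed F]

/-- For `h` descended, the values at the generic point of the space and at that of an image of `M σ`
are both given by the same form. -/
theorem Descended.eq {f : MvPolynomial (Fin (N + 1)) F} {n j : ℕ} {h : K ⊗[k] A}
    (hh : C.Descended f n j h) (σ : K →ₐ[k] F) :
    C.fn (mapLeft A σ h) * algebraMap _ 𝓕 (f ^ j) =
      C.ev σ (mapLeft A σ h) * algebraMap _ 𝓕 (matSubst (C.M σ) (f ^ j)) := by
  obtain ⟨p, -, hp, h1⟩ := hh σ
  rw [C.ev_eq_of_eq σ h1, h1, hp]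

/-- Modulo `I`, the function `r` is a quotient `P / Q` of descended functions with the same
denominator `f ^ j`. The comparison factor between the generic point and its projection is the same
for `P` and `Q` and cancels, so `z = P / Q`, formed in `K ⊗ Ω`, has the required values for all
embeddings simultaneously. -/
theorem exists_value (r : K ⊗[k] A) : ∃ z : K ⊗[k] Ω, ∀ σ : K →ₐ[k] F,
    D.E (mapLeft Ω σ z) = C.ev σ (mapLeft A σ r) := by
  obtain ⟨u, hu, e, f, g, H⟩ := C.exists_presentation
  obtain ⟨σ⟩ : Nonempty (K →ₐ[k] F) := ⟨IsAlgClosed.lift⟩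
  obtain ⟨j, p₀, q₀, hp₀, hq₀, hq0, h1, h2⟩ := C.ev_eq σ (mapLeft A σ r)
  replace hp₀ := isHomogeneous_matSubst (C.M σ) hp₀
  replace hq₀ := isHomogeneous_matSubst (C.M σ) hq₀
  have hp : matSubst (C.M σ) (matSubst (C.M σ) p₀) = matSubst (C.M σ) p₀ := by
    rw [matSubst_matSubst, C.M_mul_self]
  have hq : matSubst (C.M σ) (matSubst (C.M σ) q₀) = matSubst (C.M σ) q₀ := by
    rw [matSubst_matSubst, C.M_mul_self]
  generalize matSubst (C.M σ) p₀ = p at *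
  generalize matSubst (C.M σ) q₀ = q at *
  -- The degree `j` of `p` and `q` need not be a multiple of `e`. Writing `p / q` as `p * q ^ (e -
  -- 1) / q ^ e` gives degree `e * j`, as the denominator `f ^ j` requires.
  have hqe : (q ^ e).IsHomogeneous (e * j) := by
    rw [mul_comm]; exact hq₀.pow e
  have he : e - 1 + 1 = e := by have := H.pos; omega
  have hpe : (p * q ^ (e - 1)).IsHomogeneous (e * j) := by
    have h3 := hp₀.mul (hq₀.pow (e - 1))
    have h4 : j + j * (e - 1) = e * j := by
      conv_rhs => rw [← he]
      ring
    rwa [h4] at h3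
  obtain ⟨Q₀, hQ₀⟩ := C.exists_fn_eq H hu hqe
  obtain ⟨P₀, hP₀⟩ := C.exists_fn_eq H hu hpe
  have hqf : matSubst (C.M σ) (q ^ e) = q ^ e := by rw [map_pow, hq]
  have hpf : matSubst (C.M σ) (p * q ^ (e - 1)) = p * q ^ (e - 1) := by
    rw [map_mul, map_pow, hq, hp]
  have hQev := C.ev_eq_of_eq σ hQ₀
  have hPev := C.ev_eq_of_eq σ hP₀
  rw [hqf] at hQev
  rw [hpf] at hPev
  -- If all functionals sent `Q₀` to `I`, then `Q₀` would vanish on the image of `M σ`, contrary to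
  -- `q ≠ 0`.
  obtain ⟨Λ, hΛ, hΛQ⟩ : ∃ Λ : F →ₗ[k] K, IsLinearOver σ Λ ∧ Λ.rTensor A Q₀ ∉ C.I := by
    by_contra! H'
    have h3 := mem_map_of_forall σ C.I Q₀ H'
    rw [← C.ker_ev, RingHom.mem_ker] at h3
    rw [h3, zero_mul, eq_comm, map_eq_zero_iff _ (IsFractionRing.injective _ 𝓕)] at hQev
    exact hq0 ((pow_eq_zero_iff H.pos.ne').1 hQev)
  have hf0 : ∀ τ, algebraMap _ 𝓕 (matSubst (C.M τ) (f ^ j)) ≠ 0 := fun τ => map_ne_zero.2 (by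
    rw [map_pow]; exact pow_ne_zero _ (C.matSubst_f_ne_zero H hu τ))
  -- By linearity over `σ`, this is `Λ` of `Q₀` times the conjugate of `r` minus `P₀`, which
  -- vanishes on the image of `M σ`.
  have hker : Λ.rTensor A Q₀ * r - Λ.rTensor A P₀ ∈ C.I := by
    rw [← rTensor_mul_mapLeft hΛ, ← map_sub]
    refine rTensor_mem_of_mem_map hΛ ?_
    rw [← C.ker_ev, RingHom.mem_ker]
    refine mul_right_cancel₀ (hf0 σ) (mul_right_cancel₀ (map_ne_zero.2 hq0) ?_)
    rw [zero_mul, zero_mul, map_sub, map_mul, sub_mul, hPev, mul_right_comm, hQev, sub_mul, mul_assoc,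
      h2, ← map_mul, ← map_mul, sub_eq_zero, mul_assoc, ← pow_succ, he, mul_comm]
  have hQ := C.descended_rTensor H hu hqe hQ₀ hqf hΛ
  have hP := C.descended_rTensor H hu hpe hP₀ hpf hΛ
  generalize Λ.rTensor A Q₀ = Q at *
  generalize Λ.rTensor A P₀ = P at *
  let c := Algebra.TensorProduct.map (AlgHom.id k K) C.a
  have hfn : ∀ τ x, D.E (mapLeft Ω τ (c x)) = C.fn (mapLeft A τ x) := fun τ x => by
    rw [← C.incl_mapLeft]
    rfl
  have hQev0 : ∀ τ, C.ev τ (mapLeft A τ Q) ≠ 0 := fun τ h => by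
    rw [← RingHom.mem_ker, C.ker_ev] at h
    exact hΛQ (mem_of_mapLeft_mem_map h)
  have hf0' : algebraMap _ 𝓕 (f ^ j) ≠ 0 := map_ne_zero.2 (pow_ne_zero _ H.ne_zero)
  have hQfn : ∀ τ, C.fn (mapLeft A τ Q) ≠ 0 := fun τ h => by
    have := hQ.eq C τ
    rw [h, zero_mul, eq_comm, mul_eq_zero] at this
    exact this.elim (hQev0 τ) (hf0 τ)
  have hinj : ∀ τ : K →ₐ[k] F, Function.Injective
      ((D.E : F ⊗[k] Ω →+* 𝓕).comp (mapLeft Ω τ : K ⊗[k] Ω →+* F ⊗[k] Ω)) := fun τ =>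
    D.injective.comp
      (Module.Flat.rTensor_preserves_injective_linearMap (M := Ω) τ.toLinearMap τ.injective)
  have hc0 : c Q ≠ 0 := fun h => hQfn σ (by rw [← hfn, h, map_zero, map_zero])
  obtain ⟨Q', hQ'⟩ := (isField_tensorProduct_of_injective _ (hinj σ)).mul_inv_cancel hc0
  refine ⟨c P * Q', fun τ => ?_⟩
  have h3 : C.fn (mapLeft A τ Q) * D.E (mapLeft Ω τ Q') = 1 := by
    rw [← hfn, ← map_mul, ← map_mul, hQ', map_one, map_one]
  have h4 : C.ev τ (mapLeft A τ Q) * C.ev τ (mapLeft A τ r) = C.ev τ (mapLeft A τ P) := by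
    have := Ideal.mem_map_of_mem (mapLeft A τ) hker
    rw [← C.ker_ev, RingHom.mem_ker, map_sub, map_sub, map_mul, map_mul, sub_eq_zero] at this
    exact this
  have h5 := hQ.eq C τ
  have h6 := hP.eq C τ
  rw [map_mul, map_mul, hfn]
  refine mul_left_cancel₀ (hQev0 τ) (mul_right_cancel₀ (hf0 τ) ?_)
  rw [h4, ← h6]
  linear_combination (-C.fn (mapLeft A τ P) * D.E (mapLeft Ω τ Q')) * h5 +
    (C.fn (mapLeft A τ P) * algebraMap _ 𝓕 (f ^ j)) * h3

/-- The rational map from the form of projective space to the Weil restriction of the subvariety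
with ideal `I`. -/
theorem exists_algHom : ∃ ψ : K ⊗[k] A →ₐ[K] K ⊗[k] Ω, ∀ (σ : K →ₐ[k] F) (r : K ⊗[k] A),
    D.E (mapLeft Ω σ (ψ r)) = C.ev σ (mapLeft A σ r) := by
  choose ψ hψ using C.exists_value
  obtain ⟨σ⟩ : Nonempty (K →ₐ[k] F) := ⟨IsAlgClosed.lift⟩
  have hinj : ∀ x y, D.E (mapLeft Ω σ x) = D.E (mapLeft Ω σ y) → x = y := fun x y h =>
    Module.Flat.rTensor_preserves_injective_linearMap (M := Ω) σ.toLinearMap σ.injective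
      (D.injective h)
  refine ⟨⟨⟨⟨⟨ψ, ?_⟩, ?_⟩, ?_, ?_⟩, ?_⟩, fun σ r => hψ r σ⟩
  · exact hinj _ _ (by simp only [hψ, map_one])
  · exact fun x y => hinj _ _ (by simp only [hψ, map_mul])
  · exact hinj _ _ (by simp only [hψ, map_zero])
  · exact fun x y => hinj _ _ (by simp only [hψ, map_add])
  · refine fun c => hinj _ _ ?_
    change D.E (mapLeft Ω σ (ψ _)) = _
    rw [hψ]
    have h1 : ∀ (B : Type u) [CommRing B] [Algebra k B], mapLeft B σ (algebraMap K (K ⊗[k] B) c) =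
      algebraMap F _ (σ c) := fun B _ _ => by simp [Algebra.TensorProduct.algebraMap_apply]
    rw [h1, h1, AlgHom.commutes, AlgHom.commutes]

end RationalCharts.Conjugates

end SeveriBrauer

namespace SeveriBrauer

/-! ### Points of projective space from homogeneous coordinates -/

section Points

variable {N : ℕ} {R T : Type u} [CommRing R] [CommRing T]

/-- Degree-zero fractions with denominators powers of `q`. -/
abbrev AwayRing (N : ℕ) {R : Type u} [CommRing R] (q : MvPolynomial (Fin (N + 1)) R) : Type u :=
  HomogeneousLocalization.Away (grading N R) q

/-- The open immersion of `D₊(q)`. -/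
noncomputable def chartι {q : MvPolynomial (Fin (N + 1)) R} {d : ℕ} (hq : q ∈ grading N R d)
    (hd : 0 < d) : Spec (CommRingCat.of (AwayRing N q)) ⟶ projSpace N R :=
  Proj.awayι (grading N R) q hq hd

instance {q : MvPolynomial (Fin (N + 1)) R} {d : ℕ} (hq : q ∈ grading N R d)
    (hd : 0 < d) : IsOpenImmersion (chartι hq hd) := by
  change IsOpenImmersion (Proj.awayι (grading N R) q hq hd)
  infer_instance

theorem range_chartι {q : MvPolynomial (Fin (N + 1)) R} {d : ℕ} (hq : q ∈ grading N R d)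
    (hd : 0 < d) : Set.range (chartι hq hd) =
      {y : ProjectiveSpectrum (grading N R) | q ∉ y.asHomogeneousIdeal} :=
  congrArg (fun U : (Proj (grading N R)).Opens => (U : Set (Proj (grading N R))))
    (Proj.opensRange_awayι (grading N R) q hq hd)

/-- The evaluation of degree-zero fractions. -/
noncomputable def evalAway (χ : MvPolynomial (Fin (N + 1)) R →+* T)
    {q : MvPolynomial (Fin (N + 1)) R} (hq : IsUnit (χ q)) : AwayRing N q →+* T :=
  (IsLocalization.Away.lift q hq).comp (algebraMap (AwayRing N q) (Localization.Away q))

theorem evalAway_mk (χ : MvPolynomial (Fin (N + 1)) R →+* T)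
    {q : MvPolynomial (Fin (N + 1)) R} (hχ : IsUnit (χ q)) {d : ℕ} (hq : q ∈ grading N R d) (n : ℕ)
    (a : MvPolynomial (Fin (N + 1)) R) (ha : a ∈ grading N R (n • d)) :
    evalAway χ hχ (HomogeneousLocalization.Away.mk (grading N R) hq n a ha) * χ q ^ n = χ a := by
  rw [evalAway, RingHom.comp_apply, HomogeneousLocalization.algebraMap_apply,
    HomogeneousLocalization.Away.val_mk, Localization.mk_eq_mk', mul_comm]
  rw [← map_pow]
  exact ((IsLocalization.lift_mk'_spec _ _ _ (⟨q ^ n, n, rfl⟩ : Submonoid.powers q)).1 rfl).symm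

theorem AwayRing.hom_ext {q : MvPolynomial (Fin (N + 1)) R} {d : ℕ} (hq : q ∈ grading N R d)
    {f g : AwayRing N q →+* T} (h : ∀ n a ha,
      f (HomogeneousLocalization.Away.mk (grading N R) hq n a ha) =
        g (HomogeneousLocalization.Away.mk (grading N R) hq n a ha)) : f = g := by
  ext x
  obtain ⟨n, a, ha, rfl⟩ := x.mk_surjective _ hq
  exact h n a ha

theorem eq_evalAway (χ : MvPolynomial (Fin (N + 1)) R →+* T)
    {q : MvPolynomial (Fin (N + 1)) R} (hχ : IsUnit (χ q)) {d : ℕ} (hq : q ∈ grading N R d)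
    {f : AwayRing N q →+* T} (h : ∀ n a ha,
      f (HomogeneousLocalization.Away.mk (grading N R) hq n a ha) * χ q ^ n = χ a) :
    f = evalAway χ hχ :=
  AwayRing.hom_ext hq fun n a ha => (hχ.pow n).mul_left_injective
    ((h n a ha).trans (evalAway_mk χ hχ hq n a ha).symm)

theorem evalAway_injective {χ : MvPolynomial (Fin (N + 1)) R →+* T} (hinj : Function.Injective χ)
    {q : MvPolynomial (Fin (N + 1)) R} {d : ℕ} (hq : q ∈ grading N R d) (hχ : IsUnit (χ q)) :
    Function.Injective (evalAway χ hχ) := by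
  rw [injective_iff_map_eq_zero]
  intro x hx
  obtain ⟨n, a, ha, rfl⟩ := x.mk_surjective _ hq
  have h := evalAway_mk χ hχ hq n a ha
  rw [hx, zero_mul, eq_comm, map_eq_zero_iff _ hinj] at h
  subst h
  rw [HomogeneousLocalization.ext_iff_val, HomogeneousLocalization.Away.val_mk,
    HomogeneousLocalization.val_zero, Localization.mk_zero]

/-- The point of projective space with homogeneous coordinates `χ x_i`. -/
noncomputable def pt (χ : MvPolynomial (Fin (N + 1)) R →+* T) {q : MvPolynomial (Fin (N + 1)) R}
    {d : ℕ} (hq : q ∈ grading N R d) (hd : 0 < d) (hχ : IsUnit (χ q)) :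
    Spec (CommRingCat.of T) ⟶ projSpace N R :=
  Spec.map (CommRingCat.ofHom (evalAway χ hχ)) ≫ chartι hq hd

theorem specMap_awayMap_chartι {q q' : MvPolynomial (Fin (N + 1)) R} {d d' : ℕ}
    (hq : q ∈ grading N R d) (hd : 0 < d) (hq' : q' ∈ grading N R d') {x} (hx : x = q * q')
    (hxd : x ∈ grading N R (d + d')) :
    Spec.map (CommRingCat.ofHom (HomogeneousLocalization.awayMap (grading N R) hq' hx)) ≫
      chartι hq hd = chartι hxd (by omega) :=
  Proj.SpecMap_awayMap_awayι (grading N R) hq hd hq' hx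

theorem pt_eq_mul (χ : MvPolynomial (Fin (N + 1)) R →+* T) {q q' x : MvPolynomial (Fin (N + 1)) R}
    {d d' : ℕ} (hq : q ∈ grading N R d) (hd : 0 < d) (hχ : IsUnit (χ q))
    (hq' : q' ∈ grading N R d') (hx : x = q * q') (hxd : x ∈ grading N R (d + d'))
    (hχx : IsUnit (χ x)) :
    pt χ hq hd hχ = pt χ hxd (by omega) hχx := by
  rw [pt, pt, ← specMap_awayMap_chartι hq hd hq' hx hxd, ← Spec.map_comp_assoc,
    ← CommRingCat.ofHom_comp]
  congr 3
  refine (eq_evalAway χ hχ hq fun n a ha => ?_).symm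
  have h := evalAway_mk χ hχx hxd n (a * q' ^ n) (by
    rw [smul_add]
    exact SetLike.mul_mem_graded ha (SetLike.pow_mem_graded n hq'))
  have hu : IsUnit (χ q' ^ n) := by
    rw [hx, map_mul] at hχx
    exact (isUnit_of_mul_isUnit_right hχx).pow n
  refine hu.mul_left_injective ?_
  subst hx
  simp only [RingHom.comp_apply, HomogeneousLocalization.awayMap_mk]
  rwa [map_mul, mul_pow, ← mul_assoc, map_mul, map_pow] at h

/-- The form used as denominator is immaterial: both descriptions restrict to the chart of the
product `q * q'`. -/
theorem pt_eq (χ : MvPolynomial (Fin (N + 1)) R →+* T) {q q' : MvPolynomial (Fin (N + 1)) R}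
    {d d' : ℕ} (hq : q ∈ grading N R d) (hd : 0 < d) (hχ : IsUnit (χ q))
    (hq' : q' ∈ grading N R d') (hd' : 0 < d') (hχ' : IsUnit (χ q')) :
    pt χ hq hd hχ = pt χ hq' hd' hχ' := by
  have h1 : IsUnit (χ (q * q')) := by rw [map_mul]; exact hχ.mul hχ'
  have h2 : q * q' ∈ grading N R (d' + d) := add_comm d d' ▸ SetLike.mul_mem_graded hq hq'
  rw [pt_eq_mul χ hq hd hχ hq' rfl (SetLike.mul_mem_graded hq hq') h1, pt_eq_mul χ hq' hd' hχ' hq (mul_comm q q') h2 h1]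
  have : ∀ (n n') (hn : q * q' ∈ grading N R n) (hn' : q * q' ∈ grading N R n') (h0 : 0 < n)
      (h0' : 0 < n'), n = n' → pt χ hn h0 h1 = pt χ hn' h0' h1 := by
    rintro n _ _ _ _ _ rfl
    rfl
  exact this _ _ _ _ _ _ (add_comm _ _)

theorem specMap_pt {T' : Type u} [CommRing T'] (g : T →+* T')
    (χ : MvPolynomial (Fin (N + 1)) R →+* T) {q : MvPolynomial (Fin (N + 1)) R}
    {d : ℕ} (hq : q ∈ grading N R d) (hd : 0 < d) (hχ : IsUnit (χ q)) :
    Spec.map (CommRingCat.ofHom g) ≫ pt χ hq hd hχ = pt (g.comp χ) hq hd (hχ.map g) := by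
  rw [pt, pt, ← Spec.map_comp_assoc, ← CommRingCat.ofHom_comp]
  congr 3
  refine eq_evalAway _ _ hq fun n a ha => ?_
  rw [RingHom.comp_apply, RingHom.comp_apply, ← map_pow, ← map_mul, evalAway_mk]
  rfl

/-- Homogeneous coordinates may be scaled. -/
theorem pt_eq_of_scale (χ χ' : MvPolynomial (Fin (N + 1)) R →+* T) (c : T)
    (h : ∀ n a, a ∈ grading N R n → χ' a = c ^ n * χ a) {q : MvPolynomial (Fin (N + 1)) R}
    {d : ℕ} (hq : q ∈ grading N R d) (hd : 0 < d) (hχ : IsUnit (χ q)) (hχ' : IsUnit (χ' q)) :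
    pt χ' hq hd hχ' = pt χ hq hd hχ := by
  rw [pt, pt]
  congr 3
  refine (eq_evalAway _ _ hq fun n a ha => ?_).symm
  have hc : IsUnit (c ^ (n * d)) := by
    rw [mul_comm, pow_mul]
    rw [h d q hq] at hχ'
    exact (isUnit_of_mul_isUnit_left hχ').pow n
  refine hc.mul_left_injective ?_
  simp only []
  rw [h d q hq, mul_pow, mul_left_comm, evalAway_mk, ← pow_mul, mul_comm d n, ← smul_eq_mul, h _ a ha,
    smul_eq_mul]
  ring

theorem chartι_linearMap {m : ℕ} {R' : Type u} [CommRing R'] (f : R' →+* R)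
    (M : Matrix (Fin (N + 1)) (Fin (m + 1)) R)
    (hM : ∃ D : Matrix (Fin (m + 1)) (Fin (N + 1)) R, D * M = 1)
    {q : MvPolynomial (Fin (N + 1)) R'} {d : ℕ} (hq : q ∈ grading N R' d) (hd : 0 < d) :
    chartι ((linearSubst f M).map_mem hq) hd ≫ linearMap f M hM =
      Spec.map (CommRingCat.ofHom (HomogeneousLocalization.Away.map (linearSubst f M) q)) ≫
        chartι hq hd :=
  Proj.awayι_comp_map _ _ hd q hq

theorem pt_comp_map {m : ℕ} {R' : Type u} [CommRing R'] (f : R' →+* R)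
    (M : Matrix (Fin (N + 1)) (Fin (m + 1)) R)
    (hM : ∃ D : Matrix (Fin (m + 1)) (Fin (N + 1)) R, D * M = 1)
    (χ : MvPolynomial (Fin (m + 1)) R →+* T) {q : MvPolynomial (Fin (N + 1)) R'}
    {d : ℕ} (hq : q ∈ grading N R' d) (hd : 0 < d) {q' : MvPolynomial (Fin (m + 1)) R} {d' : ℕ}
    (hq' : q' ∈ grading m R d') (hd' : 0 < d') (hχ' : IsUnit (χ q'))
    (hχ : IsUnit (χ (linearSubst f M q))) :
    pt χ hq' hd' hχ' ≫ linearMap f M hM =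
      pt (χ.comp (linearSubst f M : _ →+* MvPolynomial (Fin (m + 1)) R)) hq hd hχ := by
  rw [pt_eq χ hq' hd' hχ' ((linearSubst f M).map_mem hq) hd hχ]
  simp only [pt, Category.assoc]
  rw [chartι_linearMap f M hM hq hd, ← Spec.map_comp_assoc, ← CommRingCat.ofHom_comp]
  congr 3
  refine eq_evalAway _ _ hq fun n a ha => ?_
  rw [RingHom.comp_apply, HomogeneousLocalization.Away.map_mk]
  exact evalAway_mk χ hχ ((linearSubst f M).map_mem hq) n _ _

theorem chartι_str {q : MvPolynomial (Fin (N + 1)) R} {d : ℕ} (hq : q ∈ grading N R d)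
    (hd : 0 < d) : chartι hq hd ≫ projSpaceStr N R = Spec.map (CommRingCat.ofHom
      ((HomogeneousLocalization.fromZeroRingHom (grading N R) (Submonoid.powers q)).comp
        (algebraMap R (grading N R 0)))) := by
  change Proj.awayι (grading N R) q hq hd ≫ Proj.toSpecZero (grading N R) ≫ _ = _
  rw [Proj.awayι_toSpecZero_assoc, ← Spec.map_comp, ← CommRingCat.ofHom_comp]

theorem evalAway_algebraMap (χ : MvPolynomial (Fin (N + 1)) R →+* T)
    {q : MvPolynomial (Fin (N + 1)) R} (hχ : IsUnit (χ q)) : (evalAway χ hχ).comp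
      ((HomogeneousLocalization.fromZeroRingHom (grading N R) (Submonoid.powers q)).comp
        (algebraMap R (grading N R 0))) = χ.comp MvPolynomial.C := by
  ext r
  change IsLocalization.Away.lift (S := Localization.Away q) q hχ
    (Localization.mk (MvPolynomial.C r) 1) = _
  rw [Localization.mk_one_eq_algebraMap]
  exact IsLocalization.Away.lift_eq _ _ _

theorem pt_str (χ : MvPolynomial (Fin (N + 1)) R →+* T) {q : MvPolynomial (Fin (N + 1)) R}
    {d : ℕ} (hq : q ∈ grading N R d) (hd : 0 < d) (hχ : IsUnit (χ q)) :
    pt χ hq hd hχ ≫ projSpaceStr N R = Spec.map (CommRingCat.ofHom (χ.comp MvPolynomial.C)) := by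
  rw [pt, Category.assoc, chartι_str, ← Spec.map_comp, ← CommRingCat.ofHom_comp,
    evalAway_algebraMap]

theorem mem_pt_iff (χ : MvPolynomial (Fin (N + 1)) R →+* T) {q : MvPolynomial (Fin (N + 1)) R}
    {d : ℕ} (hq : q ∈ grading N R d) (hd : 0 < d) (hχ : IsUnit (χ q)) (x : PrimeSpectrum T)
    {a : MvPolynomial (Fin (N + 1)) R} {n : ℕ} (ha : a ∈ grading N R n) (hn : 0 < n) :
    a ∈ (show ProjectiveSpectrum (grading N R) from
      pt χ hq hd hχ x).asHomogeneousIdeal ↔ χ a ∈ x.asIdeal := by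
  rw [← not_iff_not]
  have h : _ = _ := congrArg (fun U : (Spec (CommRingCat.of (AwayRing N q))).Opens => U.carrier)
    (Proj.awayι_preimage_basicOpen (grading N R) hq hd ha hn)
  have h2 := Set.ext_iff.1 h (Spec.map (CommRingCat.ofHom (evalAway χ hχ)) x)
  refine Iff.trans h2 ?_
  change _ ∉ _ ↔ _
  rw [not_iff_not]
  change evalAway χ hχ _ ∈ x.asIdeal ↔ _
  have h3 := evalAway_mk χ hχ hq n (a ^ d) (by
    rw [nsmul_eq_mul, mul_comm]; exact SetLike.pow_mem_graded d ha)
  have h4 : χ q ^ n ∉ x.asIdeal := fun h => x.isPrime.ne_top (Ideal.eq_top_of_isUnit_mem _ h (hχ.pow n))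
  constructor
  · intro h
    have := Ideal.mul_mem_right (χ q ^ n) _ h
    rw [h3, map_pow] at this
    exact x.isPrime.mem_of_pow_mem _ this
  · intro h
    refine (x.isPrime.mem_or_mem ?_).resolve_right h4
    rw [h3, map_pow]
    exact Ideal.pow_mem_of_mem _ h _ hd

end Points

end SeveriBrauer

namespace SeveriBrauer

/-! ### Points with coordinates in a field -/

section FieldPoints

theorem X_mem_grading (N : ℕ) (R : Type u) [CommRing R] (i : Fin (N + 1)) :
    MvPolynomial.X i ∈ grading N R 1 :=
  MvPolynomial.isHomogeneous_X R i

variable {N : ℕ} {R T : Type u} [CommRing R] [Field T]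

/-- The point of projective space with homogeneous coordinates `χ x_i` in a field. -/
noncomputable def fieldPt (χ : MvPolynomial (Fin (N + 1)) R →+* T)
    (h : ∃ i, χ (MvPolynomial.X i) ≠ 0) : Spec (CommRingCat.of T) ⟶ projSpace N R :=
  pt χ (X_mem_grading N R h.choose) one_pos (isUnit_iff_ne_zero.2 h.choose_spec)

theorem fieldPt_eq (χ : MvPolynomial (Fin (N + 1)) R →+* T)
    (h : ∃ i, χ (MvPolynomial.X i) ≠ 0) {q : MvPolynomial (Fin (N + 1)) R} {d : ℕ}
    (hq : q ∈ grading N R d) (hd : 0 < d) (hχ : IsUnit (χ q)) :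
    fieldPt χ h = pt χ hq hd hχ :=
  pt_eq _ _ _ _ _ _ _

theorem exists_X_ne_zero [Nontrivial R] {χ : MvPolynomial (Fin (N + 1)) R →+* T}
    (hinj : Function.Injective χ) : ∃ i, χ (MvPolynomial.X i) ≠ 0 :=
  ⟨0, (map_ne_zero_iff _ hinj).2 (MvPolynomial.X_ne_zero _)⟩

theorem specMap_fieldPt {T' : Type u} [Field T'] (g : T →+* T')
    (χ : MvPolynomial (Fin (N + 1)) R →+* T) (h : ∃ i, χ (MvPolynomial.X i) ≠ 0)
    (h' : ∃ i, (g.comp χ) (MvPolynomial.X i) ≠ 0) :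
    Spec.map (CommRingCat.ofHom g) ≫ fieldPt χ h = fieldPt (g.comp χ) h' := by
  rw [fieldPt, specMap_pt]
  exact pt_eq _ _ _ _ _ _ _

theorem fieldPt_str (χ : MvPolynomial (Fin (N + 1)) R →+* T)
    (h : ∃ i, χ (MvPolynomial.X i) ≠ 0) :
    fieldPt χ h ≫ projSpaceStr N R = Spec.map (CommRingCat.ofHom (χ.comp MvPolynomial.C)) :=
  pt_str _ _ _ _

theorem fieldPt_eq_of_scale (χ χ' : MvPolynomial (Fin (N + 1)) R →+* T) (c : T) (hc : c ≠ 0)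
    (hX : ∀ n a, a ∈ grading N R n → χ' a = c ^ n * χ a) (h : ∃ i, χ (MvPolynomial.X i) ≠ 0)
    (h' : ∃ i, χ' (MvPolynomial.X i) ≠ 0) : fieldPt χ' h' = fieldPt χ h := by
  have h1 : IsUnit (χ' (MvPolynomial.X h.choose)) := by
    rw [isUnit_iff_ne_zero, hX 1 _ (X_mem_grading N R _), pow_one]
    exact mul_ne_zero hc h.choose_spec
  rw [fieldPt_eq χ' h' (X_mem_grading N R h.choose) one_pos h1]
  exact pt_eq_of_scale χ χ' c hX _ _ _ _

theorem fieldPt_comp_map {m : ℕ} {R' : Type u} [CommRing R'] (f : R' →+* R)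
    (M : Matrix (Fin (N + 1)) (Fin (m + 1)) R)
    (hM : ∃ D : Matrix (Fin (m + 1)) (Fin (N + 1)) R, D * M = 1)
    (χ : MvPolynomial (Fin (m + 1)) R →+* T) (h : ∃ i, χ (MvPolynomial.X i) ≠ 0)
    (h' : ∃ i, (χ.comp (linearSubst f M : MvPolynomial (Fin (N + 1)) R' →+* MvPolynomial (Fin (m + 1)) R))
      (MvPolynomial.X i) ≠ 0) :
    fieldPt χ h ≫ linearMap f M hM =
      fieldPt (χ.comp (linearSubst f M : MvPolynomial (Fin (N + 1)) R' →+* MvPolynomial (Fin (m + 1)) R)) h' :=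
  pt_comp_map _ _ _ _ _ _ _ _ _ _

end FieldPoints

/-! ### Affine open subschemes of projective space and their functions -/

section Charts

variable {N : ℕ} {R B : Type u} [CommRing R] [CommRing B]

/-- The homogeneous prime ideal of a point of projective space. -/
noncomputable abbrev ptIdeal (y : projSpace N R) : Ideal (MvPolynomial (Fin (N + 1)) R) :=
  (show ProjectiveSpectrum (grading N R) from y).asHomogeneousIdeal.toIdeal

instance (y : projSpace N R) : (ptIdeal y).IsPrime :=
  (show ProjectiveSpectrum (grading N R) from y).isPrime

theorem mem_range_chartι {q : MvPolynomial (Fin (N + 1)) R} {d : ℕ} (hq : q ∈ grading N R d)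
    (hd : 0 < d) {y : projSpace N R} : y ∈ Set.range (chartι hq hd) ↔ q ∉ ptIdeal y :=
  Set.ext_iff.1 (range_chartι hq hd) y

theorem exists_X_notMem_ptIdeal (y : projSpace N R) :
    ∃ i, (MvPolynomial.X i : MvPolynomial (Fin (N + 1)) R) ∉ ptIdeal y :=
  exists_X_notMem y

variable (j : Spec (CommRingCat.of B) ⟶ projSpace N R) [IsOpenImmersion j]

/-- This and `exists_localization_lift` compare an affine open subscheme near `t` with the standard
charts, in both directions. Multiplication by `q₀` ensures that the degree is positive. -/
theorem exists_away_lift (t : PrimeSpectrum B) {q₀ : MvPolynomial (Fin (N + 1)) R} {d₀ : ℕ}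
    (hq₀ : q₀ ∈ grading N R d₀) (hd₀ : 0 < d₀) (ht : q₀ ∉ ptIdeal (j t)) :
    ∃ (d : ℕ) (hd : 0 < d) (q : MvPolynomial (Fin (N + 1)) R) (hq : q ∈ grading N R d)
      (g : B →+* AwayRing N q), q ∉ ptIdeal (j t) ∧
        Spec.map (CommRingCat.ofHom g) ≫ j = chartι hq hd := by
  obtain ⟨_, ⟨_, ⟨f, rfl⟩, rfl⟩, hf, hle⟩ :=
    (Proj.isBasis_basicOpen (grading N R)).exists_subset_of_mem_open
    (show j t ∈ Set.range j from ⟨t, rfl⟩) j.isOpenEmbedding.isOpen_range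
  rw [Proj.basicOpen_eq_iSup_proj] at hf hle
  obtain ⟨i, hi⟩ := TopologicalSpace.Opens.mem_iSup.1 hf
  have hr : GradedRing.proj (grading N R) i f ∈ grading N R i := SetLike.coe_mem _
  have hq : q₀ * GradedRing.proj (grading N R) i f ∈ grading N R (d₀ + i) :=
    SetLike.mul_mem_graded hq₀ hr
  have hd : 0 < d₀ + i := by omega
  have hrange : Set.range (chartι hq hd) ⊆ Set.range j := by
    intro y hy
    rw [mem_range_chartι] at hy
    refine hle (TopologicalSpace.Opens.mem_iSup.2 ⟨i, fun h => hy (Ideal.mul_mem_left _ _ h)⟩)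
  refine ⟨d₀ + i, hd, _, hq, (Spec.preimage (IsOpenImmersion.lift j (chartι hq hd) hrange)).hom,
    fun h => ?_, ?_⟩
  · exact (Ideal.IsPrime.mem_or_mem inferInstance h).elim ht hi
  · rw [CommRingCat.ofHom_hom, Spec.map_preimage, IsOpenImmersion.lift_fac]

theorem exists_localization_lift (t : PrimeSpectrum B) {q : MvPolynomial (Fin (N + 1)) R} {d : ℕ}
    (hq : q ∈ grading N R d) (hd : 0 < d) (ht : q ∉ ptIdeal (j t)) :
    ∃ (s : B) (g : AwayRing N q →+* Localization.Away s), s ∉ t.asIdeal ∧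
        Spec.map (CommRingCat.ofHom g) ≫ chartι hq hd =
          Spec.map (CommRingCat.ofHom (algebraMap B (Localization.Away s))) ≫ j := by
  have ho : IsOpen (j ⁻¹' Set.range (chartι hq hd)) :=
    (chartι hq hd).isOpenEmbedding.isOpen_range.preimage j.continuous
  obtain ⟨_, ⟨s, rfl⟩, hs, hle⟩ := PrimeSpectrum.isTopologicalBasis_basic_opens.exists_subset_of_mem_open
    (show t ∈ j ⁻¹' Set.range (chartι hq hd) from (mem_range_chartι hq hd).2 ht) ho
  let i := Spec.map (CommRingCat.ofHom (algebraMap B (Localization.Away s)))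
  have hr : Set.range (i ≫ j) ⊆ Set.range (chartι hq hd) := by
    rintro _ ⟨x, rfl⟩
    refine hle ?_
    have : i x ∈ Set.range (PrimeSpectrum.comap (algebraMap B (Localization.Away s))) := ⟨x, rfl⟩
    rwa [PrimeSpectrum.localization_away_comap_range _ s] at this
  refine ⟨s, (Spec.preimage (IsOpenImmersion.lift (chartι hq hd) (i ≫ j) hr)).hom, hs, ?_⟩
  rw [CommRingCat.ofHom_hom, Spec.map_preimage, IsOpenImmersion.lift_fac]

variable {j}

theorem specMap_ofHom_injective {A B : Type u} [CommRing A] [CommRing B] {f g : A →+* B}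
    (h : Spec.map (CommRingCat.ofHom f) = Spec.map (CommRingCat.ofHom g)) : f = g :=
  congrArg CommRingCat.Hom.hom (Spec.map_injective h)

theorem eq_of_specMap_comp_eq {A B : Type u} [CommRing A] [CommRing B] {X : Scheme.{u}}
    {i : Spec (CommRingCat.of A) ⟶ X} [Mono i] {f g : A →+* B}
    (h : Spec.map (CommRingCat.ofHom f) ≫ i = Spec.map (CommRingCat.ofHom g) ≫ i) : f = g :=
  specMap_ofHom_injective ((cancel_mono i).1 h)

/-- A function on an affine open subscheme is locally a fraction of forms, and its values are the
fractions of the values of these forms. -/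
theorem exists_fraction {F : Type u} [Field F] {j : Spec (CommRingCat.of B) ⟶ projSpace N F}
    [IsOpenImmersion j] (t : PrimeSpectrum B) (b : B) :
    ∃ (n : ℕ) (p q : MvPolynomial (Fin (N + 1)) F), p ∈ grading N F n ∧ q ∈ grading N F n ∧
      q ∉ ptIdeal (j t) ∧ ∀ {T : Type u} [Field T] (χ : MvPolynomial (Fin (N + 1)) F →+* T)
        (h : ∃ i, χ (MvPolynomial.X i) ≠ 0) (e : B →+* T), χ q ≠ 0 →
        Spec.map (CommRingCat.ofHom e) ≫ j = fieldPt χ h → e b * χ q = χ p := by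
  obtain ⟨i, hi⟩ := exists_X_notMem_ptIdeal (j t)
  obtain ⟨d, hd, q, hq, g, hqt, hg⟩ := exists_away_lift j t (X_mem_grading N F i) one_pos hi
  obtain ⟨n, a, ha, hb⟩ := (g b).mk_surjective _ hq
  -- The extra factor `q` matters for `n = 0`: the non-vanishing of the denominator must imply that
  -- of `q`.
  refine ⟨(n + 1) • d, a * q, q ^ (n + 1), ?_, SetLike.pow_mem_graded _ hq, fun h =>
    hqt (Ideal.IsPrime.mem_of_pow_mem inferInstance _ h), fun {T} _ χ h e hχ he => ?_⟩
  · rw [succ_nsmul]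
    exact SetLike.mul_mem_graded ha hq
  · rw [map_pow] at hχ
    have hχ' : IsUnit (χ q) := isUnit_iff_ne_zero.2 (ne_zero_pow (Nat.succ_ne_zero n) hχ)
    have h1 : e = (evalAway χ hχ').comp g := by
      refine eq_of_specMap_comp_eq (i := j) ?_
      rw [he, fieldPt_eq χ h hq hd hχ', pt, ← hg, CommRingCat.ofHom_comp, Spec.map_comp_assoc]
    rw [h1, RingHom.comp_apply, ← hb, map_pow, pow_succ, ← mul_assoc, evalAway_mk, map_mul]

theorem mem_ptIdeal_fieldPt_iff {T : Type u} [Field T] (χ : MvPolynomial (Fin (N + 1)) R →+* T)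
    (h : ∃ i, χ (MvPolynomial.X i) ≠ 0) (x : PrimeSpectrum T) {q : MvPolynomial (Fin (N + 1)) R}
    {n : ℕ} (hq : q ∈ grading N R n) : q ∈ ptIdeal (fieldPt χ h x) ↔ χ q = 0 := by
  have hx : ∀ a, a ∈ x.asIdeal ↔ a = 0 := fun a => by
    rw [(Ideal.eq_bot_or_top x.asIdeal).resolve_right x.isPrime.ne_top, Ideal.mem_bot]
  have key : ∀ (d : ℕ) (a : MvPolynomial (Fin (N + 1)) R), a ∈ grading N R d → 0 < d →
      (a ∈ ptIdeal (fieldPt χ h x) ↔ χ a = 0) := fun d a ha hd =>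
    (mem_pt_iff χ (X_mem_grading N R h.choose) one_pos (isUnit_iff_ne_zero.2 h.choose_spec)
      x ha hd).trans (hx _)
  have h1 := key _ _ (X_mem_grading N R h.choose) one_pos
  -- Forms of degree zero are not covered by `key`, so a coordinate that does not vanish at the
  -- point is multiplied in.
  have h2 := key (1 + n) _ (SetLike.mul_mem_graded (X_mem_grading N R h.choose) hq) (by omega)
  rw [map_mul, mul_eq_zero, or_iff_right h.choose_spec] at h2
  rw [← h2]
  exact ⟨fun h => Ideal.mul_mem_left _ _ h, fun h' =>
    (Ideal.IsPrime.mem_or_mem inferInstance h').resolve_left fun h'' => h.choose_spec (h1.1 h'')⟩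

theorem apply_comap_bot {T : Type u} [Field T] {X : Scheme.{u}}
    (j : Spec (CommRingCat.of B) ⟶ X) (e : B →+* T) :
    j (PrimeSpectrum.comap e ⊥) = (Spec.map (CommRingCat.ofHom e) ≫ j) (⊥ : PrimeSpectrum T) := rfl

section Generic

variable {F : Type u} [Field F] {𝓕 : Type u} [Field 𝓕] {χ : MvPolynomial (Fin (N + 1)) F →+* 𝓕}
  (hχ : Function.Injective χ) (h : ∃ i, χ (MvPolynomial.X i) ≠ 0)
  {j : Spec (CommRingCat.of B) ⟶ projSpace N F} [IsOpenImmersion j]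

include hχ in
-- The generic point lies in each non-empty open subscheme, since no non-zero form vanishes at it.
theorem exists_ringHom_generic [Nontrivial B] :
    ∃ e : B →+* 𝓕, Spec.map (CommRingCat.ofHom e) ≫ j = fieldPt χ h := by
  obtain ⟨t⟩ : Nonempty (PrimeSpectrum B) := inferInstance
  obtain ⟨i, hi⟩ := exists_X_notMem_ptIdeal (j t)
  obtain ⟨d, hd, q, hq, g, hqt, hg⟩ := exists_away_lift j t (X_mem_grading N F i) one_pos hi
  have hq0 : IsUnit (χ q) := isUnit_iff_ne_zero.2
    ((map_ne_zero_iff _ hχ).2 fun h => hqt (h ▸ zero_mem _))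
  refine ⟨(evalAway χ hq0).comp g, ?_⟩
  rw [fieldPt_eq χ h hq hd hq0, pt, ← hg, CommRingCat.ofHom_comp, Spec.map_comp_assoc]

variable {e : B →+* 𝓕} (he : Spec.map (CommRingCat.ofHom e) ≫ j = fieldPt χ h)

include hχ he

/-- Near each point, the functions of the chart embed in a ring of fractions of forms, on which `χ`
is injective. So an element of the kernel has zero germs, and its annihilator is in no maximal
ideal. -/
theorem generic_injective : Function.Injective e := by
  rw [injective_iff_map_eq_zero]
  intro b hb
  have key : ∀ t : PrimeSpectrum B, ∃ s ∉ t.asIdeal, s * b = 0 := by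
    intro t
    obtain ⟨i, hi⟩ := exists_X_notMem_ptIdeal (j t)
    obtain ⟨d, hd, q, hq, g, hqt, hg⟩ := exists_away_lift j t (X_mem_grading N F i) one_pos hi
    have hq0 : IsUnit (χ q) := isUnit_iff_ne_zero.2
      ((map_ne_zero_iff _ hχ).2 fun h => hqt (h ▸ zero_mem _))
    have h1 : e = (evalAway χ hq0).comp g := by
      refine eq_of_specMap_comp_eq (i := j) ?_
      rw [he, fieldPt_eq χ h hq hd hq0, pt, ← hg, CommRingCat.ofHom_comp, Spec.map_comp_assoc]
    have h2 : g b = 0 := by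
      apply evalAway_injective hχ hq hq0
      rw [map_zero, ← RingHom.comp_apply, ← h1, hb]
    obtain ⟨s, g', hs, hg'⟩ := exists_localization_lift j t hq hd hqt
    have h3 : algebraMap B (Localization.Away s) = g'.comp g := by
      refine eq_of_specMap_comp_eq (i := j) ?_
      rw [← hg', ← hg, CommRingCat.ofHom_comp, Spec.map_comp_assoc]
    have h4 : algebraMap B (Localization.Away s) b = 0 := by
      rw [h3, RingHom.comp_apply, h2, map_zero]
    obtain ⟨⟨_, n, rfl⟩, hn⟩ := (IsLocalization.map_eq_zero_iff (Submonoid.powers s) _ b).1 h4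
    exact ⟨s ^ n, fun h => hs (t.isPrime.mem_of_pow_mem _ h), hn⟩
  by_contra hb0
  have hne : Ideal.span {b} ≠ ⊥ := by simpa using hb0
  have hann : (Ideal.span {b}).annihilator ≠ ⊤ := by
    rwa [Ne, Submodule.annihilator_eq_top_iff]
  obtain ⟨m, hm, hle⟩ := Ideal.exists_le_maximal _ hann
  obtain ⟨s, hs, hsb⟩ := key ⟨m, hm.isPrime⟩
  exact hs (hle (Submodule.mem_annihilator_span_singleton _ _ |>.2 hsb))

theorem exists_mul_eq {t : PrimeSpectrum B} {n : ℕ} {p q : MvPolynomial (Fin (N + 1)) F}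
    (hp : p ∈ grading N F n) (hq : q ∈ grading N F n) (hqt : q ∉ ptIdeal (j t)) {b : 𝓕}
    (hb : b * χ q = χ p) : ∃ s ∉ t.asIdeal, ∃ x, e s * b = e x := by
  obtain ⟨i, hi⟩ := exists_X_notMem_ptIdeal (j t)
  have hq' : q * MvPolynomial.X i ∈ grading N F (n + 1) :=
    SetLike.mul_mem_graded hq (X_mem_grading N F i)
  have hp' : p * MvPolynomial.X i ∈ grading N F (1 • (n + 1)) := by
    rw [one_smul]
    exact SetLike.mul_mem_graded hp (X_mem_grading N F i)
  have hqt' : q * MvPolynomial.X i ∉ ptIdeal (j t) := fun h =>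
    (Ideal.IsPrime.mem_or_mem inferInstance h).elim hqt hi
  have hq0 : IsUnit (χ (q * MvPolynomial.X i)) := isUnit_iff_ne_zero.2
    ((map_ne_zero_iff _ hχ).2 fun h => hqt' (h ▸ zero_mem _))
  obtain ⟨s, g, hs, hg⟩ := exists_localization_lift j t hq' (by omega) hqt'
  have hinj := generic_injective hχ h he
  have hes : IsUnit (e s) := isUnit_iff_ne_zero.2
    ((map_ne_zero_iff _ hinj).2 fun h => hs (h ▸ zero_mem _))
  let e' : Localization.Away s →+* 𝓕 := IsLocalization.Away.lift s hes
  have he' : e'.comp (algebraMap B _) = e := IsLocalization.Away.lift_comp s hes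
  have h1 : e'.comp g = evalAway χ hq0 := by
    refine eq_of_specMap_comp_eq (i := chartι hq' (by omega)) ?_
    rw [CommRingCat.ofHom_comp, Spec.map_comp_assoc, hg, ← Spec.map_comp_assoc,
      ← CommRingCat.ofHom_comp, he', he, fieldPt_eq χ h hq' (by omega) hq0]
    rfl
  obtain ⟨⟨x, _, m, rfl⟩, hx⟩ := IsLocalization.surj (Submonoid.powers s)
    (g (HomogeneousLocalization.Away.mk (grading N F) hq' 1 _ hp'))
  refine ⟨s ^ m, fun h => hs (t.isPrime.mem_of_pow_mem _ h), x, ?_⟩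
  have h2 := congrArg e' hx
  have h3 := evalAway_mk χ hq0 hq' 1 _ hp'
  rw [map_mul, ← RingHom.comp_apply e' g, h1, ← RingHom.comp_apply e', he',
    ← RingHom.comp_apply e', he'] at h2
  rw [← h2, mul_comm]
  congr 1
  refine mul_right_cancel₀ hq0.ne_zero ?_
  rw [pow_one] at h3
  rw [h3, map_mul, ← mul_assoc, hb, map_mul]

theorem exists_eq_of_forall {b : 𝓕} (hb : ∀ t : PrimeSpectrum B, ∃ (n : ℕ)
    (p q : MvPolynomial (Fin (N + 1)) F), p ∈ grading N F n ∧ q ∈ grading N F n ∧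
      q ∉ ptIdeal (j t) ∧ b * χ q = χ p) : ∃ x, e x = b := by
  -- The ideal of denominators of `b`. By local regularity it is in no maximal ideal.
  let J : Ideal B :=
    { carrier := {s | ∃ x, e s * b = e x}
      zero_mem' := ⟨0, by simp⟩
      add_mem' := by
        rintro s s' ⟨x, hx⟩ ⟨x', hx'⟩
        exact ⟨x + x', by rw [map_add, map_add, add_mul, hx, hx']⟩
      smul_mem' := by
        rintro c s ⟨x, hx⟩
        exact ⟨c * x, by rw [smul_eq_mul, map_mul, map_mul, mul_assoc, hx]⟩ }
  by_cases hJ : J = ⊤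
  · obtain ⟨x, hx⟩ := (Ideal.eq_top_iff_one J).1 hJ
    exact ⟨x, by rw [← hx, map_one, one_mul]⟩
  · obtain ⟨m, hm, hle⟩ := Ideal.exists_le_maximal _ hJ
    obtain ⟨n, p, q, hp, hq, hqt, h1⟩ := hb ⟨m, hm.isPrime⟩
    obtain ⟨s, hs, hsJ⟩ := exists_mul_eq hχ h he hp hq hqt h1
    exact (hs (hle hsJ)).elim

/-- On the smaller chart where `s` is invertible, `1 / s` is an ordinary function. -/
theorem exists_fraction_inv {t : PrimeSpectrum B} {s : B} (hs : s ∉ t.asIdeal) :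
    ∃ (n : ℕ) (p q : MvPolynomial (Fin (N + 1)) F), p ∈ grading N F n ∧ q ∈ grading N F n ∧
      q ∉ ptIdeal (j t) ∧ (e s)⁻¹ * χ q = χ p := by
  have hinj := generic_injective hχ h he
  have hes : IsUnit (e s) := isUnit_iff_ne_zero.2
    ((map_ne_zero_iff _ hinj).2 fun h => hs (h ▸ zero_mem _))
  let e' : Localization.Away s →+* 𝓕 := IsLocalization.Away.lift s hes
  have he' : e'.comp (algebraMap B _) = e := IsLocalization.Away.lift_comp s hes
  have ht : t ∈ Set.range (PrimeSpectrum.comap (algebraMap B (Localization.Away s))) := by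
    rw [PrimeSpectrum.localization_away_comap_range _ s]
    exact hs
  obtain ⟨t', rfl⟩ := ht
  let i := Spec.map (CommRingCat.ofHom (algebraMap B (Localization.Away s)))
  have : IsOpenImmersion i := IsOpenImmersion.of_isLocalization s
  obtain ⟨n, p, q, hp, hq, hqt, H⟩ := exists_fraction (j := i ≫ j) t'
    (IsLocalization.Away.invSelf s)
  have h1 := H χ h e' ((map_ne_zero_iff _ hχ).2 fun h => hqt (h ▸ zero_mem _)) (by
    rw [← Spec.map_comp_assoc, ← CommRingCat.ofHom_comp, he', he])
  refine ⟨n, p, q, hp, hq, hqt, ?_⟩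
  rw [← h1]
  congr 1
  refine inv_eq_of_mul_eq_one_right ?_
  have h2 := congrArg e' (IsLocalization.Away.mul_invSelf (S := Localization.Away s) s)
  rw [map_mul, ← RingHom.comp_apply e', he', map_one] at h2
  exact h2

end Generic

end Charts

end SeveriBrauer

namespace SeveriBrauer

/-! ### Base change of affine charts -/

section BaseChart

variable {k : Type u} [Field k] {P : Scheme.{u}} {p : P ⟶ Spec (CommRingCat.of k)}
  {A : Type u} [CommRing A] [Algebra k A] (j : Spec (CommRingCat.of A) ⟶ P)
  (hj : j ≫ p = Spec.map (CommRingCat.ofHom (algebraMap k A)))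
  (K : Type u) [Field K] [Algebra k K]

theorem isPullback_tensorProduct (k K A : Type u) [CommRing k] [CommRing K] [CommRing A]
    [Algebra k K] [Algebra k A] :
    IsPullback (Spec.map (CommRingCat.ofHom
        (Algebra.TensorProduct.includeLeftRingHom : K →+* K ⊗[k] A)))
      (Spec.map (CommRingCat.ofHom
        (Algebra.TensorProduct.includeRight.toRingHom : A →+* K ⊗[k] A)))
      (Spec.map (CommRingCat.ofHom (algebraMap k K)))
      (Spec.map (CommRingCat.ofHom (algebraMap k A))) :=
  isPullback_SpecMap_of_isPushout _ _ _ _ (CommRingCat.isPushout_tensorProduct k K A)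

/-- The base change `Spec (K ⊗ A) ⟶ P_K` of `j : Spec A ⟶ P`. -/
noncomputable def baseChart : Spec (CommRingCat.of (K ⊗[k] A)) ⟶ pullback p (specExt k K) :=
  pullback.lift
    (Spec.map (CommRingCat.ofHom (Algebra.TensorProduct.includeRight.toRingHom : A →+* K ⊗[k] A)) ≫ j)
    (Spec.map (CommRingCat.ofHom (Algebra.TensorProduct.includeLeftRingHom : K →+* K ⊗[k] A)))
    (by rw [Category.assoc, hj]; exact (isPullback_tensorProduct k K A).w.symm)

theorem baseChart_fst : baseChart j hj K ≫ pullback.fst _ _ = Spec.map (CommRingCat.ofHom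
    (Algebra.TensorProduct.includeRight.toRingHom : A →+* K ⊗[k] A)) ≫ j :=
  pullback.lift_fst _ _ _

theorem baseChart_snd : baseChart j hj K ≫ pullback.snd _ _ = Spec.map (CommRingCat.ofHom
    (Algebra.TensorProduct.includeLeftRingHom : K →+* K ⊗[k] A)) :=
  pullback.lift_snd _ _ _

theorem baseChart_fst_assoc {X : Scheme.{u}} (f : P ⟶ X) :
    baseChart j hj K ≫ pullback.fst _ _ ≫ f = Spec.map (CommRingCat.ofHom
      (Algebra.TensorProduct.includeRight.toRingHom : A →+* K ⊗[k] A)) ≫ j ≫ f := by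
  rw [← Category.assoc, baseChart_fst, Category.assoc]

theorem baseChart_snd_assoc {X : Scheme.{u}} (f : Spec (CommRingCat.of K) ⟶ X) :
    baseChart j hj K ≫ pullback.snd _ _ ≫ f = Spec.map (CommRingCat.ofHom
      (Algebra.TensorProduct.includeLeftRingHom : K →+* K ⊗[k] A)) ≫ f := by
  rw [← Category.assoc, baseChart_snd]

theorem isPullback_baseChart : IsPullback (baseChart j hj K) (Spec.map (CommRingCat.ofHom
    (Algebra.TensorProduct.includeRight.toRingHom : A →+* K ⊗[k] A))) (pullback.fst _ _) j := by
  refine IsPullback.of_right ?_ (baseChart_fst j hj K)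
    (IsPullback.of_hasPullback p (specExt k K)).flip
  rw [baseChart_snd, hj]
  exact isPullback_tensorProduct k K A

instance [IsOpenImmersion j] : IsOpenImmersion (baseChart j hj K) :=
  MorphismProperty.of_isPullback (P := @IsOpenImmersion) (isPullback_baseChart j hj K).flip
    inferInstance

theorem mem_range_baseChart {x : ↥(pullback p (specExt k K))}
    (hx : pullback.fst p (specExt k K) x ∈ Set.range j) : x ∈ Set.range (baseChart j hj K) := by
  obtain ⟨y, hy⟩ := hx
  obtain ⟨z, hz, -⟩ := Scheme.exists_preimage_of_isPullback (isPullback_baseChart j hj K) x y hy.symm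
  exact ⟨z, hz⟩

theorem specMap_baseChart {B : Type u} [CommRing B] [Algebra k B] (a : A →ₐ[k] B)
    {j' : Spec (CommRingCat.of B) ⟶ P} (hj' : j' ≫ p = Spec.map (CommRingCat.ofHom (algebraMap k B)))
    (h : Spec.map (CommRingCat.ofHom (a : A →+* B)) ≫ j = j') :
    Spec.map (CommRingCat.ofHom (Algebra.TensorProduct.map (AlgHom.id K K) a :
      K ⊗[k] A →+* K ⊗[k] B)) ≫ baseChart j hj K = baseChart j' hj' K := by
  apply pullback.hom_ext
  · rw [Category.assoc, baseChart_fst, baseChart_fst, ← h, ← Category.assoc, ← Category.assoc,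
      ← Spec.map_comp, ← Spec.map_comp, ← CommRingCat.ofHom_comp, ← CommRingCat.ofHom_comp]
    congr 3
  · rw [Category.assoc, baseChart_snd, baseChart_snd, ← Spec.map_comp, ← CommRingCat.ofHom_comp]
    congr 2
    ext x
    simp

end BaseChart

/-! ### The generic point of an integral scheme over `k` -/

section GenericPoint

variable {k : Type u} [Field k] {P : Scheme.{u}} 

/-- `η` is the generic point of an integral `k`-scheme. -/
structure IsGenericPoint (p : P ⟶ Spec (CommRingCat.of k)) {Ω : Type u} [Field Ω] [Algebra k Ω]
    (η : Spec (CommRingCat.of Ω) ⟶ P) : Prop where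
  isOver : η ≫ p = Spec.map (CommRingCat.ofHom (algebraMap k Ω))
  exists_algHom : ∀ {A : Type u} [CommRing A] [Algebra k A] [Nontrivial A]
    (j : Spec (CommRingCat.of A) ⟶ P) [IsOpenImmersion j],
    j ≫ p = Spec.map (CommRingCat.ofHom (algebraMap k A)) → ∃ a : A →ₐ[k] Ω,
      Spec.map (CommRingCat.ofHom (a : A →+* Ω)) ≫ j = η ∧ Function.Injective a ∧
      ∀ x, ∃ b c, a c ≠ 0 ∧ x * a c = a b

theorem exists_isGenericPoint [IsIntegral P] (p : P ⟶ Spec (CommRingCat.of k)) :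
    ∃ (Ω : Type u) (_ : Field Ω) (_ : Algebra k Ω) (η : Spec (CommRingCat.of Ω) ⟶ P),
      IsGenericPoint p η := by
  let η : Spec P.functionField ⟶ P := P.fromSpecStalk (genericPoint P)
  let φ : CommRingCat.of k ⟶ P.functionField := Spec.preimage (η ≫ p)
  let alg : Algebra k P.functionField := φ.hom.toAlgebra
  have hη : η ≫ p = Spec.map (CommRingCat.ofHom (algebraMap k P.functionField)) :=
    (Spec.map_preimage (η ≫ p)).symm
  refine ⟨P.functionField, inferInstance, alg, η, hη, ?_⟩
  intro A _ _ _ j _ hj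
  let U := j.opensRange
  have hU : IsAffineOpen U := isAffineOpen_opensRange j
  obtain ⟨x₀⟩ : Nonempty (PrimeSpectrum A) := inferInstance
  have hne : Nonempty U := ⟨⟨j x₀, ⟨x₀, rfl⟩⟩⟩
  have hmem : genericPoint P ∈ U :=
    ((genericPoint_spec P).mem_open_set_iff U.isOpen).mpr (by simpa using hne)
  have hfrac := functionField_isFractionRing_of_isAffineOpen P U hU
  have hr : Set.range j = Set.range hU.fromSpec := by
    rw [hU.range_fromSpec]; rfl
  let f := IsOpenImmersion.isoOfRangeEq j hU.fromSpec hr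
  let g : CommRingCat.of A ⟶ Γ(P, U) := Spec.preimage f.inv
  let g' : Γ(P, U) ⟶ CommRingCat.of A := Spec.preimage f.hom
  have hg : g ≫ g' = 𝟙 _ := Spec.map_injective (by
    rw [Spec.map_comp, Spec.map_preimage, Spec.map_preimage, f.hom_inv_id, Spec.map_id])
  have hg' : g' ≫ g = 𝟙 _ := Spec.map_injective (by
    rw [Spec.map_comp, Spec.map_preimage, Spec.map_preimage, f.inv_hom_id, Spec.map_id])
  have hgx : ∀ x, g (g' x) = x := fun x => congrArg (fun h => h x) (congrArg (·.hom) hg')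
  have hgx' : ∀ x, g' (g x) = x := fun x => congrArg (fun h => h x) (congrArg (·.hom) hg)
  let a₀ : CommRingCat.of A ⟶ P.functionField := g ≫ P.presheaf.germ U (genericPoint P) hmem
  have ha : Spec.map a₀ ≫ j = η := by
    have h1 : f.inv ≫ j = hU.fromSpec := IsOpenImmersion.isoOfRangeEq_inv_fac _ _ _
    rw [Spec.map_comp, Spec.map_preimage, Category.assoc, h1]
    exact hU.fromSpecStalk_eq_fromSpecStalk hmem
  have hinj : Function.Injective (P.presheaf.germ U (genericPoint P) hmem) :=
    IsFractionRing.injective Γ(P, U) P.functionField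
  have hcomm : a₀.hom.comp (algebraMap k A) = algebraMap k P.functionField := by
    apply specMap_ofHom_injective
    rw [← hη, ← ha, Category.assoc, hj, ← Spec.map_comp]
    rfl
  refine ⟨{ a₀.hom with commutes' := fun c => congrArg (fun h => h c) hcomm }, ha, ?_, ?_⟩
  · intro x y hxy
    rw [← hgx' x, ← hgx' y]
    exact congrArg _ (hinj hxy)
  · intro x
    obtain ⟨n, d, hd, rfl⟩ := IsFractionRing.div_surjective (A := Γ(P, U)) x
    have hd0 : algebraMap Γ(P, U) P.functionField d ≠ 0 :=
      fun h => nonZeroDivisors.ne_zero hd (hinj (h.trans (map_zero _).symm))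
    have key : ∀ y, a₀.hom (g' y) = algebraMap Γ(P, U) P.functionField y := fun y =>
      congrArg (P.presheaf.germ U (genericPoint P) hmem) (hgx y)
    refine ⟨g' n, g' d, ?_, ?_⟩
    · change a₀.hom (g' d) ≠ 0
      rwa [key]
    · change _ * a₀.hom (g' d) = a₀.hom (g' n)
      rw [key, key, div_mul_cancel₀ _ hd0]

theorem exists_affine_chart (p : P ⟶ Spec (CommRingCat.of k)) (x : P) :
    ∃ (A : Type u) (_ : CommRing A) (_ : Algebra k A) (_ : Nontrivial A)
      (j : Spec (CommRingCat.of A) ⟶ P), IsOpenImmersion j ∧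
      j ≫ p = Spec.map (CommRingCat.ofHom (algebraMap k A)) ∧ x ∈ Set.range j := by
  let i := P.affineOpenCover.idx x
  let j : Spec (P.affineOpenCover.X i) ⟶ P := P.affineOpenCover.f i
  let φ : CommRingCat.of k ⟶ P.affineOpenCover.X i := Spec.preimage (j ≫ p)
  obtain ⟨t, ht⟩ := P.affineOpenCover.covers x
  refine ⟨P.affineOpenCover.X i, inferInstance, φ.hom.toAlgebra,
    PrimeSpectrum.nonempty_iff_nontrivial.1 ⟨t⟩, j, inferInstance,
    (Spec.map_preimage (j ≫ p)).symm, ⟨t, ht⟩⟩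

end GenericPoint

/-! ### Function field and charts of a form of projective space -/

section FormCharts

variable {k F Ω 𝓕 : Type u} [Field k] [Field F] [Algebra k F] [Field Ω] [Algebra k Ω] [Field 𝓕]
  {N : ℕ} [Algebra (MvPolynomial (Fin (N + 1)) F) 𝓕] [Algebra F 𝓕]
  [IsFractionRing (MvPolynomial (Fin (N + 1)) F) 𝓕]
  [IsScalarTower F (MvPolynomial (Fin (N + 1)) F) 𝓕]
  {P : Scheme.{u}} {p : P ⟶ Spec (CommRingCat.of k)}

variable (𝓕) in
/-- The generic point of projective space. -/
noncomputable def genPt : Spec (CommRingCat.of 𝓕) ⟶ projSpace N F :=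
  fieldPt (algebraMap (MvPolynomial (Fin (N + 1)) F) 𝓕)
    (exists_X_ne_zero (IsFractionRing.injective _ 𝓕))

theorem mem_baseChange_range_iff {A : Type u} [CommRing A] [Algebra k A] (a : A →ₐ[k] Ω)
    {x : F ⊗[k] Ω} : x ∈ (LinearMap.range a.toLinearMap).baseChange F ↔
      ∃ b, Algebra.TensorProduct.map (AlgHom.id F F) a b = x := by
  constructor
  · intro hx
    rw [Submodule.baseChange_eq_span] at hx
    induction hx using Submodule.span_induction with
    | zero => exact ⟨0, map_zero _⟩
    | add x y _ _ hx hy =>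
      obtain ⟨b, rfl⟩ := hx
      obtain ⟨c, rfl⟩ := hy
      exact ⟨b + c, map_add _ _ _⟩
    | smul a x _ hx =>
      obtain ⟨b, rfl⟩ := hx
      exact ⟨a • b, map_smul _ _ _⟩
    | mem x hx =>
      obtain ⟨m, ⟨b, rfl⟩, rfl⟩ := hx
      exact ⟨1 ⊗ₜ b, by simp⟩
  · rintro ⟨b, rfl⟩
    induction b using TensorProduct.induction_on with
    | zero => simp
    | add x y hx hy => rw [map_add]; exact add_mem hx hy
    | tmul c b =>
      simpa using Submodule.tmul_mem_baseChange_of_mem c (⟨b, rfl⟩ : a b ∈ LinearMap.range a.toLinearMap)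

theorem exists_common_denominator {A : Type u} [CommRing A] [Algebra k A] (a : A →ₐ[k] Ω)
    (ha : ∀ x, ∃ b c, a c ≠ 0 ∧ x * a c = a b) (x : F ⊗[k] Ω) : ∃ c b, a c ≠ 0 ∧
      x * (1 ⊗ₜ a c) = Algebra.TensorProduct.map (AlgHom.id F F) a b := by
  induction x using TensorProduct.induction_on with
  | zero => exact ⟨1, 0, by simp, by simp⟩
  | add x y hx hy =>
    obtain ⟨c, b, hc, h⟩ := hx
    obtain ⟨c', b', hc', h'⟩ := hy
    refine ⟨c * c', b * (1 ⊗ₜ c') + b' * (1 ⊗ₜ c), by rw [map_mul]; exact mul_ne_zero hc hc', ?_⟩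
    have h1 : (1 : F) ⊗ₜ[k] a (c * c') = (1 ⊗ₜ a c) * (1 ⊗ₜ a c') := by simp
    rw [h1, map_add, map_mul, map_mul, ← h, ← h', Algebra.TensorProduct.map_tmul,
      Algebra.TensorProduct.map_tmul, AlgHom.id_apply]
    ring
  | tmul f y =>
    obtain ⟨b, c, hc, h⟩ := ha y
    exact ⟨c, f ⊗ₜ b, hc, by simp [h]⟩

variable (Φ : pullback p (specExt k F) ≅ projSpace N F)
  (hΦ : Φ.hom ≫ projSpaceStr N F = pullback.snd _ _)

include hΦ in
theorem exists_algHom_generic {A : Type u} [CommRing A] [Algebra k A] [Nontrivial A]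
    (j : Spec (CommRingCat.of A) ⟶ P) [IsOpenImmersion j]
    (hj : j ≫ p = Spec.map (CommRingCat.ofHom (algebraMap k A))) :
    ∃ e : F ⊗[k] A →ₐ[F] 𝓕, Spec.map (CommRingCat.ofHom (e : F ⊗[k] A →+* 𝓕)) ≫
      baseChart j hj F ≫ Φ.hom = genPt 𝓕 := by
  have hinj : Function.Injective (Algebra.TensorProduct.includeRight : A →ₐ[k] F ⊗[k] A) :=
    Algebra.TensorProduct.includeRight_injective (algebraMap k F).injective
  have := hinj.nontrivial
  obtain ⟨e, he⟩ := exists_ringHom_generic (j := baseChart j hj F ≫ Φ.hom)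
    (IsFractionRing.injective (MvPolynomial (Fin (N + 1)) F) 𝓕)
    (exists_X_ne_zero (IsFractionRing.injective (MvPolynomial (Fin (N + 1)) F) 𝓕))
  have hcomm : e.comp Algebra.TensorProduct.includeLeftRingHom = algebraMap F 𝓕 := by
    apply specMap_ofHom_injective
    have h1 := congrArg (· ≫ projSpaceStr N F) he
    simp only [Category.assoc, fieldPt_str, hΦ, baseChart_snd] at h1
    rw [CommRingCat.ofHom_comp, Spec.map_comp, h1, IsScalarTower.algebraMap_eq F
      (MvPolynomial (Fin (N + 1)) F) 𝓕]
    rfl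
  exact ⟨{ e with commutes' := fun c => congrArg (fun h => h c) hcomm }, he⟩

theorem forall_regularAt {A : Type u} [CommRing A] {j : Spec (CommRingCat.of A) ⟶ projSpace N F}
    [IsOpenImmersion j] {e : A →+* 𝓕} (he : Spec.map (CommRingCat.ofHom e) ≫ j = genPt 𝓕) (b : A)
    (t : PrimeSpectrum A) : RegularAt (show projSpace N F from j t) (e b) := by
  obtain ⟨n, p, q, hp, hq, hqt, h⟩ := exists_fraction (j := j) t b
  have h1 := h (algebraMap _ 𝓕) (exists_X_ne_zero (IsFractionRing.injective _ 𝓕)) e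
  refine ⟨n, p, q, hp, hq, hqt, h1 ?_ he⟩
  rw [map_ne_zero_iff _ (IsFractionRing.injective (MvPolynomial (Fin (N + 1)) F) 𝓕)]
  rintro rfl
  exact hqt (Ideal.zero_mem _)

variable {η : Spec (CommRingCat.of Ω) ⟶ P} (hη : IsGenericPoint p η)

include hΦ in
/-- The rational functions on a form of projective space, as rational functions on projective
space. -/
theorem exists_algHom_functionField [Nonempty P] :
    ∃ E : F ⊗[k] Ω →ₐ[F] 𝓕, Function.Injective E ∧
      Spec.map (CommRingCat.ofHom (E : F ⊗[k] Ω →+* 𝓕)) ≫ baseChart η hη.isOver F ≫ Φ.hom =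
        genPt 𝓕 := by
  obtain ⟨x⟩ := ‹Nonempty P›
  obtain ⟨A, _, _, _, j, _, hj, -⟩ := exists_affine_chart p x
  obtain ⟨e, he⟩ := exists_algHom_generic (𝓕 := 𝓕) Φ hΦ j hj
  obtain ⟨a, haj, ha, hfrac⟩ := hη.exists_algHom j hj
  have heinj : Function.Injective e := generic_injective (j := baseChart j hj F ≫ Φ.hom)
    (IsFractionRing.injective (MvPolynomial (Fin (N + 1)) F) 𝓕) (h :=
    (exists_X_ne_zero (IsFractionRing.injective (MvPolynomial (Fin (N + 1)) F) 𝓕))) he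
  have hinj : Function.Injective (Algebra.TensorProduct.includeRight : A →ₐ[k] F ⊗[k] A) :=
    Algebra.TensorProduct.includeRight_injective (algebraMap k F).injective
  let e₀ : A →+* 𝓕 := (e : F ⊗[k] A →+* 𝓕).comp Algebra.TensorProduct.includeRight.toRingHom
  have he₀ : Function.Injective e₀ := heinj.comp hinj
  let _ : Algebra A Ω := (a : A →+* Ω).toAlgebra
  have : IsDomain A := ha.isDomain (a : A →+* Ω)
  have : FaithfulSMul A Ω := (faithfulSMul_iff_algebraMap_injective A Ω).2 ha
  have : IsFractionRing A Ω := IsFractionRing.of_field _ _ fun z => by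
    obtain ⟨b, c, hc, h⟩ := hfrac z
    exact ⟨b, c, (eq_div_iff hc).2 h⟩
  let _ : Algebra k 𝓕 := ((algebraMap F 𝓕).comp (algebraMap k F)).toAlgebra
  have : IsScalarTower k F 𝓕 := IsScalarTower.of_algebraMap_eq fun _ => rfl
  let E₀ : Ω →+* 𝓕 := IsFractionRing.lift he₀
  have hE₀ : ∀ b, E₀ (a b) = e (1 ⊗ₜ b) := IsFractionRing.lift_algebraMap he₀
  have hE₀k : ∀ c : k, E₀ (algebraMap k Ω c) = algebraMap k 𝓕 c := fun c => by
    rw [← a.commutes, hE₀, IsScalarTower.algebraMap_apply k F 𝓕, ← e.commutes]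
    congr 1
    rw [Algebra.TensorProduct.algebraMap_apply, Algebra.algebraMap_eq_smul_one (R := k) c,
      Algebra.algebraMap_eq_smul_one (R := k) (A := F) c, TensorProduct.tmul_smul,
      TensorProduct.smul_tmul']
    rfl
  let E : F ⊗[k] Ω →ₐ[F] 𝓕 := Algebra.TensorProduct.lift (Algebra.ofId F 𝓕)
    { E₀ with commutes' := hE₀k } fun _ _ => Commute.all _ _
  have hE : E.comp (Algebra.TensorProduct.map (AlgHom.id F F) a) = e := by
    ext b
    change algebraMap F 𝓕 1 * E₀ (a b) = e (1 ⊗ₜ b)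
    rw [map_one, one_mul, hE₀]
  refine ⟨E, ?_, ?_⟩
  -- Clear denominators by an element of `A`; on `F ⊗ A` injectivity is `generic_injective`.
  · rw [injective_iff_map_eq_zero]
    intro x hx
    obtain ⟨c, b, hc, h⟩ := exists_common_denominator a hfrac x
    have h1 : e b = 0 := by
      rw [← hE, AlgHom.comp_apply, ← h, map_mul, hx, zero_mul]
    rw [(map_eq_zero_iff _ heinj).1 h1, map_zero] at h
    have h2 : (1 ⊗ₜ a c) * (1 ⊗ₜ (a c)⁻¹) = (1 : F ⊗[k] Ω) := by
      rw [Algebra.TensorProduct.tmul_mul_tmul, mul_inv_cancel₀ hc, one_mul,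
        Algebra.TensorProduct.one_def]
    rw [← mul_one x, ← h2, ← mul_assoc, h, zero_mul]
  · rw [← specMap_baseChart j hj F a hη.isOver haj, ← he, ← hE, Category.assoc,
      ← Category.assoc, ← Spec.map_comp, ← CommRingCat.ofHom_comp]
    rfl

include hΦ in
-- The charts are affine neighbourhoods `Spec A` of the points of `P`, indexed by these points. `G`
-- is the image of `A` in the function field and `O` is the open subset `Spec (F ⊗ A)` of projective
-- space; the functions regular on it are the elements of `F ⊗ A`.
theorem exists_rationalCharts [Nonempty P] [Algebra k 𝓕] :
    ∃ D : RationalCharts k F N Ω 𝓕, Spec.map (CommRingCat.ofHom (D.E : F ⊗[k] Ω →+* 𝓕)) ≫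
        baseChart η hη.isOver F ≫ Φ.hom = genPt 𝓕 ∧
      ∀ x : P, ∃ (V : D.ι) (A : Type u) (_ : CommRing A) (_ : Algebra k A) (_ : Nontrivial A)
        (j : Spec (CommRingCat.of A) ⟶ P) (a : A →ₐ[k] Ω), IsOpenImmersion j ∧
        j ≫ p = Spec.map (CommRingCat.ofHom (algebraMap k A)) ∧ x ∈ Set.range j ∧
        Spec.map (CommRingCat.ofHom (a : A →+* Ω)) ≫ j = η ∧ Function.Injective a ∧
        LinearMap.range a.toLinearMap = D.G V ∧ (D.O V).Nonempty := by
  obtain ⟨E, hEinj, hE⟩ := exists_algHom_functionField (𝓕 := 𝓕) Φ hΦ hη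
  have key : ∀ x : P, ∃ (G : Submodule k Ω) (O : Set (projSpace N F)) (A : Type u)
      (_ : CommRing A) (_ : Algebra k A) (_ : Nontrivial A)
      (j : Spec (CommRingCat.of A) ⟶ P) (a : A →ₐ[k] Ω) (_ : IsOpenImmersion j)
      (hj : j ≫ p = Spec.map (CommRingCat.ofHom (algebraMap k A))), x ∈ Set.range j ∧
        Spec.map (CommRingCat.ofHom (a : A →+* Ω)) ≫ j = η ∧ Function.Injective a ∧
        LinearMap.range a.toLinearMap = G ∧ Set.range (baseChart j hj F ≫ Φ.hom) = O := fun x => by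
    obtain ⟨A, _, _, _, j, _, hj, hx⟩ := exists_affine_chart p x
    obtain ⟨a, haj, ha, hfrac⟩ := hη.exists_algHom j hj
    exact ⟨_, _, A, _, _, ‹_›, j, a, ‹_›, hj, hx, haj, ha, rfl, rfl⟩
  choose G O A rA alg nt j a hjo hj hx haj ha hG hO using key
  let e : ∀ V, F ⊗[k] A V →ₐ[F] 𝓕 := fun V => E.comp (Algebra.TensorProduct.map (AlgHom.id F F) (a V))
  have he : ∀ V, Spec.map (CommRingCat.ofHom (e V : F ⊗[k] A V →+* 𝓕)) ≫
      baseChart (j V) (hj V) F ≫ Φ.hom = genPt 𝓕 := fun V => by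
    rw [← hE, ← specMap_baseChart (j V) (hj V) F (a V) hη.isOver (haj V), Category.assoc,
      ← Spec.map_comp_assoc, ← CommRingCat.ofHom_comp]
    rfl
  have hmem : ∀ V b, (∃ x ∈ (G V).baseChange F, E x = b) ↔ ∃ y, e V y = b := fun V b => by
    constructor
    · rintro ⟨x, hx, rfl⟩
      rw [← hG, mem_baseChange_range_iff] at hx
      obtain ⟨y, rfl⟩ := hx
      exact ⟨y, rfl⟩
    · rintro ⟨y, rfl⟩
      exact ⟨_, hG V ▸ (mem_baseChange_range_iff (a V)).2 ⟨y, rfl⟩, rfl⟩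
  have hS := IsFractionRing.injective (MvPolynomial (Fin (N + 1)) F) 𝓕
  have heinj : ∀ V, Function.Injective (e V) := fun V => 
    generic_injective (j := baseChart (j V) (hj V) F ≫ Φ.hom) hS (h := exists_X_ne_zero hS) (he V)
  refine ⟨{ E := E, injective := hEinj, ι := P, G := G, O := O, cover := ?_, mem_iff := ?_,
            exists_denom := ?_ }, hE, ?_⟩
  · intro y
    let x := Φ.inv y
    refine ⟨pullback.fst p (specExt k F) x, ?_⟩
    rw [← hO]
    obtain ⟨t, ht⟩ := mem_range_baseChart (j _) (hj _) F (hx (pullback.fst p (specExt k F) x))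
    refine ⟨t, ?_⟩
    rw [Scheme.Hom.comp_apply, ht]
    change Φ.hom (Φ.inv (show projSpace N F from y)) = _
    rw [← Scheme.Hom.comp_apply, Φ.inv_hom_id]
    rfl
  · intro V b
    rw [hmem]
    constructor
    · rintro ⟨y, rfl⟩ z hz
      rw [← hO] at hz
      obtain ⟨t, rfl⟩ := hz
      exact forall_regularAt (he V) y t
    · intro h
      exact exists_eq_of_forall (j := baseChart (j V) (hj V) F ≫ Φ.hom) hS
        (h := exists_X_ne_zero hS) (he V) fun t => h _ ((hO V) ▸ ⟨t, rfl⟩)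
  · intro V y hy b hb
    rw [← hO] at hy
    obtain ⟨t, rfl⟩ := hy
    obtain ⟨n, p, q, hp, hq, hqt, hbpq⟩ := hb
    obtain ⟨s, hs, x, hsx⟩ := exists_mul_eq (j := baseChart (j V) (hj V) F ≫ Φ.hom) hS
      (h := exists_X_ne_zero hS) (he V) hp hq hqt hbpq
    have hm : ∀ y, Algebra.TensorProduct.map (AlgHom.id F F) (a V) y ∈ (G V).baseChange F :=
      fun y => hG V ▸ (mem_baseChange_range_iff (a V)).2 ⟨y, rfl⟩
    refine ⟨_, hm x, _, hm s, hsx, ?_, forall_regularAt (he V) s t, ?_⟩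
    · change e V s ≠ 0
      rw [map_ne_zero_iff _ (heinj V)]
      rintro rfl
      exact hs (Ideal.zero_mem _)
    · exact exists_fraction_inv (j := baseChart (j V) (hj V) F ≫ Φ.hom) hS
        (h := exists_X_ne_zero hS) (he V) hs
  · intro x
    refine ⟨x, A x, rA x, alg x, nt x, j x, a x, hjo x, hj x, hx x, haj x, ha x, hG x, ?_⟩
    obtain ⟨t⟩ : Nonempty (PrimeSpectrum (F ⊗[k] A x)) :=
      have := (Algebra.TensorProduct.includeRight_injective (R := k) (A := F) (B := A x)
        (algebraMap k F).injective).nontrivial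
      inferInstance
    change (O x).Nonempty
    rw [← hO]
    exact ⟨_, t, rfl⟩

end FormCharts

end SeveriBrauer

/-! ### Complementary linear subspaces and their conjugates -/

namespace SeveriBrauer

/-- Independence and spanning say that the `M i` together form an isomorphism from the direct sum;
the `D i` are the components of its inverse. -/
theorem exists_dual_matrices {F ι : Type*} [Field F] [Fintype ι] [DecidableEq ι] {n : ℕ} {m : ι → ℕ}
    (M : ∀ i, Matrix (Fin n) (Fin (m i)) F) (hM : ∀ i, ∃ D : Matrix (Fin (m i)) (Fin n) F, D * M i = 1)
    (hind : iSupIndep fun i => LinearMap.range (M i).mulVecLin)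
    (hsup : ⨆ i, LinearMap.range (M i).mulVecLin = ⊤) :
    ∃ D : ∀ i, Matrix (Fin (m i)) (Fin n) F, (∀ i, D i * M i = 1) ∧
      (∀ i j, i ≠ j → D i * M j = 0) ∧ ∑ i, M i * D i = 1 := by
  let T : (∀ i, Fin (m i) → F) →ₗ[F] (Fin n → F) := ∑ i, (M i).mulVecLin ∘ₗ LinearMap.proj i
  have hT : ∀ c, T c = ∑ i, (M i).mulVec (c i) := fun c => by simp [T]
  have hTs : ∀ i c, T (Pi.single i c) = (M i).mulVec c := fun i c => by
    rw [hT, Finset.sum_eq_single i]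
    · simp
    · intro j _ hj; simp [Pi.single_eq_of_ne hj]
    · simp
  have hbij : Function.Bijective T := by
    constructor
    · rw [injective_iff_map_eq_zero]
      intro c hc
      rw [hT] at hc
      have := (iSupIndep_iff_finsetSum_eq_zero_imp_eq_zero _).1 hind Finset.univ
        (fun i => (M i).mulVec (c i)) (fun i _ => ⟨c i, rfl⟩) hc
      funext i
      obtain ⟨D, hD⟩ := hM i
      have h1 := congrArg D.mulVec (this i (Finset.mem_univ i))
      rwa [Matrix.mulVec_mulVec, hD, Matrix.one_mulVec, Matrix.mulVec_zero] at h1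
    · rw [← LinearMap.range_eq_top, ← top_le_iff, ← hsup]
      refine iSup_le fun i => ?_
      rintro _ ⟨c, rfl⟩
      exact ⟨Pi.single i c, hTs i c⟩
  let e := LinearEquiv.ofBijective T hbij
  have he : ∀ i c, e.symm ((M i).mulVec c) = Pi.single i c := fun i c => by
    rw [← hTs]; exact e.symm_apply_apply _
  let D : ∀ i, Matrix (Fin (m i)) (Fin n) F := fun i =>
    LinearMap.toMatrix' (LinearMap.proj i ∘ₗ e.symm.toLinearMap)
  have hD : ∀ i v, (D i).mulVec v = e.symm v i := fun i v => by
    rw [← Matrix.toLin'_apply, Matrix.toLin'_toMatrix']; rfl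
  refine ⟨D, fun i => ?_, fun i j hij => ?_, ?_⟩
  · refine Matrix.mulVec_injective (funext fun v => ?_)
    rw [← Matrix.mulVec_mulVec, hD, he, Pi.single_eq_same, Matrix.one_mulVec]
  · refine Matrix.mulVec_injective (funext fun v => ?_)
    rw [← Matrix.mulVec_mulVec, hD, he, Pi.single_eq_of_ne hij, Matrix.zero_mulVec]
  · refine Matrix.mulVec_injective (funext fun v => ?_)
    rw [Matrix.sum_mulVec, Matrix.one_mulVec]
    simp_rw [← Matrix.mulVec_mulVec, hD]
    rw [← hT]
    exact e.apply_symm_apply v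

section Cover

/-- The cover of projective space by the open sets where one of the forms `q i` does not vanish. -/
noncomputable def chartCover {N : ℕ} {R : Type u} [CommRing R] {ι : Type*} {d : ι → ℕ}
    {q : ι → MvPolynomial (Fin (N + 1)) R} (hq : ∀ i, q i ∈ grading N R (d i)) (hd : ∀ i, 0 < d i)
    (h : ∀ y : projSpace N R, ∃ i, q i ∉ ptIdeal y) : (projSpace N R).AffineOpenCover where
  I₀ := ι
  X i := CommRingCat.of (AwayRing N (q i))
  f i := chartι (hq i) (hd i)
  idx y := (h y).choose
  covers y := (mem_range_chartι _ _).2 (h y).choose_spec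

theorem hom_ext_of_charts {N : ℕ} {R : Type u} [CommRing R] {ι : Type*} {d : ι → ℕ}
    {q : ι → MvPolynomial (Fin (N + 1)) R} (hq : ∀ i, q i ∈ grading N R (d i)) (hd : ∀ i, 0 < d i)
    (h : ∀ y : projSpace N R, ∃ i, q i ∉ ptIdeal y) {X : Scheme.{u}} {f g : projSpace N R ⟶ X}
    (hfg : ∀ i, chartι (hq i) (hd i) ≫ f = chartι (hq i) (hd i) ≫ g) : f = g :=
  (chartCover hq hd h).openCover.hom_ext _ _ hfg

variable {N m : ℕ} {R A : Type u} [CommRing R] [CommRing A] (f : R →+* A)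
  (M : Matrix (Fin (N + 1)) (Fin (m + 1)) A)
  (hM : ∃ D : Matrix (Fin (m + 1)) (Fin (N + 1)) A, D * M = 1)

theorem linearSubst_X (i : Fin (N + 1)) : linearSubst f M (MvPolynomial.X i) =
    ∑ j, MvPolynomial.C (M i j) * MvPolynomial.X j :=
  MvPolynomial.eval₂Hom_X' _ _ _

theorem linearSubst_C (r : R) : linearSubst f M (MvPolynomial.C r) = MvPolynomial.C (f r) :=
  MvPolynomial.eval₂Hom_C _ _ _

include hM in
theorem exists_linearSubst_X_notMem (y : projSpace m A) :
    ∃ i, linearSubst f M (MvPolynomial.X i) ∉ ptIdeal y := by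
  obtain ⟨D, hD⟩ := hM
  obtain ⟨j, hj⟩ := exists_X_notMem_ptIdeal y
  by_contra! h
  refine hj ?_
  have hsum : (MvPolynomial.X j : MvPolynomial (Fin (m + 1)) A) =
      ∑ i, MvPolynomial.C (D j i) * linearSubst f M (MvPolynomial.X i) := by
    simp_rw [linearSubst_X, Finset.mul_sum, ← mul_assoc, ← MvPolynomial.C_mul]
    rw [Finset.sum_comm]
    simp_rw [← Finset.sum_mul, ← map_sum, ← Matrix.mul_apply, hD, Matrix.one_apply]
    simp
  rw [hsum]
  exact Ideal.sum_mem _ fun i _ => Ideal.mul_mem_left _ _ (h i)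

theorem linearMap_str : linearMap f M hM ≫ projSpaceStr N R =
    projSpaceStr m A ≫ Spec.map (CommRingCat.ofHom f) := by
  refine hom_ext_of_charts (fun i => (linearSubst f M).map_mem (X_mem_grading N R i))
    (fun _ => one_pos) (exists_linearSubst_X_notMem f M hM) fun i => ?_
  rw [← Category.assoc, ← Category.assoc, chartι_linearMap f M hM (X_mem_grading N R i) one_pos, chartι_str, Category.assoc, chartι_str,
    ← Spec.map_comp, ← Spec.map_comp, ← CommRingCat.ofHom_comp, ← CommRingCat.ofHom_comp]
  congr 2
  refine RingHom.ext fun r => ?_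
  change HomogeneousLocalization.mk (𝒜 := grading m A)
    (x := Submonoid.powers (linearSubst f M (MvPolynomial.X i))) _ = HomogeneousLocalization.mk _
  congr 1
  ext
  · rfl
  · exact congrArg (MvPolynomial.coeff _) (linearSubst_C f M r)
  · exact congrArg (MvPolynomial.coeff _) (map_one (linearSubst f M))

end Cover

section ConjugateData

variable {k K : Type u} [Field k] [Field K] [Algebra k K]  {F : Type u} [Field F] [Algebra k F]

/-- The conjugates of `i` are the linear subspaces given by the matrices `M σ`, and these are
complementary, with projections `D σ`. -/
structure ConjugateData {N : ℕ} {L P : Scheme.{u}} (p : P ⟶ Spec (CommRingCat.of k))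
    (i : L ⟶ pullback p (specExt k K)) [FiniteDimensional k K]
    (Φ : pullback p (specExt k F) ≅ projSpace N F) where
  m : (K →ₐ[k] F) → ℕ
  M : ∀ σ, Matrix (Fin (N + 1)) (Fin (m σ + 1)) F
  D : ∀ σ, Matrix (Fin (m σ + 1)) (Fin (N + 1)) F
  D_mul_M_self : ∀ σ, D σ * M σ = 1
  D_mul_M_of_ne : ∀ σ τ, σ ≠ τ → D σ * M τ = 0
  sum_M_mul_D : ∑ σ, M σ * D σ = 1
  a : ∀ σ, projSpace (m σ) F ⟶ L
  isPullback : ∀ σ, IsPullback (a σ) (projSpaceStr (m σ) F) (i ≫ pullback.snd _ _)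
    (Spec.map (CommRingCat.ofHom (σ : K →+* F)))
  a_fst : ∀ σ, a σ ≫ i ≫ pullback.fst _ _ =
    linearMap (RingHom.id F) (M σ) ⟨D σ, D_mul_M_self σ⟩ ≫ Φ.inv ≫ pullback.fst _ _

theorem ConjugatesSpanIndependently.exists_conjugateData [FiniteDimensional k K]
    {N : ℕ} {L P : Scheme.{u}}
    {p : P ⟶ Spec (CommRingCat.of k)} {i : L ⟶ pullback p (specExt k K)}
    (h : ConjugatesSpanIndependently p N i) :
    ∃ φ : GeometricTrivialization p N, Nonempty (ConjugateData p i φ.iso) := by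
  classical
  obtain ⟨φ, W, hlin, hind, hsup⟩ := h
  choose m M hM e he hW using hlin
  obtain rfl : W = fun σ => LinearMap.range (M σ).mulVecLin := funext fun σ => (hW σ).symm
  obtain ⟨D, h1, h2, h3⟩ := exists_dual_matrices M hM hind hsup
  have ha : ∀ σ, (e σ).hom ≫ projSpaceStr (m σ) _ = pullback.snd _ _ := fun σ => by
    have := congrArg (· ≫ projSpaceStr N _) (he σ)
    simpa only [Category.assoc, linearMap_str, φ.isOver, conjugate, pullback.lift_snd,
      CommRingCat.ofHom_id, Spec.map_id, Category.comp_id] using this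
  refine ⟨φ, ⟨⟨m, M, D, h1, h2, h3, fun σ => (e σ).inv ≫ pullback.fst _ _, fun σ => ?_,
    fun σ => ?_⟩⟩⟩
  · refine IsPullback.of_iso (IsPullback.of_hasPullback _ _) (e σ) (Iso.refl _) (Iso.refl _)
      (Iso.refl _) ?_ ?_ ?_ ?_
    · simp
    · simp [ha]
    · simp
    · simp
  · have h4 := (Iso.eq_inv_comp (e σ)).2 (he σ)
    rw [h4]
    simp only [conjugate, Category.assoc, Iso.hom_inv_id_assoc]
    rw [pullback.lift_fst]

end ConjugateData

end SeveriBrauer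

/-! ### Composition of linear substitutions, and cartesian squares -/

namespace SeveriBrauer

section LinearSubst

variable {R : Type u} [CommRing R]

theorem linearSubst_linearSubst {l m n : ℕ} {R₁ R₂ : Type u} [CommRing R₁] [CommRing R₂]
    (f : R₁ →+* R₂) (g : R₂ →+* R) (M : Matrix (Fin (n + 1)) (Fin (m + 1)) R₂)
    (M' : Matrix (Fin (m + 1)) (Fin (l + 1)) R) (p : MvPolynomial (Fin (n + 1)) R₁) :
    linearSubst g M' (linearSubst f M p) = linearSubst (g.comp f) (M.map g * M') p := by
  have : (linearSubst g M' : MvPolynomial (Fin (m + 1)) R₂ →+* MvPolynomial (Fin (l + 1)) R).comp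
      (linearSubst f M : MvPolynomial (Fin (n + 1)) R₁ →+* MvPolynomial (Fin (m + 1)) R₂) =
      (linearSubst (g.comp f) (M.map g * M') : MvPolynomial (Fin (n + 1)) R₁ →+*
        MvPolynomial (Fin (l + 1)) R) := by
    apply MvPolynomial.ringHom_ext
    · intro r
      change linearSubst g M' (linearSubst f M (MvPolynomial.C r)) =
        linearSubst (g.comp f) (M.map g * M') (MvPolynomial.C r)
      simp [linearSubst_C]
    · intro i
      change linearSubst g M' (linearSubst f M (MvPolynomial.X i)) =
        linearSubst (g.comp f) (M.map g * M') (MvPolynomial.X i)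
      simp only [linearSubst_X, map_sum, map_mul, linearSubst_C, Matrix.mul_apply, Matrix.map_apply,
        Finset.mul_sum, Finset.sum_mul, mul_assoc]
      rw [Finset.sum_comm]
  exact congrArg (fun h => h p) this

theorem linearSubst_one {n : ℕ} (p : MvPolynomial (Fin (n + 1)) R) :
    linearSubst (RingHom.id R) (1 : Matrix (Fin (n + 1)) (Fin (n + 1)) R) p = p := by
  have : (linearSubst (RingHom.id R) (1 : Matrix (Fin (n + 1)) (Fin (n + 1)) R) :
      MvPolynomial (Fin (n + 1)) R →+* MvPolynomial (Fin (n + 1)) R) = RingHom.id _ := by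
    apply MvPolynomial.ringHom_ext
    · exact fun r => linearSubst_C _ _ r
    · exact fun i => (linearSubst_X _ _ i).trans (by simp [Matrix.one_apply])
  exact congrArg (fun h => h p) this

theorem linearSubst_eq_matSubst {F : Type u} [Field F] {n : ℕ} (E : Matrix (Fin (n + 1)) (Fin (n + 1)) F)
    (p : MvPolynomial (Fin (n + 1)) F) : linearSubst (RingHom.id F) E p = matSubst E p := by
  have : (linearSubst (RingHom.id F) E : MvPolynomial (Fin (n + 1)) F →+* MvPolynomial (Fin (n + 1)) F)
      = (matSubst E : MvPolynomial (Fin (n + 1)) F →+* MvPolynomial (Fin (n + 1)) F) := by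
    apply MvPolynomial.ringHom_ext
    · intro r
      exact (linearSubst_C _ _ r).trans ((matSubst E).commutes r).symm
    · intro i
      exact (linearSubst_X _ _ i).trans (matSubst_X E i).symm
  exact congrArg (fun h => h p) this

end LinearSubst

section Squares

theorem isPullback_mapLeft {k K F A : Type u} [Field k] [Field K] [Field F] [Algebra k K]
    [Algebra k F] [CommRing A] [Algebra k A] (σ : K →ₐ[k] F) :
    IsPullback (Spec.map (CommRingCat.ofHom (mapLeft A σ : K ⊗[k] A →+* F ⊗[k] A)))
      (Spec.map (CommRingCat.ofHom (Algebra.TensorProduct.includeLeftRingHom : F →+* F ⊗[k] A)))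
      (Spec.map (CommRingCat.ofHom (Algebra.TensorProduct.includeLeftRingHom : K →+* K ⊗[k] A)))
      (Spec.map (CommRingCat.ofHom (σ : K →+* F))) := by
  refine IsPullback.of_right ?_ ?_ (isPullback_tensorProduct k K A).flip
  · rw [← Spec.map_comp, ← Spec.map_comp, ← CommRingCat.ofHom_comp, ← CommRingCat.ofHom_comp,
      σ.comp_algebraMap]
    convert (isPullback_tensorProduct k F A).flip using 4
    ext x
    simp
  · rw [← Spec.map_comp, ← Spec.map_comp, ← CommRingCat.ofHom_comp, ← CommRingCat.ofHom_comp]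
    congr 2

theorem isPullback_quotient {A B : Type u} [CommRing A] [CommRing B] (f : A →+* B) (I : Ideal A) :
    IsPullback (Spec.map (CommRingCat.ofHom (Ideal.quotientMap (I.map f) f Ideal.le_comap_map)))
      (Spec.map (CommRingCat.ofHom (Ideal.Quotient.mk (I.map f))))
      (Spec.map (CommRingCat.ofHom (Ideal.Quotient.mk I))) (Spec.map (CommRingCat.ofHom f)) := by
  have w : CommRingCat.ofHom (Ideal.Quotient.mk I) ≫ CommRingCat.ofHom
      (Ideal.quotientMap (I.map f) f Ideal.le_comap_map) =
        CommRingCat.ofHom f ≫ CommRingCat.ofHom (Ideal.Quotient.mk (I.map f)) := by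
    ext x
    rfl
  have hs : ∀ s : PushoutCocone (CommRingCat.ofHom (Ideal.Quotient.mk I)) (CommRingCat.ofHom f),
      ∀ a ∈ I.map f, s.inr.hom a = 0 := fun s => by
    change I.map f ≤ RingHom.ker s.inr.hom
    rw [Ideal.map_le_iff_le_comap]
    intro a ha
    have h := congrArg (fun h => h a) (congrArg (·.hom) s.condition)
    change s.inl.hom (Ideal.Quotient.mk I a) = s.inr.hom (f a) at h
    rw [Ideal.Quotient.eq_zero_iff_mem.2 ha, map_zero] at h
    exact h.symm
  refine isPullback_SpecMap_of_isPushout _ _ _ _ ⟨⟨w⟩, ⟨PushoutCocone.IsColimit.mk w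
    (fun s => CommRingCat.ofHom (Ideal.Quotient.lift _ s.inr.hom (hs s)))
    (fun s => ?_) (fun s => ?_) fun s g h₁ h₂ => ?_⟩⟩
  · apply CommRingCat.hom_ext
    apply Ideal.Quotient.ringHom_ext
    ext a
    exact (congrArg (fun h => h a) (congrArg (·.hom) s.condition)).symm
  · ext a
    rfl
  · apply CommRingCat.hom_ext
    apply Ideal.Quotient.ringHom_ext
    ext a
    exact congrArg (fun h => h a) (congrArg (·.hom) h₂)

end Squares

/-! ### Evaluation at the projections of the generic point -/

namespace ConjugateData

variable {k K F Ω 𝓕 : Type u} [Field k] [Field K] [Algebra k K] [Field F] [Algebra k F]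
  [Field 𝓕] {N : ℕ} [Algebra (MvPolynomial (Fin (N + 1)) F) 𝓕]
  [IsFractionRing (MvPolynomial (Fin (N + 1)) F) 𝓕] [FiniteDimensional k K]
  {L P : Scheme.{u}} {p : P ⟶ Spec (CommRingCat.of k)} {i : L ⟶ pullback p (specExt k K)}
  {Φ : pullback p (specExt k F) ≅ projSpace N F} (C : ConjugateData p i Φ)

/-- The map `ℙ(W_σ) ⟶ ℙ^N`. -/
noncomputable abbrev emb (σ : K →ₐ[k] F) : projSpace (C.m σ) F ⟶ projSpace N F :=
  linearMap (RingHom.id F) (C.M σ) ⟨C.D σ, C.D_mul_M_self σ⟩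

variable (𝓕) in
/-- The homogeneous coordinates of the projection to `ℙ(W_σ)` of the generic point of `ℙ^N`. -/
noncomputable def coord (σ : K →ₐ[k] F) : MvPolynomial (Fin (C.m σ + 1)) F →+* 𝓕 :=
  (algebraMap (MvPolynomial (Fin (N + 1)) F) 𝓕).comp (linearSubst (RingHom.id F) (C.D σ))

/-- The relation `D σ * M σ = 1` gives a retraction. Geometrically, the generic point projects to
the generic point of `ℙ(W_σ)`. -/
theorem coord_injective (σ : K →ₐ[k] F) : Function.Injective (C.coord 𝓕 σ) := by
  refine (IsFractionRing.injective (MvPolynomial (Fin (N + 1)) F) 𝓕).comp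
    (Function.LeftInverse.injective (g := linearSubst (RingHom.id F) (C.M σ)) fun p => ?_)
  change linearSubst (RingHom.id F) (C.M σ) (linearSubst (RingHom.id F) (C.D σ) p) = p
  rw [linearSubst_linearSubst]
  simp only [RingHom.id_comp, RingHom.coe_id, Matrix.map_id, C.D_mul_M_self]
  exact linearSubst_one p

theorem coord_linearSubst (σ : K →ₐ[k] F) (q : MvPolynomial (Fin (N + 1)) F) :
    C.coord 𝓕 σ (linearSubst (RingHom.id F) (C.M σ) q) =
      algebraMap _ 𝓕 (matSubst (C.M σ * C.D σ) q) := by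
  rw [← linearSubst_eq_matSubst]
  change algebraMap _ 𝓕 (linearSubst (RingHom.id F) (C.D σ)
    (linearSubst (RingHom.id F) (C.M σ) q)) = _
  rw [linearSubst_linearSubst]
  simp only [RingHom.id_comp, RingHom.coe_id, Matrix.map_id]

variable (𝓕) in
/-- The projection to `ℙ(W_σ)` of the generic point of `ℙ^N`. -/
noncomputable def proj (σ : K →ₐ[k] F) : Spec (CommRingCat.of 𝓕) ⟶ projSpace (C.m σ) F :=
  fieldPt (C.coord 𝓕 σ) (exists_X_ne_zero (C.coord_injective σ))

variable {A : Type u} [CommRing A] [Algebra k A] (j : Spec (CommRingCat.of A) ⟶ P)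
  [IsOpenImmersion j] (hj : j ≫ p = Spec.map (CommRingCat.ofHom (algebraMap k A)))

theorem specMap_mapLeft_baseChart (σ : K →ₐ[k] F) :
    Spec.map (CommRingCat.ofHom (mapLeft A σ : K ⊗[k] A →+* F ⊗[k] A)) ≫ baseChart j hj K ≫
      pullback.fst _ _ = baseChart j hj F ≫ pullback.fst _ _ := by
  rw [baseChart_fst, baseChart_fst, ← Spec.map_comp_assoc, ← CommRingCat.ofHom_comp]
  congr 3
  ext x
  simp

/-- Let `I` be the ideal of `L` in the chart. As the conjugate of `L` is `ℙ(W_σ)`, the conjugate of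
`I` defines in the chart a non-empty open subscheme of `ℙ(W_σ)`, which contains the generic point.
Evaluation there is therefore injective modulo the conjugate of `I`. -/
theorem exists_ev [IsClosedImmersion i] (hΦ : Φ.hom ≫ projSpaceStr N F = pullback.snd _ _)
    (x : L) (hx : (i ≫ pullback.fst _ _) x ∈ Set.range j) :
    ∃ (I : Ideal (K ⊗[k] A)) (w : Spec (CommRingCat.of (K ⊗[k] A ⧸ I)) ⟶ L),
      w ≫ i = Spec.map (CommRingCat.ofHom (Ideal.Quotient.mk I)) ≫ baseChart j hj K ∧
      ∀ σ : K →ₐ[k] F, ∃ e : (F ⊗[k] A ⧸ I.map (mapLeft A σ)) →+* 𝓕, Function.Injective e ∧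
        Spec.map (CommRingCat.ofHom (e.comp (Ideal.quotientMap (I.map (mapLeft A σ))
          (mapLeft A σ : K ⊗[k] A →+* F ⊗[k] A) Ideal.le_comap_map))) ≫ w =
            C.proj 𝓕 σ ≫ C.a σ ∧
        Spec.map (CommRingCat.ofHom (e.comp (Ideal.Quotient.mk (I.map (mapLeft A σ))))) ≫
          baseChart j hj F ≫ Φ.hom = C.proj 𝓕 σ ≫ C.emb σ := by
  obtain ⟨I, e₀, he₀⟩ := (IsClosedImmersion.Spec_iff (f := pullback.snd i (baseChart j hj K))).1
    inferInstance
  let w : Spec (CommRingCat.of (K ⊗[k] A ⧸ I)) ⟶ L := e₀.inv ≫ pullback.fst _ _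
  have hw : IsPullback w (Spec.map (CommRingCat.ofHom (Ideal.Quotient.mk I))) i
      (baseChart j hj K) := by
    refine IsPullback.of_iso (IsPullback.of_hasPullback _ _) e₀ (Iso.refl _) (Iso.refl _)
      (Iso.refl _) ?_ ?_ ?_ ?_
    · simp [w]
    · rw [he₀]; simp
    · simp
    · simp
  have hwo : IsOpenImmersion w :=
    MorphismProperty.of_isPullback (P := @IsOpenImmersion) hw.flip inferInstance
  -- The chart contains the point `x` of `L`, so the ideal is proper.
  have hI : (1 : K ⊗[k] A) ∉ I := by
    intro h1
    obtain ⟨b, hb⟩ := mem_range_baseChart j hj K hx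
    obtain ⟨t, -⟩ := Scheme.exists_preimage_of_isPullback hw x b hb.symm
    have : Subsingleton (K ⊗[k] A ⧸ I) :=
      Ideal.Quotient.subsingleton_iff.2 ((Ideal.eq_top_iff_one I).2 h1)
    exact not_subsingleton_iff_nontrivial.2 (PrimeSpectrum.nonempty_iff_nontrivial.1 ⟨t⟩) this
  refine ⟨I, w, hw.w, fun σ => ?_⟩
  let g : K ⊗[k] A ⧸ I →+* F ⊗[k] A ⧸ I.map (mapLeft A σ) := Ideal.quotientMap
    (I.map (mapLeft A σ)) (mapLeft A σ : K ⊗[k] A →+* F ⊗[k] A) Ideal.le_comap_map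
  have h₁ : IsPullback (Spec.map (CommRingCat.ofHom g))
      (Spec.map (CommRingCat.ofHom (Ideal.Quotient.mk (I.map (mapLeft A σ)))))
      (Spec.map (CommRingCat.ofHom (Ideal.Quotient.mk I)))
      (Spec.map (CommRingCat.ofHom (mapLeft A σ : K ⊗[k] A →+* F ⊗[k] A))) :=
    isPullback_quotient (mapLeft A σ : K ⊗[k] A →+* F ⊗[k] A) I
  have h₂ := h₁.paste_vert (isPullback_mapLeft σ)
  have hover : Spec.map (CommRingCat.ofHom (Ideal.Quotient.mk I)) ≫ Spec.map (CommRingCat.ofHom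
      (Algebra.TensorProduct.includeLeftRingHom : K →+* K ⊗[k] A)) =
      w ≫ i ≫ pullback.snd _ _ := by
    rw [← baseChart_snd j hj K, ← Category.assoc, ← hw.w, Category.assoc]
  let q : Spec (CommRingCat.of (F ⊗[k] A ⧸ I.map (mapLeft A σ))) ⟶ projSpace (C.m σ) F :=
    (C.isPullback σ).lift (Spec.map (CommRingCat.ofHom g) ≫ w)
      (Spec.map (CommRingCat.ofHom (Ideal.Quotient.mk (I.map (mapLeft A σ)))) ≫
        Spec.map (CommRingCat.ofHom (Algebra.TensorProduct.includeLeftRingHom : F →+* F ⊗[k] A)))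
      (by rw [Category.assoc, ← hover]; exact h₂.w)
  have hqa : q ≫ C.a σ = Spec.map (CommRingCat.ofHom g) ≫ w :=
    (C.isPullback σ).lift_fst _ _ _
  have hqs : q ≫ projSpaceStr (C.m σ) F = _ := (C.isPullback σ).lift_snd _ _ _
  -- Over `F`, the square exhibits the trace of `ℙ(W_σ)` on the chart as a base change of the open
  -- immersion `w`.
  have hq : IsPullback (Spec.map (CommRingCat.ofHom g)) q w (C.a σ) := by
    refine IsPullback.of_bot ?_ hqa.symm (C.isPullback σ)
    rw [hqs, ← hover]
    exact h₂
  have hqo : IsOpenImmersion q :=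
    MorphismProperty.of_isPullback (P := @IsOpenImmersion) hq inferInstance
  have hqe : q ≫ C.emb σ = Spec.map (CommRingCat.ofHom (Ideal.Quotient.mk (I.map (mapLeft A σ)))) ≫
      baseChart j hj F ≫ Φ.hom := by
    rw [← Category.assoc, ← Iso.comp_inv_eq]
    apply pullback.hom_ext
    · simp only [Category.assoc]
      rw [← C.a_fst, reassoc_of% hqa, reassoc_of% hw.w, ← specMap_mapLeft_baseChart j hj σ,
        reassoc_of% h₁.w]
    · rw [Category.assoc, Category.assoc, (Iso.inv_comp_eq Φ).2 hΦ.symm, linearMap_str,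
        CommRingCat.ofHom_id, Spec.map_id, Category.comp_id, hqs, Category.assoc, baseChart_snd]
  have hnt : Nontrivial (F ⊗[k] A ⧸ I.map (mapLeft A σ)) := by
    refine Ideal.Quotient.nontrivial_iff.2 fun h => hI (mem_of_mapLeft_mem_map (σ := σ) ?_)
    rw [h]
    trivial
  obtain ⟨e, he⟩ := exists_ringHom_generic (j := q) (C.coord_injective (𝓕 := 𝓕) σ)
    (exists_X_ne_zero (C.coord_injective σ))
  refine ⟨e, generic_injective (C.coord_injective (𝓕 := 𝓕) σ)
    (h := exists_X_ne_zero (C.coord_injective σ)) he, ?_, ?_⟩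
  · rw [CommRingCat.ofHom_comp, Spec.map_comp, Category.assoc, ← hqa, reassoc_of% he]
    rfl
  · rw [CommRingCat.ofHom_comp, Spec.map_comp, Category.assoc, ← hqe, reassoc_of% he]
    rfl

end ConjugateData

end SeveriBrauer

/-! ### The rational map on an open subscheme -/

namespace SeveriBrauer

/-- Since `A` is of finite type, it suffices to invert the product of common denominators of the
images of finitely many generators. -/
theorem exists_algHom_localization {k K A Ω : Type u} [Field k] [Field K] [Algebra k K]
    [CommRing A] [Algebra k A] [Algebra.FiniteType k A] [Field Ω] [Algebra k Ω] (a : A →ₐ[k] Ω)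
    (ha : Function.Injective a) (hfrac : ∀ x, ∃ b c, a c ≠ 0 ∧ x * a c = a b)
    (ψ : K ⊗[k] A →ₐ[K] K ⊗[k] Ω) :
    ∃ (s : A) (a' : Localization.Away s →ₐ[k] Ω) (ψ' : K ⊗[k] A →ₐ[K] K ⊗[k] Localization.Away s),
      (∀ x, a' (algebraMap A _ x) = a x) ∧ Function.Injective a' ∧
      ∀ r, Algebra.TensorProduct.map (AlgHom.id K K) a' (ψ' r) = ψ r := by
  obtain ⟨S, hS⟩ := Algebra.FiniteType.out (R := k) (A := A)
  choose c b hc hb using fun x : A => exists_common_denominator (F := K) a hfrac (ψ (1 ⊗ₜ x))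
  let s := ∏ x ∈ S, c x
  have hs : a s ≠ 0 := by
    rw [map_prod]
    exact Finset.prod_ne_zero_iff.2 fun x _ => hc x
  let a' : Localization.Away s →ₐ[k] Ω := IsLocalization.liftAlgHom (M := Submonoid.powers s)
    (f := a) fun y => by
      obtain ⟨_, n, rfl⟩ := y
      exact isUnit_iff_ne_zero.2 (by simpa using pow_ne_zero n hs)
  have ha' : ∀ x, a' (algebraMap A _ x) = a x := fun x => IsLocalization.lift_eq _ x
  have hinj : Function.Injective a' := by
    rw [injective_iff_map_eq_zero]
    intro x hx
    obtain ⟨y, t, rfl⟩ := IsLocalization.exists_mk'_eq (Submonoid.powers s) x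
    have h1 : a y = 0 := by
      rw [← ha', ← IsLocalization.mk'_spec (Localization.Away s) y t, map_mul, hx, zero_mul]
    rw [(map_eq_zero_iff a ha).1 h1, IsLocalization.mk'_zero]
  let f : K ⊗[k] Localization.Away s →ₐ[K] K ⊗[k] Ω :=
    Algebra.TensorProduct.map (AlgHom.id K K) a'
  have hf : Function.Injective f :=
    Module.Flat.lTensor_preserves_injective_linearMap (M := K) a'.toLinearMap hinj
  have hgen : ∀ x ∈ S, ψ (1 ⊗ₜ x) ∈ f.range := fun x hx => by
    obtain ⟨d, hd⟩ := Finset.dvd_prod_of_mem c hx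
    have hu : IsUnit (algebraMap A (Localization.Away s) (c x)) := by
      have := IsLocalization.Away.algebraMap_isUnit (S := Localization.Away s) s
      change IsUnit (algebraMap A (Localization.Away s) (∏ x ∈ S, c x)) at this
      rw [hd, map_mul] at this
      exact isUnit_of_mul_isUnit_left this
    obtain ⟨v, hv⟩ := hu.exists_right_inv
    refine ⟨Algebra.TensorProduct.map (AlgHom.id K K) (IsScalarTower.toAlgHom k A _) (b x) *
      (1 ⊗ₜ v), ?_⟩
    have h1 : ∀ y, f (Algebra.TensorProduct.map (AlgHom.id K K)
        (IsScalarTower.toAlgHom k A (Localization.Away s)) y) =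
        Algebra.TensorProduct.map (AlgHom.id K K) a y := fun y => by
      induction y using TensorProduct.induction_on with
      | zero => simp
      | add x y hx hy => simp only [map_add, hx, hy]
      | tmul e y => simp [f, ha']
    change f _ = _
    rw [map_mul, h1, ← hb, mul_assoc]
    have h2 : f (1 ⊗ₜ v) = 1 ⊗ₜ a' v := by simp [f]
    rw [h2, Algebra.TensorProduct.tmul_mul_tmul, ← ha', ← map_mul, hv, map_one, one_mul,
      ← Algebra.TensorProduct.one_def, mul_one]
  have hall : ∀ x : A, ψ (1 ⊗ₜ x) ∈ f.range := fun x => by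
    have : Algebra.adjoin k (S : Set A) ≤ ((f.range.comap ψ).restrictScalars k).comap
        (Algebra.TensorProduct.includeRight : A →ₐ[k] K ⊗[k] A) :=
      Algebra.adjoin_le fun x hx => hgen x hx
    rw [hS] at this
    exact this (Algebra.mem_top (x := x))
  have hrange : ∀ r, ψ r ∈ f.range := fun r => by
    induction r using TensorProduct.induction_on with
    | zero => rw [map_zero]; exact zero_mem _
    | add x y hx hy => rw [map_add]; exact add_mem hx hy
    | tmul e x =>
      have : e ⊗ₜ[k] x = e • (1 ⊗ₜ[k] x : K ⊗[k] A) := by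
        rw [TensorProduct.smul_tmul', smul_eq_mul, mul_one]
      rw [this, map_smul]
      exact Subalgebra.smul_mem _ (hall x) e
  refine ⟨s, a', ((AlgEquiv.ofInjective f hf).symm : f.range →ₐ[K] _).comp
    (ψ.codRestrict f.range hrange), ha', hinj, fun r => ?_⟩
  exact congrArg Subtype.val ((AlgEquiv.ofInjective f hf).apply_symm_apply ⟨ψ r, hrange r⟩)

namespace ConjugateData

variable {k K F Ω 𝓕 : Type u} [Field k] [Field K] [Algebra k K] [Field F] [Algebra k F]
  [Field Ω] [Algebra k Ω]
  [Field 𝓕] {N : ℕ} [Algebra (MvPolynomial (Fin (N + 1)) F) 𝓕]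
  [IsFractionRing (MvPolynomial (Fin (N + 1)) F) 𝓕] [Algebra F 𝓕]
  [IsScalarTower F (MvPolynomial (Fin (N + 1)) F) 𝓕] [FiniteDimensional k K]
  {L P : Scheme.{u}} {p : P ⟶ Spec (CommRingCat.of k)} {i : L ⟶ pullback p (specExt k K)}
  {Φ : pullback p (specExt k F) ≅ projSpace N F} (C : ConjugateData p i Φ)

theorem coord_C (σ : K →ₐ[k] F) :
    (C.coord 𝓕 σ).comp MvPolynomial.C = algebraMap F 𝓕 := by
  ext c
  rw [IsScalarTower.algebraMap_apply F (MvPolynomial (Fin (N + 1)) F) 𝓕]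
  exact congrArg (algebraMap _ 𝓕) (linearSubst_C _ _ c)

theorem exists_coord_linearSubst_X_ne_zero (σ : K →ₐ[k] F) :
    ∃ l, ((C.coord 𝓕 σ).comp (linearSubst (RingHom.id F) (C.M σ) :
      MvPolynomial (Fin (N + 1)) F →+* MvPolynomial (Fin (C.m σ + 1)) F)) (MvPolynomial.X l) ≠ 0 := by
  obtain ⟨l, hl⟩ := exists_linearSubst_X_notMem (RingHom.id F) (C.M σ) ⟨C.D σ, C.D_mul_M_self σ⟩
    (C.proj 𝓕 σ (⊥ : PrimeSpectrum 𝓕))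
  exact ⟨l, fun h => hl ((mem_ptIdeal_fieldPt_iff _ _ _
    ((linearSubst (RingHom.id F) (C.M σ)).map_mem (X_mem_grading N F l))).2 h)⟩

theorem proj_emb (σ : K →ₐ[k] F) :
    C.proj 𝓕 σ ≫ C.emb σ = fieldPt ((C.coord 𝓕 σ).comp (linearSubst (RingHom.id F) (C.M σ) :
      MvPolynomial (Fin (N + 1)) F →+* MvPolynomial (Fin (C.m σ + 1)) F))
      (C.exists_coord_linearSubst_X_ne_zero σ) :=
  fieldPt_comp_map _ _ _ _ _ _

/-- This supplies the input of the algebraic descent: a chart that meets `L`, the idempotent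
matrices `M σ * D σ`, and evaluation at the projected generic points. -/
theorem exists_conjugates [IsClosedImmersion i]
    (hΦ : Φ.hom ≫ projSpaceStr N F = pullback.snd _ _)
    {η : Spec (CommRingCat.of Ω) ⟶ P} (hη : η ≫ p = Spec.map (CommRingCat.ofHom (algebraMap k Ω)))
    (D : RationalCharts k F N Ω 𝓕)
    (hD : Spec.map (CommRingCat.ofHom (D.E : F ⊗[k] Ω →+* 𝓕)) ≫
        baseChart η hη F ≫ Φ.hom = genPt 𝓕)
    {A : Type u} [CommRing A] [Algebra k A]
    (j : Spec (CommRingCat.of A) ⟶ P) [IsOpenImmersion j]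
    (hj : j ≫ p = Spec.map (CommRingCat.ofHom (algebraMap k A)))
    (a : A →ₐ[k] Ω) (ha : Function.Injective a)
    (haj : Spec.map (CommRingCat.ofHom (a : A →+* Ω)) ≫ j = η) {V : D.ι}
    (hV : LinearMap.range a.toLinearMap = D.G V) (hO : (D.O V).Nonempty)
    (x : L) (hx : (i ≫ pullback.fst _ _) x ∈ Set.range j) :
    ∃ (X : D.Conjugates K A) (w : Spec (CommRingCat.of (K ⊗[k] A ⧸ X.I)) ⟶ L),
      w ≫ i = Spec.map (CommRingCat.ofHom (Ideal.Quotient.mk X.I)) ≫ baseChart j hj K ∧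
      ∀ σ, ∃ e : (K ⊗[k] A ⧸ X.I) →+* 𝓕, (∀ r, e (Ideal.Quotient.mk X.I r) = X.ev σ (mapLeft A σ r)) ∧
        Spec.map (CommRingCat.ofHom e) ≫ w = C.proj 𝓕 σ ≫ C.a σ := by
  obtain ⟨I, w, hw, h⟩ := C.exists_ev (𝓕 := 𝓕) j hj hΦ x hx
  choose e he hew hej using h
  have hcomm : ∀ σ, ((e σ).comp (Ideal.Quotient.mk (I.map (mapLeft A σ)))).comp
      Algebra.TensorProduct.includeLeftRingHom = algebraMap F 𝓕 := fun σ => by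
    apply specMap_ofHom_injective
    have h1 := congrArg (· ≫ projSpaceStr N F) (hej σ)
    simp only [Category.assoc, hΦ, baseChart_snd, linearMap_str, CommRingCat.ofHom_id,
      Spec.map_id, Category.comp_id] at h1
    rw [CommRingCat.ofHom_comp, Spec.map_comp, h1, proj, fieldPt_str, coord_C]
  let ev : ∀ σ : K →ₐ[k] F, F ⊗[k] A →ₐ[F] 𝓕 := fun σ =>
    { (e σ).comp (Ideal.Quotient.mk (I.map (mapLeft A σ))) with
      commutes' := fun c => congrArg (fun h => h c) (hcomm σ) }
  have hS := IsFractionRing.injective (MvPolynomial (Fin (N + 1)) F) 𝓕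
  have hgen : Spec.map (CommRingCat.ofHom ((D.E.comp (Algebra.TensorProduct.map (AlgHom.id F F) a) :
      F ⊗[k] A →ₐ[F] 𝓕) : F ⊗[k] A →+* 𝓕)) ≫ baseChart j hj F ≫ Φ.hom = genPt 𝓕 := by
    rw [← hD, ← specMap_baseChart j hj F a hη haj, Category.assoc,
      ← Spec.map_comp_assoc, ← CommRingCat.ofHom_comp]
    rfl
  have hMM : ∀ σ, (C.M σ * C.D σ) * (C.M σ * C.D σ) = C.M σ * C.D σ := fun σ => by
    rw [Matrix.mul_assoc, ← Matrix.mul_assoc (C.D σ), C.D_mul_M_self, Matrix.one_mul]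
  have hne : ∀ σ, C.M σ * C.D σ ≠ 0 := fun σ h0 => by
    have h1 : C.D σ * (C.M σ * C.D σ) * C.M σ = 1 := by
      rw [← Matrix.mul_assoc, C.D_mul_M_self, Matrix.one_mul, C.D_mul_M_self]
    rw [h0, Matrix.mul_zero, Matrix.zero_mul] at h1
    exact zero_ne_one h1
  obtain ⟨y₀, hy₀⟩ := hO
  refine ⟨{ V₀ := V, y₀ := y₀, y₀_mem := hy₀, a := a, a_injective := ha, range_a := hV,
            M := fun σ => C.M σ * C.D σ, M_mul_of_ne := ?_, M_mul_self := hMM,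
            sum_M := C.sum_M_mul_D, M_ne_zero := hne, ev := ev, ev_eq := ?_, I := I,
            ker_ev := ?_ }, w, hw, fun σ => ⟨_, fun r => rfl, hew σ⟩⟩
  · intro σ τ hστ
    rw [Matrix.mul_assoc, ← Matrix.mul_assoc (C.D σ), C.D_mul_M_of_ne σ τ hστ, Matrix.zero_mul,
      Matrix.mul_zero]
  · intro σ b
    let χ : MvPolynomial (Fin (N + 1)) F →+* 𝓕 := (C.coord 𝓕 σ).comp
      (linearSubst (RingHom.id F) (C.M σ) :
        MvPolynomial (Fin (N + 1)) F →+* MvPolynomial (Fin (C.m σ + 1)) F)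
    have hχ : ∀ q, χ q = algebraMap _ 𝓕 (matSubst (C.M σ * C.D σ) q) := C.coord_linearSubst σ
    have hX : ∃ l, χ (MvPolynomial.X l) ≠ 0 := C.exists_coord_linearSubst_X_ne_zero σ
    have hevj : Spec.map (CommRingCat.ofHom (ev σ : F ⊗[k] A →+* 𝓕)) ≫
        baseChart j hj F ≫ Φ.hom = fieldPt χ hX := (hej σ).trans (C.proj_emb σ)
    -- A fraction that represents `b` near the projected generic point has a denominator that
    -- survives there, and the same fraction represents `b` at the generic point of the whole space.
    obtain ⟨n, p, q, hp, hq, hqt, h⟩ := exists_fraction (j := baseChart j hj F ≫ Φ.hom)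
      (PrimeSpectrum.comap (ev σ : F ⊗[k] A →+* 𝓕) ⊥) b
    rw [apply_comap_bot, hevj, mem_ptIdeal_fieldPt_iff χ hX _ hq] at hqt
    have hq0 : q ≠ 0 := by rintro rfl; exact hqt (map_zero _)
    refine ⟨n, p, q, hp, hq, ?_, ?_, ?_⟩
    · rintro h0
      exact hqt (by rw [hχ, h0, map_zero])
    · exact h (algebraMap _ 𝓕) (exists_X_ne_zero hS) _ ((map_ne_zero_iff _ hS).2 hq0) hgen
    · have := h χ hX (ev σ : F ⊗[k] A →+* 𝓕) hqt hevj
      rwa [hχ, hχ] at this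
  · intro σ
    ext r
    rw [RingHom.mem_ker]
    change e σ (Ideal.Quotient.mk _ r) = 0 ↔ _
    rw [map_eq_zero_iff _ (he σ), Ideal.Quotient.eq_zero_iff_mem]

theorem exists_rational_map [IsClosedImmersion i] [IsAlgClosed F] [Algebra.IsSeparable k K]
    [LocallyOfFiniteType p]
    (hΦ : Φ.hom ≫ projSpaceStr N F = pullback.snd _ _)
    {η : Spec (CommRingCat.of Ω) ⟶ P} (hη : IsGenericPoint p η)
    (D : RationalCharts k F N Ω 𝓕)
    (hD : Spec.map (CommRingCat.ofHom (D.E : F ⊗[k] Ω →+* 𝓕)) ≫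
        baseChart η hη.isOver F ≫ Φ.hom = genPt 𝓕)
    (hcharts : ∀ x : P, ∃ (V : D.ι) (A : Type u) (_ : CommRing A) (_ : Algebra k A) (_ : Nontrivial A)
        (j : Spec (CommRingCat.of A) ⟶ P) (a : A →ₐ[k] Ω), IsOpenImmersion j ∧
        j ≫ p = Spec.map (CommRingCat.ofHom (algebraMap k A)) ∧ x ∈ Set.range j ∧
        Spec.map (CommRingCat.ofHom (a : A →+* Ω)) ≫ j = η ∧ Function.Injective a ∧
        LinearMap.range a.toLinearMap = D.G V ∧ (D.O V).Nonempty) :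
    ∃ (A : Type u) (_ : CommRing A) (_ : Algebra k A)
        (j : Spec (CommRingCat.of A) ⟶ P) (a : A →ₐ[k] Ω), IsOpenImmersion j ∧
        j ≫ p = Spec.map (CommRingCat.ofHom (algebraMap k A)) ∧
        Spec.map (CommRingCat.ofHom (a : A →+* Ω)) ≫ j = η ∧ Function.Injective a ∧
      ∃ h : Spec (CommRingCat.of (K ⊗[k] A)) ⟶ L, h ≫ i ≫ pullback.snd _ _ =
          Spec.map (CommRingCat.ofHom (Algebra.TensorProduct.includeLeftRingHom : K →+* K ⊗[k] A)) ∧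
        ∀ σ, Spec.map (CommRingCat.ofHom ((D.E : F ⊗[k] Ω →+* 𝓕).comp
          ((mapLeft Ω σ : K ⊗[k] Ω →+* F ⊗[k] Ω).comp
          (Algebra.TensorProduct.map (AlgHom.id K K) a : K ⊗[k] A →+* K ⊗[k] Ω)))) ≫ h =
            C.proj 𝓕 σ ≫ C.a σ := by
  obtain ⟨σ₀⟩ : Nonempty (K →ₐ[k] F) := ⟨IsAlgClosed.lift⟩
  -- Any point of `L` would serve; the chart only has to meet `L`.
  let x : L := C.a σ₀ (C.proj 𝓕 σ₀ (⊥ : PrimeSpectrum 𝓕))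
  obtain ⟨V, A, _, _, _, j, a, _, hj, hx, haj, ha, hV, hO⟩ :=
    hcharts ((i ≫ pullback.fst _ _) x)
  obtain ⟨X, w, hw, hev⟩ := C.exists_conjugates hΦ hη.isOver D hD j hj a ha haj hV hO x hx
  obtain ⟨ψ, hψ⟩ := X.exists_algHom
  -- Conjugation by one embedding is injective, and after it the value of `ψ r` is evaluation on
  -- `ℙ(W_σ₀)`, where `r` vanishes. So `ψ` defines a morphism to `L`.
  have hker : ∀ r ∈ X.I, ψ r = 0 := fun r hr => by
    have h1 : mapLeft Ω σ₀ (ψ r) = 0 := by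
      rw [← map_eq_zero_iff D.E D.injective, hψ, ← RingHom.mem_ker, X.ker_ev]
      exact Ideal.mem_map_of_mem _ hr
    exact (map_eq_zero_iff (mapLeft Ω σ₀) (Module.Flat.rTensor_preserves_injective_linearMap
      (M := Ω) σ₀.toLinearMap σ₀.injective)).1 h1
  have : Algebra.FiniteType k A := by
    have h1 : LocallyOfFiniteType (j ≫ p) := inferInstance
    rw [hj, HasRingHomProperty.Spec_iff (P := @LocallyOfFiniteType)] at h1
    exact RingHom.finiteType_algebraMap.1 h1
  obtain ⟨a₁, haj₁, ha₁, hfrac⟩ := hη.exists_algHom j hj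
  obtain rfl : a₁ = a := AlgHom.coe_ringHom_injective (eq_of_specMap_comp_eq (haj₁.trans haj.symm))
  obtain ⟨s, a', ψ', haa', ha', hψ'⟩ := exists_algHom_localization a₁ ha hfrac ψ
  let f : K ⊗[k] Localization.Away s →ₐ[K] K ⊗[k] Ω := Algebra.TensorProduct.map (AlgHom.id K K) a'
  have hf : Function.Injective f :=
    Module.Flat.lTensor_preserves_injective_linearMap (M := K) a'.toLinearMap ha'
  have hker' : ∀ r ∈ X.I, (ψ' : K ⊗[k] A →+* K ⊗[k] Localization.Away s) r = 0 := fun r hr =>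
    (map_eq_zero_iff f hf).1 ((hψ' r).trans (hker r hr))
  have hsp : Spec.map (CommRingCat.ofHom (algebraMap A (Localization.Away s))) ≫ j ≫ p =
      Spec.map (CommRingCat.ofHom (algebraMap k (Localization.Away s))) := by
    rw [hj, ← Spec.map_comp, ← CommRingCat.ofHom_comp, ← IsScalarTower.algebraMap_eq]
  have hloc : IsOpenImmersion (Spec.map (CommRingCat.ofHom (algebraMap A (Localization.Away s)))) :=
    inferInstance
  refine ⟨Localization.Away s, inferInstance, inferInstance,
    Spec.map (CommRingCat.ofHom (algebraMap A (Localization.Away s))) ≫ j, a', inferInstance,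
    by rw [Category.assoc, hsp], ?_, ha',
    Spec.map (CommRingCat.ofHom (Ideal.Quotient.lift X.I _ hker')) ≫ w, ?_, fun σ => ?_⟩
  · rw [← haj, ← Spec.map_comp_assoc, ← CommRingCat.ofHom_comp]
    exact congrArg (fun g => Spec.map (CommRingCat.ofHom g) ≫ j) (RingHom.ext fun y => haa' y)
  · rw [Category.assoc, reassoc_of% hw, baseChart_snd, ← Spec.map_comp, ← Spec.map_comp,
      ← CommRingCat.ofHom_comp, ← CommRingCat.ofHom_comp]
    exact congrArg (fun g => Spec.map (CommRingCat.ofHom g)) (RingHom.ext fun y => ψ'.commutes y)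
  · obtain ⟨e, he, hew⟩ := hev σ
    rw [← hew, ← Spec.map_comp_assoc, ← CommRingCat.ofHom_comp]
    refine congrArg (fun g => Spec.map (CommRingCat.ofHom g) ≫ w)
      (Ideal.Quotient.ringHom_ext (RingHom.ext fun r => ?_))
    refine Eq.trans ?_ (he r).symm
    rw [← hψ]
    exact congrArg (fun y => D.E (mapLeft Ω σ y)) (hψ' r)

end ConjugateData

end SeveriBrauer

namespace SeveriBrauer

/-! ### The decomposition of `T ×ₖ Spec K` over an algebraically closed field -/

section Sections

variable {k K F : Type u} [Field k] [Field K] [Field F] [Algebra k K] [Algebra k F]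

/-- The point of `Spec (F ⊗ K)` that is an embedding of `K` in `F`. -/
noncomputable abbrev embPt (σ : K →ₐ[k] F) : F ⊗[k] K →ₐ[F] F :=
  Algebra.TensorProduct.lift (AlgHom.id F F) σ fun _ _ => Commute.all _ _

theorem mul_eq_of_forall {σ : K →ₐ[k] F} {e : F ⊗[k] K}
    (he : ∀ c, e * (1 ⊗ₜ c) = e * (σ c ⊗ₜ 1)) (x : F ⊗[k] K) : e * x = e * (embPt σ x ⊗ₜ 1) := by
  induction x using TensorProduct.induction_on with
  | zero => simp
  | add x y hx hy => rw [mul_add, hx, hy, map_add, TensorProduct.add_tmul, mul_add]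
  | tmul f c =>
    have h1 : f ⊗ₜ[k] c = (f ⊗ₜ 1) * (1 ⊗ₜ c) := by simp
    have h2 : (embPt σ (f ⊗ₜ c) ⊗ₜ[k] (1 : K)) = (f ⊗ₜ 1) * (σ c ⊗ₜ 1) := by simp
    rw [h1, ← h1, h2, h1, mul_left_comm, he, mul_left_comm]

variable {T : Scheme.{u}} (t : T ⟶ Spec (CommRingCat.of F))

theorem specMap_specExt (σ : K →ₐ[k] F) : Spec.map (CommRingCat.ofHom (σ : K →+* F)) ≫ specExt k K =
    specExt k F := by
  rw [← Spec.map_comp, ← CommRingCat.ofHom_comp, σ.comp_algebraMap]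

/-- The section of `T ×ₖ Spec K ⟶ T` given by an embedding of `K` in `F`. -/
noncomputable def embSection (σ : K →ₐ[k] F) : T ⟶ pullback (t ≫ specExt k F) (specExt k K) :=
  pullback.lift (𝟙 T) (t ≫ Spec.map (CommRingCat.ofHom (σ : K →+* F)))
    (by rw [Category.assoc, specMap_specExt, Category.id_comp])

/-- The projection `T ×ₖ Spec K ⟶ Spec (F ⊗ K)`. -/
noncomputable def toSpecTensor :
    pullback (t ≫ specExt k F) (specExt k K) ⟶ Spec (CommRingCat.of (F ⊗[k] K)) :=
  (isPullback_tensorProduct k F K).lift (pullback.fst _ _ ≫ t) (pullback.snd _ _)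
    (by rw [Category.assoc]; exact pullback.condition)

theorem isPullback_toSpecTensor : IsPullback (pullback.fst (t ≫ specExt k F) (specExt k K))
    (toSpecTensor t) t (Spec.map (CommRingCat.ofHom
      (Algebra.TensorProduct.includeLeftRingHom : F →+* F ⊗[k] K))) := by
  refine IsPullback.of_bot ?_ ((isPullback_tensorProduct k F K).lift_fst _ _ _).symm
    (isPullback_tensorProduct k F K)
  have h : toSpecTensor t ≫ _ = pullback.snd (t ≫ specExt k F) (specExt k K) :=
    (isPullback_tensorProduct k F K).lift_snd _ _ _
  rw [h]
  exact IsPullback.of_hasPullback _ _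

theorem isPullback_embSection (σ : K →ₐ[k] F) : IsPullback (embSection t σ) t (toSpecTensor t)
    (Spec.map (CommRingCat.ofHom (embPt σ : F ⊗[k] K →+* F))) := by
  have h1 : Spec.map (CommRingCat.ofHom (embPt σ : F ⊗[k] K →+* F)) ≫ Spec.map (CommRingCat.ofHom
      (Algebra.TensorProduct.includeLeftRingHom : F →+* F ⊗[k] K)) = 𝟙 _ := by
    rw [← Spec.map_comp, ← CommRingCat.ofHom_comp, ← Spec.map_id]
    refine congrArg (fun g => Spec.map (CommRingCat.ofHom g)) (RingHom.ext fun x => ?_)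
    simp
  have h2 : Spec.map (CommRingCat.ofHom (embPt σ : F ⊗[k] K →+* F)) ≫ Spec.map (CommRingCat.ofHom
      (Algebra.TensorProduct.includeRight.toRingHom : K →+* F ⊗[k] K)) =
      Spec.map (CommRingCat.ofHom (σ : K →+* F)) := by
    rw [← Spec.map_comp, ← CommRingCat.ofHom_comp]
    refine congrArg (fun g => Spec.map (CommRingCat.ofHom g)) (RingHom.ext fun x => ?_)
    simp
  refine IsPullback.of_right ?_ ?_ (isPullback_toSpecTensor t)
  · rw [h1, embSection, pullback.lift_fst]
    exact IsPullback.of_id_fst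
  · apply (isPullback_tensorProduct k F K).hom_ext
    · rw [Category.assoc, Category.assoc, h1, Category.comp_id, ← (isPullback_toSpecTensor t).w,
        embSection, pullback.lift_fst_assoc, Category.id_comp]
    · rw [Category.assoc, Category.assoc, h2]
      have h : toSpecTensor t ≫ _ = pullback.snd (t ≫ specExt k F) (specExt k K) :=
        (isPullback_tensorProduct k F K).lift_snd _ _ _
      rw [h, embSection, pullback.lift_snd]

variable [FiniteDimensional k K] [Algebra.IsSeparable k K] [IsAlgClosed F]

variable (k K F) in
-- The idempotents separate the embeddings, and `1 - e σ` generates the kernel of the point `σ`.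
-- Hence these points are open immersions and form a disjoint cover.
theorem exists_embPt_idempotents : ∃ e : (K →ₐ[k] F) → F ⊗[k] K, ∑ σ, e σ = 1 ∧
    ∀ σ, IsIdempotentElem (e σ) ∧ (∀ τ, τ ≠ σ → embPt τ (e σ) = 0) ∧
      RingHom.ker (embPt σ : F ⊗[k] K →+* F) = Ideal.span {1 - e σ} := by
  obtain ⟨e, hsum, he⟩ := exists_idempotents k K F
  have h0 : ∀ σ τ, τ ≠ σ → embPt τ (e σ) = 0 := fun σ τ hτ => by
    by_contra h
    refine hτ (AlgHom.ext fun c => ?_)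
    have h1 := congrArg (embPt τ) (he σ c)
    rw [map_mul, map_mul] at h1
    simpa using mul_left_cancel₀ h h1
  have h1 : ∀ σ, embPt σ (e σ) = 1 := fun σ => by
    have := congrArg (embPt σ) hsum
    rwa [map_sum, map_one, Finset.sum_eq_single σ (fun τ _ hτ => h0 τ σ hτ.symm) (by simp)] at this
  refine ⟨e, hsum, fun σ => ⟨?_, h0 σ, ?_⟩⟩
  · rw [IsIdempotentElem, mul_eq_of_forall (he σ), h1, ← Algebra.TensorProduct.one_def, mul_one]
  · ext x
    rw [RingHom.mem_ker, Ideal.mem_span_singleton]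
    constructor
    · intro hx
      have h2 := mul_eq_of_forall (he σ) x
      change embPt σ x = 0 at hx
      rw [hx, TensorProduct.zero_tmul, mul_zero] at h2
      exact ⟨x, by rw [sub_mul, h2, one_mul, sub_zero]⟩
    · rintro ⟨y, rfl⟩
      change embPt σ _ = 0
      rw [map_mul, map_sub, map_one, h1, sub_self, zero_mul]

theorem embPt_surjective (σ : K →ₐ[k] F) : Function.Surjective (embPt σ) := fun x =>
  ⟨x ⊗ₜ 1, by simp⟩

theorem isOpenImmersion_embPt (σ : K →ₐ[k] F) :
    IsOpenImmersion (Spec.map (CommRingCat.ofHom (embPt σ : F ⊗[k] K →+* F))) := by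
  obtain ⟨e, -, he⟩ := exists_embPt_idempotents k K F
  exact (isOpenImmersion_SpecMap_iff_of_surjective _ (embPt_surjective σ)).2
    ⟨1 - e σ, (he σ).1.one_sub, (he σ).2.2⟩

theorem exists_embPt_preimage (y : PrimeSpectrum (F ⊗[k] K)) :
    ∃ (σ : K →ₐ[k] F) (x : PrimeSpectrum F), PrimeSpectrum.comap (embPt σ : F ⊗[k] K →+* F) x = y := by
  obtain ⟨e, hsum, he⟩ := exists_embPt_idempotents k K F
  obtain ⟨σ, hσ⟩ : ∃ σ, e σ ∉ y.asIdeal := by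
    by_contra! h
    exact y.2.ne_top ((Ideal.eq_top_iff_one _).2 (hsum ▸ Ideal.sum_mem _ fun σ _ => h σ))
  refine ⟨σ, ?_⟩
  change y ∈ Set.range _
  have h := range_comap_of_surjective _ (embPt σ : F ⊗[k] K →+* F) (embPt_surjective σ)
  rw [h, (he σ).2.2, PrimeSpectrum.zeroLocus_span, PrimeSpectrum.mem_zeroLocus,
    Set.singleton_subset_iff]
  refine (y.2.mem_or_mem (x := e σ) ?_).resolve_left hσ
  rw [mul_sub, mul_one, (he σ).1, sub_self]
  exact Ideal.zero_mem _

theorem eq_of_comap_embPt_eq {σ τ : K →ₐ[k] F} {x y : PrimeSpectrum F}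
    (h : PrimeSpectrum.comap (embPt σ : F ⊗[k] K →+* F) x =
      PrimeSpectrum.comap (embPt τ : F ⊗[k] K →+* F) y) : σ = τ := by
  obtain ⟨e, hsum, he⟩ := exists_embPt_idempotents k K F
  by_contra hne
  have h1 : ∀ ρ (z : PrimeSpectrum F) (ρ'), ρ ≠ ρ' → 
      e ρ' ∈ (PrimeSpectrum.comap (embPt ρ : F ⊗[k] K →+* F) z).asIdeal := fun ρ z ρ' hρ => by
    change embPt ρ (e ρ') ∈ z.asIdeal
    rw [(he ρ').2.1 ρ hρ]
    exact Ideal.zero_mem _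
  refine (PrimeSpectrum.comap (embPt σ : F ⊗[k] K →+* F) x).2.ne_top
    ((Ideal.eq_top_iff_one _).2 (hsum ▸ Ideal.sum_mem _ fun ρ _ => ?_))
  by_cases hρ : σ = ρ
  · rw [h]
    exact h1 τ y ρ fun h => hne (hρ.trans h.symm)
  · exact h1 σ x ρ hρ

instance (σ : K →ₐ[k] F) : IsOpenImmersion (embSection t σ) :=
  have := isOpenImmersion_embPt σ
  MorphismProperty.of_isPullback (P := @IsOpenImmersion) (isPullback_embSection t σ).flip
    inferInstance

/-- The decomposition of `T ×ₖ Spec K` for a scheme `T` over an algebraically closed field. -/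
noncomputable def embCover : (pullback (t ≫ specExt k F) (specExt k K)).OpenCover :=
  Scheme.Cover.mkOfCovers (K →ₐ[k] F) (fun _ => T) (embSection t) fun y => by
    obtain ⟨σ, x, hx⟩ := exists_embPt_preimage (toSpecTensor t y)
    obtain ⟨z, hz, -⟩ := Scheme.exists_preimage_of_isPullback (isPullback_embSection t σ) y x hx.symm
    exact ⟨σ, z, hz⟩

theorem embSection_hom_ext {X : Scheme.{u}} {f g : pullback (t ≫ specExt k F) (specExt k K) ⟶ X}
    (h : ∀ σ, embSection t σ ≫ f = embSection t σ ≫ g) : f = g :=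
  (embCover t).hom_ext _ _ h

/-- The pieces for different embeddings are disjoint, so no compatibility is needed for gluing. -/
theorem exists_embSection_comp {X : Scheme.{u}} (h : (K →ₐ[k] F) → (T ⟶ X)) :
    ∃ f : pullback (t ≫ specExt k F) (specExt k K) ⟶ X, ∀ σ, embSection t σ ≫ f = h σ := by
  refine ⟨(embCover t).glueMorphisms h fun (σ τ : K →ₐ[k] F) => ?_, (embCover t).ι_glueMorphisms h _⟩
  change pullback.fst (embSection t σ) (embSection t τ) ≫ h σ =
    pullback.snd (embSection t σ) (embSection t τ) ≫ h τ
  by_cases hστ : σ = τ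
  · subst hστ
    rw [(cancel_mono (embSection t σ)).1 pullback.condition]
  · have : IsEmpty ↥(pullback (embSection t σ) (embSection t τ)) := ⟨fun y => hστ ?_⟩
    · exact isInitialOfIsEmpty.hom_ext _ _
    have h1 := congrArg (fun f => toSpecTensor t (f y))
      (pullback.condition (f := embSection t σ) (g := embSection t τ))
    have hw : ∀ (ρ : K →ₐ[k] F) (z : T), toSpecTensor t (embSection t ρ z) =
        PrimeSpectrum.comap (embPt ρ : F ⊗[k] K →+* F) (t z) := fun ρ z =>
      congrArg (fun f => f z) (isPullback_embSection t ρ).w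
    change toSpecTensor t (embSection t σ _) = toSpecTensor t (embSection t τ _) at h1
    rw [hw, hw] at h1
    exact eq_of_comap_embPt_eq h1

end Sections

/-! ### The Weil restriction over `F` as a product of conjugates -/

section WeilRestriction

variable {k K F : Type u} [Field k] [Field K] [Algebra k K] [Field F] [Algebra k F]
  {L R : Scheme.{u}} {l : L ⟶ Spec (CommRingCat.of K)} {r : R ⟶ Spec (CommRingCat.of k)}
  {ev : pullback r (specExt k K) ⟶ L} (hR : IsWeilRestriction l r ev)

theorem embSection_baseChangeMap {T : Scheme.{u}} (t : T ⟶ Spec (CommRingCat.of F)) (g : T ⟶ R)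
    (hg : g ≫ r = t ≫ specExt k F) (σ : K →ₐ[k] F) :
    embSection t σ ≫ baseChangeMap K (t ≫ specExt k F) r g hg =
      pullback.lift g (t ≫ Spec.map (CommRingCat.ofHom (σ : K →+* F)))
        (by rw [hg, Category.assoc, specMap_specExt]) := by
  apply pullback.hom_ext
  · rw [Category.assoc, baseChangeMap, pullback.lift_fst, pullback.lift_fst, embSection,
      pullback.lift_fst_assoc, Category.id_comp]
  · rw [Category.assoc, baseChangeMap, pullback.lift_snd, pullback.lift_snd, embSection,
      pullback.lift_snd]

variable [FiniteDimensional k K] [Algebra.IsSeparable k K] [IsAlgClosed F]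

include hR

/-- For `T` over `F`, the scheme `T ×ₖ Spec K` consists of one copy of `T` for each embedding. So a
morphism from `T` to `R` is a family of morphisms from `T` to `L`, one over each embedding;
`exists_hom` is the existence part. -/
theorem IsWeilRestriction.hom_ext {T : Scheme.{u}} {t : T ⟶ Spec (CommRingCat.of F)} {g g' : T ⟶ R}
    (hg : g ≫ r = t ≫ specExt k F) (hg' : g' ≫ r = t ≫ specExt k F)
    (h : ∀ σ : K →ₐ[k] F, pullback.lift g (t ≫ Spec.map (CommRingCat.ofHom (σ : K →+* F)))
        (by rw [hg, Category.assoc, specMap_specExt]) ≫ ev =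
      pullback.lift g' (t ≫ Spec.map (CommRingCat.ofHom (σ : K →+* F)))
        (by rw [hg', Category.assoc, specMap_specExt]) ≫ ev) : g = g' := by
  have h1 : baseChangeMap K (t ≫ specExt k F) r g hg ≫ ev =
      baseChangeMap K (t ≫ specExt k F) r g' hg' ≫ ev := embSection_hom_ext t fun σ => by
    rw [reassoc_of% embSection_baseChangeMap t g hg, reassoc_of% embSection_baseChangeMap t g' hg', h]
  refine (hR.existsUnique T (t ≫ specExt k F) _ ?_).unique ⟨hg, rfl⟩ ⟨hg', h1.symm⟩
  rw [Category.assoc, hR.isOver, baseChangeMap, pullback.lift_snd]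

theorem IsWeilRestriction.exists_hom {T : Scheme.{u}} (t : T ⟶ Spec (CommRingCat.of F))
    (h : (K →ₐ[k] F) → (T ⟶ L))
    (hh : ∀ σ, h σ ≫ l = t ≫ Spec.map (CommRingCat.ofHom (σ : K →+* F))) :
    ∃ (g : T ⟶ R) (hg : g ≫ r = t ≫ specExt k F), ∀ σ : K →ₐ[k] F,
      pullback.lift g (t ≫ Spec.map (CommRingCat.ofHom (σ : K →+* F)))
        (by rw [hg, Category.assoc, specMap_specExt]) ≫ ev = h σ := by
  obtain ⟨f, hf⟩ := exists_embSection_comp t h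
  obtain ⟨g, ⟨hg, hgf⟩, -⟩ := hR.existsUnique T (t ≫ specExt k F) f
    (embSection_hom_ext t fun σ => by rw [reassoc_of% hf, hh, embSection, pullback.lift_snd])
  exact ⟨g, hg, fun σ => by rw [← hf, ← hgf, reassoc_of% embSection_baseChangeMap t g hg]⟩

end WeilRestriction

namespace ConjugateData

variable {k K F : Type u} [Field k] [Field K] [Algebra k K] [Field F] [Algebra k F]
  [FiniteDimensional k K] {N : ℕ}
  {L P R : Scheme.{u}} {p : P ⟶ Spec (CommRingCat.of k)} {i : L ⟶ pullback p (specExt k K)}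
  {Φ : pullback p (specExt k F) ≅ projSpace N F} (C : ConjugateData p i Φ)
  {r : R ⟶ Spec (CommRingCat.of k)} {ev : pullback r (specExt k K) ⟶ L}
  (hR : IsWeilRestriction (i ≫ pullback.snd _ _) r ev)

theorem pullback_condition_emb (r : R ⟶ Spec (CommRingCat.of k)) (σ : K →ₐ[k] F) :
    pullback.fst r (specExt k F) ≫ r =
      (pullback.snd _ _ ≫ Spec.map (CommRingCat.ofHom (σ : K →+* F))) ≫ specExt k K := by
  rw [Category.assoc, specMap_specExt, pullback.condition]

/-- The projections of `R_F ≅ ∏_σ ℙ(W_σ)`. -/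
noncomputable def weilProj (σ : K →ₐ[k] F) : pullback r (specExt k F) ⟶ projSpace (C.m σ) F :=
  (C.isPullback σ).lift (pullback.lift (pullback.fst _ _) _ (pullback_condition_emb r σ) ≫ ev)
    (pullback.snd _ _) (by rw [Category.assoc, hR.isOver, pullback.lift_snd])

theorem weilProj_a (σ : K →ₐ[k] F) : C.weilProj hR σ ≫ C.a σ =
    pullback.lift (pullback.fst _ _) _ (pullback_condition_emb r σ) ≫ ev :=
  (C.isPullback σ).lift_fst _ _ _

theorem weilProj_str (σ : K →ₐ[k] F) : C.weilProj hR σ ≫ projSpaceStr (C.m σ) F = pullback.snd _ _ :=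
  (C.isPullback σ).lift_snd _ _ _

theorem comp_weilProj_a {T : Scheme.{u}} {t : T ⟶ Spec (CommRingCat.of F)}
    (g : T ⟶ pullback r (specExt k F)) (hg : g ≫ pullback.snd _ _ = t) (σ : K →ₐ[k] F) :
    g ≫ C.weilProj hR σ ≫ C.a σ = pullback.lift (g ≫ pullback.fst _ _)
      (t ≫ Spec.map (CommRingCat.ofHom (σ : K →+* F)))
      (by rw [Category.assoc, pullback_condition_emb r σ, ← hg]; simp only [Category.assoc]) ≫ ev := by
  subst hg
  rw [weilProj_a, ← Category.assoc]
  congr 1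
  apply pullback.hom_ext
  · rw [Category.assoc, pullback.lift_fst, pullback.lift_fst]
  · rw [Category.assoc, pullback.lift_snd, pullback.lift_snd, Category.assoc]

variable [Algebra.IsSeparable k K] [IsAlgClosed F]

/-- With `exists_hom_weilProj`, this is the universal property of the product of the `ℙ(W_σ)`; the
product charts are derived from nothing else. -/
theorem weilProj_hom_ext {T : Scheme.{u}} {g g' : T ⟶ pullback r (specExt k F)}
    (h : g ≫ pullback.snd _ _ = g' ≫ pullback.snd _ _)
    (hσ : ∀ σ, g ≫ C.weilProj hR σ = g' ≫ C.weilProj hR σ) : g = g' := by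
  have hc : ∀ g : T ⟶ pullback r (specExt k F), (g ≫ pullback.fst _ _) ≫ r =
      (g ≫ pullback.snd _ _) ≫ specExt k F := fun g => by
    rw [Category.assoc, pullback.condition, Category.assoc]
  refine pullback.hom_ext (hR.hom_ext (hc g) ((hc g').trans (by rw [h])) fun σ => ?_) h
  rw [← C.comp_weilProj_a hR g rfl, ← C.comp_weilProj_a hR g' h.symm, reassoc_of% hσ]

theorem exists_hom_weilProj {T : Scheme.{u}} (t : T ⟶ Spec (CommRingCat.of F))
    (h : ∀ σ, T ⟶ projSpace (C.m σ) F) (hh : ∀ σ, h σ ≫ projSpaceStr (C.m σ) F = t) :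
    ∃ g : T ⟶ pullback r (specExt k F), g ≫ pullback.snd _ _ = t ∧
      ∀ σ, g ≫ C.weilProj hR σ = h σ := by
  obtain ⟨g, hg, hgσ⟩ := hR.exists_hom t (fun σ => h σ ≫ C.a σ) fun σ => by
    rw [Category.assoc, (C.isPullback σ).w, ← hh σ, Category.assoc]
  refine ⟨pullback.lift g t hg, pullback.lift_snd _ _ _, fun σ => ?_⟩
  apply (C.isPullback σ).hom_ext
  · rw [Category.assoc, C.comp_weilProj_a hR _ (pullback.lift_snd _ _ _), ← hgσ]
    congr 2
    exact pullback.lift_fst _ _ _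
  · rw [Category.assoc, weilProj_str, pullback.lift_snd, hh]

end ConjugateData

end SeveriBrauer

namespace SeveriBrauer

/-! ### Linear embeddings are closed immersions -/

section ClosedImmersion

/-- If two images generate the ring, then the map from the tensor product is surjective. -/
theorem isClosedImmersion_of_closure_eq_top {R A B C : Type u} [CommRing R] [CommRing A] [CommRing B]
    [CommRing C] (f : R →+* A) (g : R →+* B) {α : A →+* C} {β : B →+* C}
    (hC : ∀ x, x ∈ Subring.closure (Set.range α ∪ Set.range β))
    {X : Scheme.{u}} {fst : X ⟶ Spec (CommRingCat.of A)} {snd : X ⟶ Spec (CommRingCat.of B)}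
    (h : IsPullback fst snd (Spec.map (CommRingCat.ofHom f)) (Spec.map (CommRingCat.ofHom g)))
    {c : Spec (CommRingCat.of C) ⟶ X} (h₁ : c ≫ fst = Spec.map (CommRingCat.ofHom α))
    (h₂ : c ≫ snd = Spec.map (CommRingCat.ofHom β)) : IsClosedImmersion c := by
  let _ : Algebra R A := f.toAlgebra
  let _ : Algebra R B := g.toAlgebra
  let _ : Algebra R C := (α.comp f).toAlgebra
  have hαβ : α.comp f = β.comp g := specMap_ofHom_injective (by
    rw [CommRingCat.ofHom_comp, CommRingCat.ofHom_comp, Spec.map_comp, Spec.map_comp, ← h₁, ← h₂,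
      Category.assoc, Category.assoc, h.w])
  let φ : A ⊗[R] B →ₐ[R] C := Algebra.TensorProduct.lift
    ({ α with commutes' := fun _ => rfl } : A →ₐ[R] C)
    ({ β with commutes' := fun x => congrArg (fun h => h x) hαβ.symm } : B →ₐ[R] C)
    fun _ _ => Commute.all _ _
  have hα : ∀ a, φ (a ⊗ₜ 1) = α a := fun a => by
    change α a * β 1 = α a
    rw [map_one, mul_one]
  have hβ : ∀ b, φ (1 ⊗ₜ b) = β b := fun b => by
    change α 1 * β b = β b
    rw [map_one, one_mul]
  have hφ : Function.Surjective φ := fun x => by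
    have h1 : Subring.closure (Set.range α ∪ Set.range β) ≤ (φ : A ⊗[R] B →+* C).range := by
      rw [Subring.closure_le]
      rintro _ (⟨a, rfl⟩ | ⟨b, rfl⟩)
      · exact ⟨_, hα a⟩
      · exact ⟨_, hβ b⟩
    exact h1 (hC x)
  have h0 : IsPullback _ _ (Spec.map (CommRingCat.ofHom f)) (Spec.map (CommRingCat.ofHom g)) :=
    isPullback_tensorProduct R A B
  have hc : c = Spec.map (CommRingCat.ofHom (φ : A ⊗[R] B →+* C)) ≫ (h0.isoIsPullback _ _ h).hom := by
    apply h.hom_ext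
    · rw [h₁, Category.assoc, h0.isoIsPullback_hom_fst, ← Spec.map_comp, ← CommRingCat.ofHom_comp]
      exact congrArg (fun g => Spec.map (CommRingCat.ofHom g)) (RingHom.ext fun x => (hα x).symm)
    · rw [h₂, Category.assoc, h0.isoIsPullback_hom_snd, ← Spec.map_comp, ← CommRingCat.ofHom_comp]
      exact congrArg (fun g => Spec.map (CommRingCat.ofHom g)) (RingHom.ext fun x => (hβ x).symm)
  rw [hc]
  have := IsClosedImmersion.spec_of_surjective (CommRingCat.ofHom (φ : A ⊗[R] B →+* C)) hφ
  infer_instance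

theorem evalAway_localization_injective {N : ℕ} {R : Type u} [CommRing R]
    {q : MvPolynomial (Fin (N + 1)) R}
    (hχ : IsUnit (algebraMap (MvPolynomial (Fin (N + 1)) R) (Localization.Away q) q)) :
    Function.Injective (evalAway _ hχ) := by
  have h1 : (IsLocalization.Away.lift q hχ : Localization.Away q →+* _) = RingHom.id _ :=
    IsLocalization.ringHom_ext (Submonoid.powers q) (RingHom.ext fun x => IsLocalization.lift_eq _ x)
  intro x y hxy
  rw [evalAway, h1] at hxy
  exact HomogeneousLocalization.val_injective _ hxy

variable {N m : ℕ} {R A : Type u} [CommRing R] [CommRing A] (f : R →+* A)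
  (M : Matrix (Fin (N + 1)) (Fin (m + 1)) A)
  (hM : ∃ D : Matrix (Fin (m + 1)) (Fin (N + 1)) A, D * M = 1)

theorem isPullback_chartι {q : MvPolynomial (Fin (N + 1)) R} {d : ℕ} (hq : q ∈ grading N R d)
    (hd : 0 < d) : IsPullback (Spec.map (CommRingCat.ofHom
        (HomogeneousLocalization.Away.map (linearSubst f M) q)))
      (chartι ((linearSubst f M).map_mem hq) hd) (chartι hq hd) (linearMap f M hM) := by
  refine IsOpenImmersion.isPullback _ _ _ _ (chartι_linearMap f M hM hq hd) ?_
  have h1 := Proj.opensRange_awayι (grading N R) q hq hd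
  have h2 := Proj.opensRange_awayι (grading m A) _ ((linearSubst f M).map_mem hq) hd
  change (Proj.map (linearSubst f M) (irrelevant_le_map_linearSubst f M hM)) ⁻¹ᵁ
    (Proj.awayι (grading N R) q hq hd).opensRange =
      (Proj.awayι (grading m A) _ ((linearSubst f M).map_mem hq) hd).opensRange
  rw [h1, h2]
  rfl

include hM in
-- A form `a` in the coordinates of the source equals `M` substituted in `b`, where `b` is `D`
-- substituted in `a`. So its fractions are combinations, with constants of `A`, of pulled back
-- fractions of monomials.
theorem mem_closure_away (i : Fin (N + 1))
    (x : AwayRing m (linearSubst f M (MvPolynomial.X i))) :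
    x ∈ Subring.closure (Set.range ((HomogeneousLocalization.fromZeroRingHom (grading m A)
        (Submonoid.powers (linearSubst f M (MvPolynomial.X i)))).comp
          (algebraMap A (grading m A 0))) ∪
      Set.range (HomogeneousLocalization.Away.map (linearSubst f M) (MvPolynomial.X i))) := by
  obtain ⟨D, hD⟩ := hM
  have hX := (linearSubst f M).map_mem (X_mem_grading N R i)
  obtain ⟨n, a, ha, rfl⟩ := x.mk_surjective _ hX
  have hb := (linearSubst (RingHom.id A) D).map_mem ha
  set b : MvPolynomial (Fin (N + 1)) A := linearSubst (RingHom.id A) D a with hbdef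
  have hab : a = linearSubst (RingHom.id A) M b := by
    rw [hbdef, linearSubst_linearSubst]
    simp only [RingHom.id_comp, RingHom.coe_id, Matrix.map_id, hD]
    exact (linearSubst_one a).symm
  let q := linearSubst f M (MvPolynomial.X i)
  let χ : MvPolynomial (Fin (m + 1)) A →+* Localization.Away q := algebraMap _ _
  have hχ : IsUnit (χ q) := IsLocalization.Away.algebraMap_isUnit q
  have hinj : Function.Injective (evalAway χ hχ) := evalAway_localization_injective hχ
  have hdeg : ∀ s ∈ b.support, (MvPolynomial.monomial s (1 : R)) ∈ grading N R (n • 1) := fun s hs =>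
    (MvPolynomial.isHomogeneous_monomial 1 (by
      rw [Finsupp.degree_eq_weight_one (R := ℕ)]
      exact hb (MvPolynomial.mem_support_iff.1 hs)))
  have hsubst : ∀ s, linearSubst f M (MvPolynomial.monomial s 1) =
      linearSubst (RingHom.id A) M (MvPolynomial.monomial s 1) := fun s => by
    refine (MvPolynomial.eval₂_monomial _ _).trans
      (Eq.trans ?_ (MvPolynomial.eval₂_monomial _ _).symm)
    rw [map_one, map_one]
  have key : HomogeneousLocalization.Away.mk (grading m A) hX n a ha = ∑ s ∈ b.support.attach,
      ((HomogeneousLocalization.fromZeroRingHom (grading m A) (Submonoid.powers q)).comp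
          (algebraMap A (grading m A 0))) (b.coeff s.1) *
        HomogeneousLocalization.Away.map (linearSubst f M) (MvPolynomial.X i)
          (HomogeneousLocalization.Away.mk (grading N R) (X_mem_grading N R i) n
            (MvPolynomial.monomial s.1 1) (hdeg s.1 s.2)) := by
    refine hinj ((hχ.pow n).mul_left_injective ?_)
    change evalAway χ hχ _ * χ q ^ n = evalAway χ hχ _ * χ q ^ n
    have hsum : χ a = ∑ s ∈ b.support.attach,
        χ (linearSubst (RingHom.id A) M (MvPolynomial.monomial s.1 (b.coeff s.1))) := by
      rw [hab, Finset.sum_attach b.support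
        (fun s => χ (linearSubst (RingHom.id A) M (MvPolynomial.monomial s (b.coeff s)))),
        ← map_sum, ← map_sum, ← b.as_sum]
    rw [evalAway_mk, map_sum, Finset.sum_mul, hsum]
    refine Finset.sum_congr rfl fun s _ => ?_
    rw [map_mul, mul_assoc, HomogeneousLocalization.Away.map_mk]
    refine Eq.trans ?_ (congrArg₂ (· * ·) (congrArg (fun h => h (b.coeff s.1))
      (evalAway_algebraMap χ hχ)).symm (evalAway_mk χ hχ hX n _ _).symm)
    rw [hsubst, RingHom.comp_apply, ← map_mul, ← mul_one (b.coeff s.1), ← MvPolynomial.C_mul_monomial,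
      map_mul, linearSubst_C, mul_one]
    rfl
  rw [key]
  exact Subring.sum_mem _ fun s _ => Subring.mul_mem _
    (Subring.subset_closure (Or.inl ⟨_, rfl⟩)) (Subring.subset_closure (Or.inr ⟨_, rfl⟩))

theorem isClosedImmersion_of_linearMap {X : Scheme.{u}} {fst : X ⟶ Spec (CommRingCat.of A)}
    {snd : X ⟶ projSpace N R}
    (h : IsPullback fst snd (Spec.map (CommRingCat.ofHom f)) (projSpaceStr N R))
    {c : projSpace m A ⟶ X} (h₁ : c ≫ fst = projSpaceStr m A) (h₂ : c ≫ snd = linearMap f M hM) :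
    IsClosedImmersion c := by
  let 𝒰 := (chartCover (X_mem_grading N R) (fun _ => one_pos) exists_X_notMem_ptIdeal).openCover
  refine IsZariskiLocalAtTarget.of_openCover (P := @IsClosedImmersion) (𝒰 := 𝒰.pullback₁ snd)
    fun i => ?_
  let ι := chartι (X_mem_grading N R i) one_pos
  let β := HomogeneousLocalization.Away.map (linearSubst f M) (MvPolynomial.X i)
  have hq := (linearSubst f M).map_mem (X_mem_grading N R i)
  change IsClosedImmersion (pullback.snd c (pullback.fst snd ι))
  have hι : ι ≫ projSpaceStr N R = _ := chartι_str (X_mem_grading N R i) one_pos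
  have h3 := (IsPullback.of_hasPullback snd ι).flip.paste_vert h.flip
  rw [hι] at h3
  have h4 := isPullback_chartι f M hM (X_mem_grading N R i) one_pos
  let c' : Spec (CommRingCat.of (AwayRing m (linearSubst f M (MvPolynomial.X i)))) ⟶
      pullback snd ι := pullback.lift (chartι hq one_pos ≫ c) (Spec.map (CommRingCat.ofHom β))
        (by rw [Category.assoc, h₂]; exact h4.w.symm)
  have h5 : IsPullback (chartι hq one_pos) c' c (pullback.fst snd ι) := by
    refine IsPullback.of_bot ?_ (pullback.lift_fst _ _ _).symm (IsPullback.of_hasPullback snd ι)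
    rw [pullback.lift_snd, h₂]
    exact h4.flip
  have h6 : IsClosedImmersion c' := by
    refine isClosedImmersion_of_closure_eq_top _ _ (mem_closure_away f M hM i) h3.flip ?_
      (pullback.lift_snd _ _ _)
    rw [pullback.lift_fst_assoc, Category.assoc, h₁]
    exact chartι_str hq one_pos
  have h7 : pullback.snd c (pullback.fst snd ι) = h5.isoPullback.inv ≫ c' :=
    h5.isoPullback_inv_snd.symm
  rw [h7]
  infer_instance

end ClosedImmersion

end SeveriBrauer

namespace SeveriBrauer

/-! ### Scheme-theoretically dominant points -/

section Dominant

theorem quasiCompact_of_field {T : Type u} [Field T] {X : Scheme.{u}}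
    (f : Spec (CommRingCat.of T) ⟶ X) : QuasiCompact f :=
  ⟨fun _ _ _ => (Set.toFinite _).isCompact⟩

/-- A closed subscheme is recovered from any scheme-theoretically dominant morphism to it: its ideal
is the kernel of the composition into the ambient scheme. -/
theorem exists_iso_of_isClosedImmersion {S Z₁ Z₂ X : Scheme.{u}} (c₁ : Z₁ ⟶ X) (c₂ : Z₂ ⟶ X)
    [IsClosedImmersion c₁] [IsClosedImmersion c₂] (d₁ : S ⟶ Z₁) (d₂ : S ⟶ Z₂)
    [IsSchemeTheoreticallyDominant d₁] [IsSchemeTheoreticallyDominant d₂]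
    (h : d₁ ≫ c₁ = d₂ ≫ c₂) : ∃ e : Z₁ ≅ Z₂, e.hom ≫ c₂ = c₁ ∧ d₁ ≫ e.hom = d₂ := by
  have hk : ∀ {Z : Scheme.{u}} (c : Z ⟶ X) (d : S ⟶ Z) [IsClosedImmersion c]
      [IsSchemeTheoreticallyDominant d], (d ≫ c).ker = c.ker := fun c d _ _ => by
    rw [Scheme.Hom.ker_comp, d.ker_eq_bot, Scheme.IdealSheafData.map_bot]
  have hker : c₂.ker = c₁.ker := by rw [← hk c₁ d₁, h, hk]
  have := IsClosedImmersion.isIso_lift c₂ c₁ hker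
  refine ⟨asIso (IsClosedImmersion.lift c₂ c₁ hker.le), IsClosedImmersion.lift_fac _ _ _, ?_⟩
  rw [← cancel_mono c₂, Category.assoc, asIso_hom, IsClosedImmersion.lift_fac, h]

/-- As `w` is a monomorphism, `d'` is the base change of `d` along `w`, and flat base change
preserves dominance for quasi-compact morphisms. It restricts dominant points to open subschemes. -/
theorem isSchemeTheoreticallyDominant_of_mono {S Z Z' : Scheme.{u}} {d : S ⟶ Z} {d' : S ⟶ Z'}
    {w : Z' ⟶ Z} [Mono w] [Flat w] [IsSchemeTheoreticallyDominant d] [QuasiCompact d]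
    (h : d' ≫ w = d) : IsSchemeTheoreticallyDominant d' := by
  have H : IsPullback (𝟙 S) d' d w := ⟨⟨by rw [Category.id_comp, h]⟩,
    ⟨PullbackCone.IsLimit.mk _ (fun s => s.fst) (fun s => Category.comp_id _)
      (fun s => by rw [← cancel_mono w, Category.assoc, h, s.condition])
      (fun s m hm _ => by rw [← hm, Category.comp_id])⟩⟩
  exact .of_isPullback H

theorem isDominant_specMap {A T : Type u} [CommRing A] [CommRing T] {f : A →+* T}
    (hf : Function.Injective f) : IsDominant (Spec.map (CommRingCat.ofHom f)) := by
  refine ⟨PrimeSpectrum.denseRange_comap_iff_ker_le_nilRadical f |>.2 ?_⟩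
  rw [(RingHom.injective_iff_ker_eq_bot f).1 hf]
  exact bot_le

theorem isSchemeTheoreticallyDominant_specMap {A T : Type u} [CommRing A] [Field T] {f : A →+* T}
    (hf : Function.Injective f) :
    IsSchemeTheoreticallyDominant (Spec.map (CommRingCat.ofHom f)) := by
  have := isReduced_of_injective f hf
  have := isDominant_specMap hf
  exact .of_isDominant _

/-- If no form vanishes at the point, the standard charts have coordinate rings inside the field.
They are reduced, and the point is dense in each of them. -/
theorem isSchemeTheoreticallyDominant_fieldPt {N : ℕ} {A T : Type u} [CommRing A] [Field T]
    {χ : MvPolynomial (Fin (N + 1)) A →+* T} (hχ : Function.Injective χ)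
    (h : ∃ i, χ (MvPolynomial.X i) ≠ 0) : IsSchemeTheoreticallyDominant (fieldPt χ h) := by
  have hA : Nontrivial A := nontrivial_of_ne 0 1 fun h01 => zero_ne_one (α := T) (by
    rw [← map_zero (χ.comp MvPolynomial.C), h01, map_one])
  have hX : ∀ i, χ (MvPolynomial.X i) ≠ 0 := fun i =>
    (map_ne_zero_iff _ hχ).2 (MvPolynomial.X_ne_zero _)
  have hinj : ∀ i, Function.Injective (evalAway χ (isUnit_iff_ne_zero.2 (hX i))) := fun i =>
    evalAway_injective hχ (X_mem_grading N A i) _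
  let 𝒰 := chartCover (X_mem_grading N A) (fun _ => one_pos) exists_X_notMem_ptIdeal
  have h1 : ∀ i, AlgebraicGeometry.IsReduced (𝒰.openCover.X i) := fun i => by
    have := isReduced_of_injective _ (hinj i)
    change AlgebraicGeometry.IsReduced (Spec (CommRingCat.of (AwayRing N (MvPolynomial.X i))))
    infer_instance
  have h2 : AlgebraicGeometry.IsReduced (projSpace N A) := .of_openCover _ 𝒰.openCover
  have h3 : IsDominant (fieldPt χ h) := by
    refine ⟨dense_iff_inter_open.2 fun U hU ⟨y, hy⟩ => ?_⟩
    obtain ⟨i, hi⟩ := exists_X_notMem_ptIdeal y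
    obtain ⟨x, rfl⟩ := (mem_range_chartι (X_mem_grading N A i) one_pos).2 hi
    have := isDominant_specMap (hinj i)
    obtain ⟨_, ht, t, rfl⟩ := dense_iff_inter_open.1 (Spec.map (CommRingCat.ofHom
      (evalAway χ (isUnit_iff_ne_zero.2 (hX i))))).denseRange _
      (hU.preimage (chartι (X_mem_grading N A i) one_pos).continuous) ⟨x, hy⟩
    refine ⟨_, ht, t, ?_⟩
    rw [fieldPt_eq χ h (X_mem_grading N A i) one_pos (isUnit_iff_ne_zero.2 (hX i)), pt,
      Scheme.Hom.comp_apply]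
  exact .of_isDominant _

theorem isBirationalMorphism_of_isOpenImmersion {U X Y : Scheme.{u}} {f : X ⟶ Y} (a : U ⟶ X)
    (b : U ⟶ Y) [IsOpenImmersion a] [IsOpenImmersion b] [IsDominant a] [IsDominant b]
    (h : a ≫ f = b) : IsBirationalMorphism f := by
  refine ⟨⟨a.opensRange, a.denseRange, b.opensRange, b.denseRange,
    a.isoOpensRange.symm ≪≫ b.isoOpensRange⟩, ?_⟩
  simp [← h]

end Dominant

end SeveriBrauer

namespace SeveriBrauer

/-! ### The closure of the graph of a rational map -/

section Graph

theorem isSchemeTheoreticallyDominant_toImage {X Y : Scheme.{u}} (f : X ⟶ Y) [QuasiCompact f] :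
    IsSchemeTheoreticallyDominant f.toImage := by
  rw [isSchemeTheoreticallyDominant_iff]
  refine Scheme.IdealSheafData.ext_of_iSup_eq_top
    (fun U : Y.affineOpens => ⟨f.imageι ⁻¹ᵁ U.1, U.2.preimage f.imageι⟩) ?_ fun U => ?_
  · rw [← top_le_iff]
    intro x _
    obtain ⟨U, hU⟩ := TopologicalSpace.Opens.mem_iSup.1
      ((iSup_affineOpens_eq_top Y).ge (TopologicalSpace.Opens.mem_top (f.imageι x)))
    exact TopologicalSpace.Opens.mem_iSup.2 ⟨U, hU⟩
  · rw [Scheme.Hom.ker_apply, (RingHom.injective_iff_ker_eq_bot _).1 (f.toImage_app_injective U)]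
    rfl

/-- Take for `Z` the scheme-theoretic image of the generic point of the graph. On an open set it
must coincide with the graph itself, which projects isomorphically to an open subscheme of `P`. -/
theorem exists_isBirationalMorphism {R P S U : Scheme.{u}} [IrreducibleSpace P] {r : R ⟶ S}
    {p : P ⟶ S} {T : Type u} [Field T] (u : U ⟶ R) (j : U ⟶ P) [IsOpenImmersion j]
    (h : u ≫ r = j ≫ p) (g : Spec (CommRingCat.of T) ⟶ U) [IsSchemeTheoreticallyDominant g] :
    ∃ (Z : Scheme.{u}) (z : Z ⟶ pullback r p), IsClosedImmersion z ∧
      (∃ d : Spec (CommRingCat.of T) ⟶ Z, IsSchemeTheoreticallyDominant d ∧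
        d ≫ z ≫ pullback.fst r p = g ≫ u ∧ d ≫ z ≫ pullback.snd r p = g ≫ j) ∧
      IsBirationalMorphism (z ≫ pullback.snd r p) := by
  let ξ : Spec (CommRingCat.of T) ⟶ pullback r p := pullback.lift (g ≫ u) (g ≫ j)
    (by rw [Category.assoc, Category.assoc, h])
  have hξ := quasiCompact_of_field ξ
  have hd : IsSchemeTheoreticallyDominant ξ.toImage := isSchemeTheoreticallyDominant_toImage _
  refine ⟨ξ.image, ξ.imageι, inferInstance, ⟨ξ.toImage, hd, ?_, ?_⟩, ?_⟩
  · rw [Scheme.Hom.toImage_imageι_assoc, pullback.lift_fst]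
  · rw [Scheme.Hom.toImage_imageι_assoc, pullback.lift_snd]
  -- an affine open subset of the target
  obtain ⟨W, w, _, _, hW⟩ : ∃ (W : Scheme.{u}) (w : W ⟶ R), IsAffine W ∧ IsOpenImmersion w ∧
      u (g (⊥ : PrimeSpectrum T)) ∈ Set.range w := by
    let 𝒰 := R.affineCover
    exact ⟨_, _, inferInstance, inferInstance, 𝒰.covers _⟩
  let V := pullback u w
  let jV : V ⟶ P := pullback.fst u w ≫ j
  let uV : V ⟶ W := pullback.snd u w
  have hV : uV ≫ w ≫ r = jV ≫ p := by
    rw [← pullback.condition_assoc, h, Category.assoc]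
  let gW : Spec (CommRingCat.of T) ⟶ W := IsOpenImmersion.lift w (g ≫ u) (by
    rintro _ ⟨t, rfl⟩
    obtain rfl : t = (⊥ : PrimeSpectrum T) := Subsingleton.elim _ _
    exact hW)
  let gV : Spec (CommRingCat.of T) ⟶ V := pullback.lift g gW (IsOpenImmersion.lift_fac _ _ _).symm
  have hgV : gV ≫ pullback.fst u w = g := pullback.lift_fst _ _ _
  have hqg := quasiCompact_of_field g
  have hgVd : IsSchemeTheoreticallyDominant gV := isSchemeTheoreticallyDominant_of_mono hgV
  let O := pullback (w ≫ r) (jV ≫ p)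
  let o : O ⟶ pullback r p := pullback.map _ _ _ _ w jV (𝟙 _) (Category.comp_id _)
    (Category.comp_id _)
  have ho : IsOpenImmersion o := inferInstance
  let γ : V ⟶ O := pullback.lift uV (𝟙 _) (by rw [hV, Category.id_comp])
  -- No separatedness of `R` is assumed. Since `W` is affine, its structure morphism is separated,
  -- and the graph of `uV` is closed in `O`.
  have hγ : IsClosedImmersion γ := by
    have : IsClosedImmersion (γ ≫ pullback.snd (w ≫ r) (jV ≫ p)) := by
      rw [pullback.lift_snd]
      infer_instance
    exact .of_comp γ (pullback.snd (w ≫ r) (jV ≫ p))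
  let d' : Spec (CommRingCat.of T) ⟶ pullback ξ.imageι o := pullback.lift ξ.toImage (gV ≫ γ) (by
    rw [Scheme.Hom.toImage_imageι]
    apply pullback.hom_ext
    · rw [pullback.lift_fst, Category.assoc, Category.assoc, pullback.lift_fst,
        pullback.lift_fst_assoc, pullback.lift_snd_assoc]
      exact (IsOpenImmersion.lift_fac _ _ _).symm
    · rw [pullback.lift_snd, Category.assoc, Category.assoc, pullback.lift_snd,
        pullback.lift_snd_assoc, Category.id_comp, pullback.lift_fst_assoc])
  have hd' : IsSchemeTheoreticallyDominant d' :=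
    isSchemeTheoreticallyDominant_of_mono (pullback.lift_fst _ _ _ : _ ≫ pullback.fst ξ.imageι o = _)
  -- The graph and the trace of `Z` are closed in `O` and share a dominant point, so they agree.
  obtain ⟨e, he, hde⟩ := exists_iso_of_isClosedImmersion γ (pullback.snd ξ.imageι o) gV d'
    (pullback.lift_snd _ _ _).symm
  have hP : Nonempty V := ⟨gV (⊥ : PrimeSpectrum T)⟩
  have hjV : IsDominant jV := ⟨jV.isOpenEmbedding.isOpen_range.dense (Set.range_nonempty _)⟩
  have ha : IsDominant (e.hom ≫ pullback.fst ξ.imageι o) := by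
    have h1 : IsDominant (gV ≫ e.hom ≫ pullback.fst ξ.imageι o) := by
      rw [reassoc_of% hde, pullback.lift_fst]
      infer_instance
    exact .of_comp gV _
  refine isBirationalMorphism_of_isOpenImmersion (e.hom ≫ pullback.fst ξ.imageι o) jV ?_
  rw [Category.assoc, pullback.condition_assoc, reassoc_of% he, pullback.lift_snd,
    pullback.lift_snd_assoc, Category.id_comp]

end Graph

end SeveriBrauer

namespace SeveriBrauer

/-! ### Generators of the standard charts -/

section AwayX

variable {N : ℕ} {R T : Type u} [CommRing R] [CommRing T]

theorem apply_eq_pow_mul {χ χ' : MvPolynomial (Fin (N + 1)) R →+* T} {c : T}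
    (hC : χ'.comp MvPolynomial.C = χ.comp MvPolynomial.C)
    (hX : ∀ l, χ' (MvPolynomial.X l) = c * χ (MvPolynomial.X l)) (n : ℕ)
    (a : MvPolynomial (Fin (N + 1)) R) (ha : a ∈ grading N R n) : χ' a = c ^ n * χ a := by
  have h1 : ∀ (ψ : MvPolynomial (Fin (N + 1)) R →+* T),
      ψ = MvPolynomial.eval₂Hom (ψ.comp MvPolynomial.C) fun l => ψ (MvPolynomial.X l) := fun ψ =>
    MvPolynomial.ringHom_ext (fun r => by simp) (fun l => by simp)
  let _ : Algebra R T := (χ.comp MvPolynomial.C).toAlgebra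
  rw [h1 χ', h1 χ, hC]
  simp_rw [hX]
  exact aeval_mul_of_isHomogeneous c _ ha

/-- The function `X l / X i` on the chart where `X i` does not vanish. -/
noncomputable def ratio (R : Type u) [CommRing R] (i l : Fin (N + 1)) :
    AwayRing N (MvPolynomial.X i : MvPolynomial (Fin (N + 1)) R) :=
  HomogeneousLocalization.Away.mk (grading N R) (X_mem_grading N R i) 1 (MvPolynomial.X l)
    (X_mem_grading N R l)

/-- The constants on the chart where `q` does not vanish. -/
noncomputable abbrev awayC (q : MvPolynomial (Fin (N + 1)) R) : R →+* AwayRing N q :=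
  (HomogeneousLocalization.fromZeroRingHom (grading N R) (Submonoid.powers q)).comp
    (algebraMap R (grading N R 0))

theorem evalAway_ratio (χ : MvPolynomial (Fin (N + 1)) R →+* T) {i : Fin (N + 1)}
    (hχ : IsUnit (χ (MvPolynomial.X i))) (l : Fin (N + 1)) :
    evalAway χ hχ (ratio R i l) * χ (MvPolynomial.X i) = χ (MvPolynomial.X l) := by
  have := evalAway_mk χ hχ (X_mem_grading N R i) 1 (MvPolynomial.X l) (X_mem_grading N R l)
  rwa [pow_one] at this

theorem ratio_self (i : Fin (N + 1)) : ratio R i i = 1 := by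
  let q : MvPolynomial (Fin (N + 1)) R := MvPolynomial.X i
  have hχ : IsUnit (algebraMap _ (Localization.Away q) q) := IsLocalization.Away.algebraMap_isUnit q
  refine evalAway_localization_injective hχ (hχ.mul_left_injective ?_)
  change evalAway _ hχ _ * _ = evalAway _ hχ _ * _
  rw [evalAway_ratio, map_one, one_mul]

theorem awayRing_hom_ext {i : Fin (N + 1)}
    {f g : AwayRing N (MvPolynomial.X i : MvPolynomial (Fin (N + 1)) R) →+* T}
    (hC : f.comp (awayC _) = g.comp (awayC _)) (hX : ∀ l, f (ratio R i l) = g (ratio R i l)) :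
    f = g := by
  let q : MvPolynomial (Fin (N + 1)) R := MvPolynomial.X i
  let θ : MvPolynomial (Fin (N + 1)) R →+* AwayRing N q :=
    MvPolynomial.eval₂Hom (awayC q) (ratio R i)
  let χ : MvPolynomial (Fin (N + 1)) R →+* Localization.Away q := algebraMap _ _
  have hχ : IsUnit (χ q) := IsLocalization.Away.algebraMap_isUnit q
  have hinj : Function.Injective (evalAway χ hχ) := evalAway_localization_injective hχ
  have hθ : ∀ n a (ha : a ∈ grading N R (n • 1)),
      HomogeneousLocalization.Away.mk (grading N R) (X_mem_grading N R i) n a ha = θ a := by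
    intro n a ha
    refine hinj ((hχ.pow n).mul_left_injective ?_)
    refine (evalAway_mk χ hχ (X_mem_grading N R i) n a ha).trans ?_
    refine (apply_eq_pow_mul (χ := (evalAway χ hχ).comp θ) (c := χ q) ?_ (fun l => ?_) n a ?_).trans
      (mul_comm _ _)
    · rw [RingHom.comp_assoc, ← evalAway_algebraMap χ hχ]
      congr 1
      exact RingHom.ext fun r => (MvPolynomial.eval₂Hom_C _ _ _).symm
    · rw [RingHom.comp_apply, MvPolynomial.eval₂Hom_X', mul_comm, evalAway_ratio]
    · simpa using ha
  have hfg : f.comp θ = g.comp θ := MvPolynomial.ringHom_ext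
    (fun r => by
      rw [RingHom.comp_apply, RingHom.comp_apply, MvPolynomial.eval₂Hom_C]
      exact congrArg (fun h => h r) hC)
    (fun l => by
      rw [RingHom.comp_apply, RingHom.comp_apply, MvPolynomial.eval₂Hom_X', hX])
  exact AwayRing.hom_ext (X_mem_grading N R i) fun n a ha => by
    rw [hθ]
    exact congrArg (fun h => h a) hfg

end AwayX

section ToSpec

/-- The ring homomorphism defined by a morphism to an affine scheme. -/
noncomputable def globalHom {X : Scheme.{u}} {A : Type u} [CommRing A]
    (f : X ⟶ Spec (CommRingCat.of A)) : A →+* Γ(X, ⊤) :=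
  ((Scheme.ΓSpecIso (CommRingCat.of A)).inv ≫ f.appTop).hom

theorem toSpecΓ_globalHom {X : Scheme.{u}} {A : Type u} [CommRing A]
    (f : X ⟶ Spec (CommRingCat.of A)) :
    X.toSpecΓ ≫ Spec.map (CommRingCat.ofHom (globalHom f)) = f := by
  rw [globalHom, CommRingCat.ofHom_hom, Spec.map_comp, ← Scheme.toSpecΓ_naturality_assoc,
    toSpecΓ_SpecMap_ΓSpecIso_inv]
  exact Category.comp_id _

theorem toSpecΓ_comp {X : Scheme.{u}} {A B : Type u} [CommRing A] [CommRing B] {φ : A →+* Γ(X, ⊤)}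
    {g : B →+* A} {f : X ⟶ Spec (CommRingCat.of B)} (h : φ.comp g = globalHom f) :
    (X.toSpecΓ ≫ Spec.map (CommRingCat.ofHom φ)) ≫ Spec.map (CommRingCat.ofHom g) = f := by
  rw [Category.assoc, ← Spec.map_comp, ← CommRingCat.ofHom_comp, h, toSpecΓ_globalHom]

theorem globalHom_comp {X : Scheme.{u}} {A B : Type u} [CommRing A] [CommRing B]
    (f : X ⟶ Spec (CommRingCat.of A)) (g : B →+* A) :
    globalHom (f ≫ Spec.map (CommRingCat.ofHom g)) = (globalHom f).comp g := by
  rw [globalHom, globalHom, Scheme.Hom.comp_appTop, ← Scheme.ΓSpecIso_inv_naturality_assoc]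
  rfl

end ToSpec

/-! ### Charts of a product of projective spaces -/

section ProductChart

variable {F : Type u} [Field F] {ι : Type u} {m : ι → ℕ} (c : ∀ i, Fin (m i + 1))

/-- The coordinate ring of the product of the standard charts `x_{c i} ≠ 0` of the spaces
`ℙ^{m i}`. -/
abbrev ChartRing (F : Type u) [Field F] {ι : Type u} {m : ι → ℕ} (c : ∀ i, Fin (m i + 1)) : Type u :=
  MvPolynomial {s : Σ i, Fin (m i + 1) // s.2 ≠ c s.1} F

open Classical in
/-- The homogeneous coordinates of the `i`-th component of the generic point of a product chart,
normalised by `chartCoord c i (c i) = 1`. -/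
noncomputable def chartCoord (F : Type u) [Field F] {ι : Type u} {m : ι → ℕ}
    (c : ∀ i, Fin (m i + 1)) (i : ι) (l : Fin (m i + 1)) : ChartRing F c :=
  if h : l = c i then 1 else MvPolynomial.X ⟨⟨i, l⟩, h⟩

theorem chartCoord_self (i : ι) : chartCoord F c i (c i) = 1 := dif_pos rfl

/-- The homogeneous coordinates `chartCoord` as a ring homomorphism. -/
noncomputable def chartHom (F : Type u) [Field F] {ι : Type u} {m : ι → ℕ}
    (c : ∀ i, Fin (m i + 1)) (i : ι) : MvPolynomial (Fin (m i + 1)) F →+* ChartRing F c :=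
  MvPolynomial.eval₂Hom MvPolynomial.C (chartCoord F c i)

theorem chartHom_X (i : ι) (l : Fin (m i + 1)) :
    chartHom F c i (MvPolynomial.X l) = chartCoord F c i l :=
  MvPolynomial.eval₂Hom_X' _ _ _

theorem chartHom_comp_C (i : ι) : (chartHom F c i).comp MvPolynomial.C = MvPolynomial.C :=
  RingHom.ext fun _ => MvPolynomial.eval₂Hom_C _ _ _

theorem isUnit_chartHom (i : ι) : IsUnit (chartHom F c i (MvPolynomial.X (c i))) := by
  rw [chartHom_X, chartCoord_self]
  exact isUnit_one

theorem chartRing_hom_ext {T : Type*} [CommRing T] {f g : ChartRing F c →+* T}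
    (hC : f.comp MvPolynomial.C = g.comp MvPolynomial.C)
    (h : ∀ i l, f (chartCoord F c i l) = g (chartCoord F c i l)) : f = g := by
  refine MvPolynomial.ringHom_ext (fun r => congrArg (fun h => h r) hC) fun s => ?_
  have := h s.1.1 s.1.2
  rwa [chartCoord, dif_neg s.2] at this

theorem evalAway_chartHom_ratio (i : ι) (l : Fin (m i + 1)) :
    evalAway (chartHom F c i) (isUnit_chartHom c i) (ratio F (c i) l) = chartCoord F c i l := by
  have := evalAway_ratio (chartHom F c i) (isUnit_chartHom c i) l
  rwa [chartHom_X, chartCoord_self, mul_one, chartHom_X] at this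

/-- The `i`-th projection of a product chart. -/
noncomputable def chartPt (F : Type u) [Field F] {ι : Type u} {m : ι → ℕ}
    (c : ∀ i, Fin (m i + 1)) (i : ι) : Spec (CommRingCat.of (ChartRing F c)) ⟶ projSpace (m i) F :=
  pt (chartHom F c i) (X_mem_grading (m i) F (c i)) one_pos (isUnit_chartHom c i)

theorem chartPt_str (i : ι) : chartPt F c i ≫ projSpaceStr (m i) F =
    Spec.map (CommRingCat.ofHom MvPolynomial.C) := by
  rw [chartPt, pt_str, chartHom_comp_C]

/-- A scheme `X` over a field that is a product of projective spaces is covered by product charts. -/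
theorem exists_productChart [Finite ι] {X : Scheme.{u}} {s : X ⟶ Spec (CommRingCat.of F)}
    (π : ∀ i, X ⟶ projSpace (m i) F) (hπ : ∀ i, π i ≫ projSpaceStr (m i) F = s)
    (hext : ∀ {T : Scheme.{u}} {g g' : T ⟶ X}, g ≫ s = g' ≫ s → (∀ i, g ≫ π i = g' ≫ π i) → g = g')
    (hex : ∀ {T : Scheme.{u}} (t : T ⟶ Spec (CommRingCat.of F)) (h : ∀ i, T ⟶ projSpace (m i) F),
      (∀ i, h i ≫ projSpaceStr (m i) F = t) → ∃ g : T ⟶ X, g ≫ s = t ∧ ∀ i, g ≫ π i = h i) (x : X) :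
    ∃ (c : ∀ i, Fin (m i + 1)) (v : Spec (CommRingCat.of (ChartRing F c)) ⟶ X),
      IsOpenImmersion v ∧ x ∈ Set.range v ∧
      v ≫ s = Spec.map (CommRingCat.ofHom (MvPolynomial.C : F →+* ChartRing F c)) ∧
      ∀ i, v ≫ π i = chartPt F c i := by
  choose c hc using fun i => exists_X_notMem_ptIdeal (π i x)
  obtain ⟨v, hvs, hv⟩ := hex (Spec.map (CommRingCat.ofHom (MvPolynomial.C : F →+* ChartRing F c)))
    (chartPt F c) (chartPt_str c)
  let q := fun i => X_mem_grading (m i) F (c i)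
  let W := fun i => (chartι (q i) one_pos).opensRange
  let O : X.Opens := ⟨⋂ i, π i ⁻¹' (W i : Set (projSpace (m i) F)),
    isOpen_iInter_of_finite fun i => (W i).isOpen.preimage (π i).continuous⟩
  have hO : ∀ y : X, y ∈ O ↔ ∀ i, π i y ∈ Set.range (chartι (q i) one_pos) := fun y => Set.mem_iInter
  let vO : Spec (CommRingCat.of (ChartRing F c)) ⟶ O := IsOpenImmersion.lift O.ι v (by
    rintro _ ⟨y, rfl⟩
    rw [Scheme.Opens.range_ι]
    refine (hO _).2 fun i => ?_
    rw [← Scheme.Hom.comp_apply, hv, chartPt, pt, Scheme.Hom.comp_apply]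
    exact ⟨_, rfl⟩)
  have hvO : vO ≫ O.ι = v := IsOpenImmersion.lift_fac _ _ _
  let w : ∀ i, O.toScheme ⟶ Spec (CommRingCat.of (AwayRing (m i) (MvPolynomial.X (c i)))) := fun i =>
    IsOpenImmersion.lift (chartι (q i) one_pos) (O.ι ≫ π i) (by
      rintro _ ⟨y, rfl⟩
      rw [Scheme.Hom.comp_apply]
      exact (hO _).1 y.2 i)
  have hw : ∀ i, w i ≫ chartι (q i) one_pos = O.ι ≫ π i := fun i => IsOpenImmersion.lift_fac _ _ _
  -- The affine coordinates of the components are functions on `O`. They define the inverse of the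
  -- morphism from the chart to `O`.
  let φ : ChartRing F c →+* Γ(O, ⊤) := MvPolynomial.eval₂Hom (globalHom (O.ι ≫ s))
    fun y => globalHom (w y.1.1) (ratio F (c y.1.1) y.1.2)
  have hφC : φ.comp MvPolynomial.C = globalHom (O.ι ≫ s) :=
    RingHom.ext fun _ => MvPolynomial.eval₂Hom_C _ _ _
  have hφ : ∀ i, φ.comp (evalAway (chartHom F c i) (isUnit_chartHom c i)) = globalHom (w i) := by
    intro i
    refine awayRing_hom_ext ?_ fun l => ?_
    · rw [RingHom.comp_assoc, evalAway_algebraMap, chartHom_comp_C, hφC, ← globalHom_comp,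
        ← chartι_str (q i) one_pos, reassoc_of% hw, hπ]
    · rw [RingHom.comp_apply, evalAway_chartHom_ratio, chartCoord]
      split_ifs with h
      · rw [h, ratio_self, map_one, map_one]
      · exact MvPolynomial.eval₂Hom_X' _ _ _
  let t : O.toScheme ⟶ Spec (CommRingCat.of (ChartRing F c)) :=
    O.toScheme.toSpecΓ ≫ Spec.map (CommRingCat.ofHom φ)
  have htC : t ≫ Spec.map (CommRingCat.ofHom (MvPolynomial.C : F →+* ChartRing F c)) = O.ι ≫ s :=
    toSpecΓ_comp hφC
  have htw : ∀ i, t ≫ Spec.map (CommRingCat.ofHom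
      (evalAway (chartHom F c i) (isUnit_chartHom c i))) = w i := fun i =>
    toSpecΓ_comp (hφ i)
  have htv : t ≫ v = O.ι := by
    refine hext ?_ fun i => ?_
    · rw [Category.assoc, hvs, htC]
    · rw [Category.assoc, hv, chartPt, pt, reassoc_of% htw, hw]
  have htvO : t ≫ vO = 𝟙 _ := by
    rw [← cancel_mono O.ι, Category.assoc, hvO, htv, Category.id_comp]
  have hvOt : vO ≫ t = 𝟙 _ := by
    obtain ⟨γ, hγ⟩ : ∃ γ : ChartRing F c →+* ChartRing F c,
        Spec.map (CommRingCat.ofHom γ) = vO ≫ t :=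
      ⟨(Spec.preimage (vO ≫ t)).hom, Spec.map_preimage _⟩
    have h1 : γ = RingHom.id _ := by
      refine chartRing_hom_ext c ?_ fun i l => ?_
      · apply specMap_ofHom_injective
        rw [CommRingCat.ofHom_comp, Spec.map_comp, hγ, Category.assoc, htC, reassoc_of% hvO, hvs]
      · have h2 : γ.comp (evalAway (chartHom F c i) (isUnit_chartHom c i)) =
            evalAway (chartHom F c i) (isUnit_chartHom c i) := by
          apply specMap_ofHom_injective
          rw [CommRingCat.ofHom_comp, Spec.map_comp, hγ, Category.assoc, htw,
            ← cancel_mono (chartι (q i) one_pos), Category.assoc, hw, reassoc_of% hvO, hv]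
          rfl
        rw [← evalAway_chartHom_ratio]
        exact congrArg (fun h => h (ratio F (c i) l)) h2
    rw [← hγ, h1]
    exact Spec.map_id _
  have hiso : IsIso vO := ⟨t, hvOt, htvO⟩
  refine ⟨c, v, hvO ▸ inferInstance, ?_, hvs, hv⟩
  have hx : x ∈ O := (hO x).2 fun i => (mem_range_chartι _ _).2 (hc i)
  exact ⟨t (show O.toScheme from ⟨x, hx⟩),
    congrArg (fun f : O.toScheme ⟶ X => f (show O.toScheme from ⟨x, hx⟩)) htv⟩

end ProductChart

end SeveriBrauer

/-! ### The bundle of spans over a product chart -/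

namespace SeveriBrauer

theorem sum_sum_mul_eq {ι F T : Type*} [Fintype ι] [CommRing F] [CommRing T] {N : ℕ} {m : ι → ℕ}
    (α : F →+* T) (M : ∀ σ, Matrix (Fin N) (Fin (m σ + 1)) F)
    (D : ∀ σ, Matrix (Fin (m σ + 1)) (Fin N) F) (h : ∑ σ, M σ * D σ = 1) (y : Fin N → T)
    (r : Fin N) : ∑ σ, ∑ l, α (M σ r l) * ∑ r', α (D σ l r') * y r' = y r := by
  have h1 : ∀ σ, ∑ l, α (M σ r l) * ∑ r', α (D σ l r') * y r' =
      ((M σ * D σ).map α).mulVec y r := fun σ => by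
    rw [Matrix.map_mul, ← Matrix.mulVec_mulVec]
    rfl
  calc _ = ∑ σ, ((M σ * D σ).map α).mulVec y r := Finset.sum_congr rfl fun σ _ => h1 σ
    _ = ((∑ σ, M σ * D σ).map α).mulVec y r := by
      rw [← RingHom.mapMatrix_apply, map_sum, Matrix.sum_mulVec, Finset.sum_apply]
      rfl
    _ = y r := by
      rw [h, Matrix.map_one _ (map_zero α) (map_one α), Matrix.one_mulVec]

namespace ConjugateData

variable {k K F : Type u} [Field k] [Field K] [Algebra k K] [Field F] [Algebra k F]
  {N n : ℕ} [FiniteDimensional k K]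
  {L P : Scheme.{u}} {p : P ⟶ Spec (CommRingCat.of k)} {i : L ⟶ pullback p (specExt k K)}
  {Φ : pullback p (specExt k F) ≅ projSpace N F} (C : ConjugateData p i Φ)
  (c : ∀ σ, Fin (C.m σ + 1)) (ε : Fin (n + 1) ≃ (K →ₐ[k] F))

/-- The matrix whose columns are homogeneous coordinates of a family of points, one on each
`ℙ(W_σ)`, over a product chart. -/
noncomputable def bundleMatrix : Matrix (Fin (N + 1)) (Fin (n + 1)) (ChartRing F c) :=
  fun r t => ∑ l, MvPolynomial.C (C.M (ε t) r l) * chartCoord F c (ε t) l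

theorem sum_D_mul_bundleMatrix_self (t : Fin (n + 1)) (l : Fin (C.m (ε t) + 1)) :
    ∑ r, MvPolynomial.C (C.D (ε t) l r) * C.bundleMatrix c ε r t = chartCoord F c (ε t) l := by
  simp_rw [bundleMatrix, Finset.mul_sum, ← mul_assoc, ← MvPolynomial.C_mul]
  rw [Finset.sum_comm]
  simp_rw [← Finset.sum_mul, ← map_sum, ← Matrix.mul_apply, C.D_mul_M_self, Matrix.one_apply]
  simp

theorem sum_D_mul_bundleMatrix_of_ne {σ : K →ₐ[k] F} {t : Fin (n + 1)} (h : σ ≠ ε t)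
    (l : Fin (C.m σ + 1)) : ∑ r, MvPolynomial.C (C.D σ l r) * C.bundleMatrix c ε r t = 0 := by
  simp_rw [bundleMatrix, Finset.mul_sum, ← mul_assoc, ← MvPolynomial.C_mul]
  rw [Finset.sum_comm]
  simp_rw [← Finset.sum_mul, ← map_sum, ← Matrix.mul_apply, C.D_mul_M_of_ne _ _ h]
  simp

/-- In each column the coordinate with index `c` is normalised to one, and `D` reads off this
coordinate while killing the other columns. -/
theorem bundleMatrix_leftInverse :
    ∃ D : Matrix (Fin (n + 1)) (Fin (N + 1)) (ChartRing F c), D * C.bundleMatrix c ε = 1 := by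
  refine ⟨Matrix.of fun t r => MvPolynomial.C (C.D (ε t) (c (ε t)) r), Matrix.ext fun s t => ?_⟩
  rw [Matrix.mul_apply, Matrix.one_apply]
  split_ifs with h
  · subst h
    refine Eq.trans ?_ (chartCoord_self c (ε s))
    exact C.sum_D_mul_bundleMatrix_self c ε s _
  · exact C.sum_D_mul_bundleMatrix_of_ne c ε (fun h' => h (ε.injective h')) _

/-- The family of linear subspaces spanned by the columns of `bundleMatrix`, on coordinate rings. -/
noncomputable def bundleSubst :
    MvPolynomial (Fin (N + 1)) F →+* MvPolynomial (Fin (n + 1)) (ChartRing F c) :=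
  (linearSubst MvPolynomial.C (C.bundleMatrix c ε) : MvPolynomial (Fin (N + 1)) F →+*
    MvPolynomial (Fin (n + 1)) (ChartRing F c))

/-- The projection to `W_σ` of a point in the span is a multiple of the chosen point on `ℙ(W_σ)`;
the factor is the fibre coordinate. -/
theorem bundleSubst_linearSubst_X (t : Fin (n + 1)) (l : Fin (C.m (ε t) + 1)) :
    C.bundleSubst c ε (linearSubst (RingHom.id F) (C.D (ε t)) (MvPolynomial.X l)) =
      MvPolynomial.X t * MvPolynomial.C (chartHom F c (ε t) (MvPolynomial.X l)) := by
  change linearSubst MvPolynomial.C (C.bundleMatrix c ε)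
    (linearSubst (RingHom.id F) (C.D (ε t)) (MvPolynomial.X l)) = _
  rw [linearSubst_linearSubst, linearSubst_X, chartHom_X, Finset.sum_eq_single t]
  · rw [← C.sum_D_mul_bundleMatrix_self, mul_comm]
    rfl
  · intro s _ hs
    have : ((C.D (ε t)).map MvPolynomial.C * C.bundleMatrix c ε :
        Matrix (Fin (C.m (ε t) + 1)) (Fin (n + 1)) (ChartRing F c)) l s = 0 :=
      C.sum_D_mul_bundleMatrix_of_ne c ε (fun h => hs (ε.injective h).symm) l
    refine (congrArg (fun z => MvPolynomial.C z * MvPolynomial.X s) this).trans ?_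
    rw [map_zero, zero_mul]
  · exact fun h => absurd (Finset.mem_univ _) h

/-- The bundle dominates projective space, because the generic vector is the sum of its components
and so lies in the span of its projections. Algebraically, `θ` evaluates the bundle at these
projections and recovers the generic point. -/
theorem bundleSubst_injective : Function.Injective (C.bundleSubst c ε) := by
  let 𝓕 := FractionRing (MvPolynomial (Fin (N + 1)) F)
  let x : ∀ σ, Fin (C.m σ + 1) → 𝓕 := fun σ l => C.coord 𝓕 σ (MvPolynomial.X l)
  have hx : ∀ σ l, x σ l ≠ 0 := fun σ l =>
    (map_ne_zero_iff _ (C.coord_injective σ)).2 (MvPolynomial.X_ne_zero l)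
  let α : F →+* 𝓕 := algebraMap F 𝓕
  let θ₀ : ChartRing F c →+* 𝓕 :=
    MvPolynomial.eval₂Hom α fun s => x s.1.1 s.1.2 / x s.1.1 (c s.1.1)
  let θ : MvPolynomial (Fin (n + 1)) (ChartRing F c) →+* 𝓕 :=
    MvPolynomial.eval₂Hom θ₀ fun t => x (ε t) (c (ε t))
  have hθ₀ : ∀ σ l, θ₀ (chartCoord F c σ l) * x σ (c σ) = x σ l := fun σ l => by
    rw [chartCoord]
    split_ifs with h
    · rw [map_one, one_mul, h]
    · rw [MvPolynomial.eval₂Hom_X']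
      exact div_mul_cancel₀ _ (hx _ _)
  have hα : ∀ r, algebraMap (MvPolynomial (Fin (N + 1)) F) 𝓕 (MvPolynomial.C r) = α r := fun r =>
    (IsScalarTower.algebraMap_apply F (MvPolynomial (Fin (N + 1)) F) 𝓕 r).symm
  have hM : ∀ r, ∑ σ, ∑ l, α (C.M σ r l) * x σ l =
      algebraMap (MvPolynomial (Fin (N + 1)) F) 𝓕 (MvPolynomial.X r) := fun r => by
    have h1 : ∀ σ l, x σ l = ∑ r', α (C.D σ l r') *
        algebraMap (MvPolynomial (Fin (N + 1)) F) 𝓕 (MvPolynomial.X r') :=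
      fun σ l => by
        change algebraMap _ 𝓕 (linearSubst (RingHom.id F) (C.D σ) (MvPolynomial.X l)) = _
        rw [linearSubst_X, map_sum]
        simp_rw [map_mul, hα]
    refine Eq.trans ?_ (sum_sum_mul_eq α C.M C.D C.sum_M_mul_D
      (fun r => algebraMap (MvPolynomial (Fin (N + 1)) F) 𝓕 (MvPolynomial.X r)) r)
    exact Finset.sum_congr rfl fun σ _ => Finset.sum_congr rfl fun l _ => congrArg _ (h1 σ l)
  have h : θ.comp (C.bundleSubst c ε) = algebraMap _ 𝓕 := by
    refine MvPolynomial.ringHom_ext (fun r => ?_) fun r => ?_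
    · rw [hα]
      change θ (linearSubst MvPolynomial.C (C.bundleMatrix c ε) (MvPolynomial.C r)) = _
      rw [linearSubst_C, MvPolynomial.eval₂Hom_C, MvPolynomial.eval₂Hom_C]
    · change θ (linearSubst MvPolynomial.C (C.bundleMatrix c ε) (MvPolynomial.X r)) = _
      rw [linearSubst_X, map_sum, ← hM, ← Equiv.sum_comp ε]
      refine Finset.sum_congr rfl fun t _ => ?_
      rw [map_mul, MvPolynomial.eval₂Hom_C, MvPolynomial.eval₂Hom_X', bundleMatrix, map_sum,
        Finset.sum_mul]
      refine Finset.sum_congr rfl fun l _ => ?_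
      rw [map_mul, MvPolynomial.eval₂Hom_C, mul_assoc, hθ₀]
  refine Function.Injective.of_comp (f := θ) ?_
  rw [← RingHom.coe_comp, h]
  exact IsFractionRing.injective _ _

end ConjugateData

end SeveriBrauer

/-! ### Morphisms to the Weil restriction on affine schemes -/

namespace SeveriBrauer

theorem flat_specExt (k K : Type u) [Field k] [Field K] [Algebra k K] : Flat (specExt k K) := by
  rw [Flat.SpecMap_iff]
  exact RingHom.flat_algebraMap_iff.2 inferInstance

theorem baseChart_baseChangeMap {k : Type u} [Field k] {Z R : Scheme.{u}}
    {s : Z ⟶ Spec (CommRingCat.of k)} {r : R ⟶ Spec (CommRingCat.of k)} {A : Type u} [CommRing A]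
    [Algebra k A] (d : Spec (CommRingCat.of A) ⟶ Z)
    (hd : d ≫ s = Spec.map (CommRingCat.ofHom (algebraMap k A))) (f : Z ⟶ R) (hf : f ≫ r = s)
    {g : Spec (CommRingCat.of A) ⟶ R}
    (hg : g ≫ r = Spec.map (CommRingCat.ofHom (algebraMap k A))) (h : d ≫ f = g)
    (K : Type u) [Field K] [Algebra k K] :
    baseChart d hd K ≫ baseChangeMap K s r f hf = baseChart g hg K := by
  apply pullback.hom_ext
  · rw [Category.assoc, baseChangeMap, pullback.lift_fst, baseChart_fst_assoc, baseChart_fst, h]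
  · rw [Category.assoc, baseChangeMap, pullback.lift_snd, baseChart_snd, baseChart_snd]

theorem IsWeilRestriction.exists_affine {k K : Type u} [Field k] [Field K] [Algebra k K]
    {L R : Scheme.{u}} {l : L ⟶ Spec (CommRingCat.of K)} {r : R ⟶ Spec (CommRingCat.of k)}
    {ev : pullback r (specExt k K) ⟶ L} (hR : IsWeilRestriction l r ev) {A : Type u} [CommRing A]
    [Algebra k A] (h : Spec (CommRingCat.of (K ⊗[k] A)) ⟶ L) (hh : h ≫ l = Spec.map
      (CommRingCat.ofHom (Algebra.TensorProduct.includeLeftRingHom : K →+* K ⊗[k] A))) :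
    ∃ (u : Spec (CommRingCat.of A) ⟶ R)
      (hu : u ≫ r = Spec.map (CommRingCat.ofHom (algebraMap k A))), baseChart u hu K ≫ ev = h := by
  let t : Spec (CommRingCat.of A) ⟶ Spec (CommRingCat.of k) :=
    Spec.map (CommRingCat.ofHom (algebraMap k A))
  let θ : Spec (CommRingCat.of (K ⊗[k] A)) ⟶ pullback t (specExt k K) :=
    baseChart (𝟙 _) (Category.id_comp t) K
  have hθ : IsIso θ := (isPullback_baseChart (𝟙 _) (Category.id_comp t) K).isIso_fst_of_isIso
  obtain ⟨u, ⟨hu, h1⟩, -⟩ := hR.existsUnique _ t (inv θ ≫ h) (by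
    rw [Category.assoc, hh, IsIso.inv_comp_eq, baseChart_snd])
  refine ⟨u, hu, ?_⟩
  rw [← baseChart_baseChangeMap (𝟙 _) (Category.id_comp t) u hu hu (Category.id_comp u),
    Category.assoc, h1, IsIso.hom_inv_id_assoc]

namespace ConjugateData

variable {k K F Ω 𝓕 : Type u} [Field k] [Field K] [Algebra k K] [Field F] [Algebra k F]
  [Field Ω] [Algebra k Ω] [Field 𝓕] {N : ℕ} [Algebra (MvPolynomial (Fin (N + 1)) F) 𝓕]
  [IsFractionRing (MvPolynomial (Fin (N + 1)) F) 𝓕] [Algebra F 𝓕]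
  [IsScalarTower F (MvPolynomial (Fin (N + 1)) F) 𝓕] [FiniteDimensional k K]
  {L P R : Scheme.{u}} {p : P ⟶ Spec (CommRingCat.of k)} {i : L ⟶ pullback p (specExt k K)}
  {Φ : pullback p (specExt k F) ≅ projSpace N F} (C : ConjugateData p i Φ)
  {r : R ⟶ Spec (CommRingCat.of k)} {ev : pullback r (specExt k K) ⟶ L}
  (hR : IsWeilRestriction (i ≫ pullback.snd _ _) r ev)

/-- This translates the property of the descended morphism to `L` into the statement that the
descended rational map to `R` becomes the family of linear projections over `F`. -/
theorem specMap_baseChart_weilProj (E : F ⊗[k] Ω →ₐ[F] 𝓕) {A : Type u} [CommRing A] [Algebra k A]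
    (a : A →ₐ[k] Ω) {u : Spec (CommRingCat.of A) ⟶ R}
    (hu : u ≫ r = Spec.map (CommRingCat.ofHom (algebraMap k A))) {g : Spec (CommRingCat.of Ω) ⟶ R}
    (hg : g ≫ r = Spec.map (CommRingCat.ofHom (algebraMap k Ω)))
    (hag : Spec.map (CommRingCat.ofHom (a : A →+* Ω)) ≫ u = g) (σ : K →ₐ[k] F)
    (h : Spec.map (CommRingCat.ofHom ((E : F ⊗[k] Ω →+* 𝓕).comp
          ((mapLeft Ω σ : K ⊗[k] Ω →+* F ⊗[k] Ω).comp
          (Algebra.TensorProduct.map (AlgHom.id K K) a : K ⊗[k] A →+* K ⊗[k] Ω)))) ≫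
            baseChart u hu K ≫ ev = C.proj 𝓕 σ ≫ C.a σ) :
    Spec.map (CommRingCat.ofHom (E : F ⊗[k] Ω →+* 𝓕)) ≫ baseChart g hg F ≫ C.weilProj hR σ =
      C.proj 𝓕 σ := by
  have hE : (E : F ⊗[k] Ω →+* 𝓕).comp
      (Algebra.TensorProduct.includeLeftRingHom : F →+* F ⊗[k] Ω) = algebraMap F 𝓕 :=
    RingHom.ext fun y => E.commutes y
  apply (C.isPullback σ).hom_ext
  · have h1 := C.comp_weilProj_a hR (Spec.map (CommRingCat.ofHom (E : F ⊗[k] Ω →+* 𝓕)) ≫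
      baseChart g hg F) rfl σ
    rw [← h, Category.assoc, Category.assoc, ← Category.assoc, h1]
    refine Eq.trans ?_ (Category.assoc _ _ _)
    refine congrArg (· ≫ ev) ?_
    apply pullback.hom_ext
    · rw [pullback.lift_fst, Category.assoc, Category.assoc, baseChart_fst, baseChart_fst, ← hag,
        ← Spec.map_comp_assoc, ← Spec.map_comp_assoc, ← Spec.map_comp_assoc,
        ← CommRingCat.ofHom_comp, ← CommRingCat.ofHom_comp, ← CommRingCat.ofHom_comp]
      refine congrArg (fun f => Spec.map (CommRingCat.ofHom f) ≫ u) (RingHom.ext fun y => ?_)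
      simp
    · rw [pullback.lift_snd, Category.assoc, Category.assoc, Category.assoc, baseChart_snd_assoc,
        baseChart_snd,
        ← Spec.map_comp, ← Spec.map_comp, ← Spec.map_comp,
        ← CommRingCat.ofHom_comp, ← CommRingCat.ofHom_comp, ← CommRingCat.ofHom_comp]
      refine congrArg (fun f => Spec.map (CommRingCat.ofHom f)) (RingHom.ext fun y => ?_)
      simp
  · rw [Category.assoc, Category.assoc, weilProj_str, baseChart_snd, ← Spec.map_comp,
      ← CommRingCat.ofHom_comp, proj, fieldPt_str, hE, coord_C]

end ConjugateData

end SeveriBrauer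

/-! ### Comparison of the closed graph with the bundle of spans -/

namespace SeveriBrauer

/-- The morphism `Z_F ⟶ R_F ×_F ℙ^N` is a base change of `Z ⟶ R × P`. -/
theorem isClosedImmersion_lift_baseChange {k F : Type u} [Field k] [Field F] [Algebra k F] {N : ℕ}
    {Z R P : Scheme.{u}} {r : R ⟶ Spec (CommRingCat.of k)} {p : P ⟶ Spec (CommRingCat.of k)}
    {Φ : pullback p (specExt k F) ≅ projSpace N F}
    (hΦ : Φ.hom ≫ projSpaceStr N F = pullback.snd _ _) (z : Z ⟶ pullback r p) [IsClosedImmersion z]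
    {c : pullback (z ≫ pullback.fst r p ≫ r) (specExt k F) ⟶
      pullback (pullback.snd r (specExt k F)) (projSpaceStr N F)}
    (h₁ : c ≫ pullback.fst _ _ ≫ pullback.fst r (specExt k F) =
      pullback.fst _ _ ≫ z ≫ pullback.fst r p)
    (h₂ : c ≫ pullback.snd _ _ ≫ Φ.inv ≫ pullback.fst p (specExt k F) =
      pullback.fst _ _ ≫ z ≫ pullback.snd r p)
    (h₃ : c ≫ pullback.fst _ _ ≫ pullback.snd r (specExt k F) = pullback.snd _ _) :
    IsClosedImmersion c := by
  have s1 := (IsPullback.of_hasPullback (pullback.snd r (specExt k F)) (projSpaceStr N F)).flip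
  have s2 : IsPullback (Φ.inv ≫ pullback.fst p (specExt k F)) (projSpaceStr N F) p (specExt k F) :=
    IsPullback.of_iso (IsPullback.of_hasPullback p (specExt k F)) Φ (Iso.refl _) (Iso.refl _)
      (Iso.refl _) (by simp) (by simp [hΦ]) (by simp) (by simp)
  have s3 := s1.paste_horiz s2
  rw [← pullback.condition] at s3
  let β : pullback (pullback.snd r (specExt k F)) (projSpaceStr N F) ⟶ pullback r p :=
    pullback.lift (pullback.fst _ _ ≫ pullback.fst _ _)
      (pullback.snd _ _ ≫ Φ.inv ≫ pullback.fst p (specExt k F))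
      ((Category.assoc _ _ _).trans s3.w.symm)
  have s4 : IsPullback β (pullback.fst _ _) (pullback.fst r p) (pullback.fst r (specExt k F)) := by
    refine IsPullback.of_right ?_ (pullback.lift_fst _ _ _)
      (IsPullback.of_hasPullback r p).flip
    rw [pullback.lift_snd]
    exact s3
  have s5 := s4.paste_vert (IsPullback.of_hasPullback r (specExt k F))
  have s6 : IsPullback (pullback.fst (z ≫ pullback.fst r p ≫ r) (specExt k F)) c z β := by
    refine IsPullback.of_bot ?_ ?_ s5
    · rw [h₃]
      exact IsPullback.of_hasPullback _ _
    · apply pullback.hom_ext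
      · rw [Category.assoc, Category.assoc, pullback.lift_fst, h₁]
      · rw [Category.assoc, Category.assoc, pullback.lift_snd, h₂]
  exact MorphismProperty.of_isPullback (P := @IsClosedImmersion) s6 inferInstance

theorem exists_fractionRing_lift {S 𝓕 T : Type*} [CommRing S] [Field 𝓕] [Algebra S 𝓕]
    [IsFractionRing S 𝓕] [Field T] {f : S →+* T} (hf : Function.Injective f) :
    ∃ ρ : 𝓕 →+* T, ρ.comp (algebraMap S 𝓕) = f :=
  ⟨IsFractionRing.lift hf, RingHom.ext fun _ => IsFractionRing.lift_algebraMap hf _⟩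

namespace ConjugateData

variable {k K F Ω 𝓕 : Type u} [Field k] [Field K] [Algebra k K] [Field F] [Algebra k F]
  [Field Ω] [Algebra k Ω] [Field 𝓕] {N n : ℕ} [Algebra (MvPolynomial (Fin (N + 1)) F) 𝓕]
  [IsFractionRing (MvPolynomial (Fin (N + 1)) F) 𝓕] [Algebra F 𝓕]
  [IsScalarTower F (MvPolynomial (Fin (N + 1)) F) 𝓕] [FiniteDimensional k K]
  {L P R Z : Scheme.{u}} {p : P ⟶ Spec (CommRingCat.of k)} {i : L ⟶ pullback p (specExt k K)}
  {Φ : pullback p (specExt k F) ≅ projSpace N F} (C : ConjugateData p i Φ)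
  {r : R ⟶ Spec (CommRingCat.of k)} {ev : pullback r (specExt k K) ⟶ L}
  (hR : IsWeilRestriction (i ≫ pullback.snd _ _) r ev)

variable [Algebra.IsSeparable k K] [IsAlgClosed F]

/-- The generic point of the bundle given by `bundleMatrix` maps to the generic point of `R_F ×_F ℙ^N`. -/
theorem exists_fieldPt_eq (c : ∀ σ, Fin (C.m σ + 1)) (ε : Fin (n + 1) ≃ (K →ₐ[k] F))
    {v : Spec (CommRingCat.of (ChartRing F c)) ⟶ pullback r (specExt k F)}
    (hvs : v ≫ pullback.snd _ _ = Spec.map (CommRingCat.ofHom (MvPolynomial.C : F →+* ChartRing F c)))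
    (hv : ∀ σ, v ≫ C.weilProj hR σ = chartPt F c σ)
    {γ : Spec (CommRingCat.of 𝓕) ⟶ pullback r (specExt k F)}
    (hγs : γ ≫ pullback.snd _ _ = genPt 𝓕 ≫ projSpaceStr N F)
    (hγ : ∀ σ, γ ≫ C.weilProj hR σ = C.proj 𝓕 σ)
    {T : Type u} [Field T] {χ : MvPolynomial (Fin (n + 1)) (ChartRing F c) →+* T}
    (hχ : Function.Injective χ) :
    ∃ ρ : 𝓕 →+* T,
      Spec.map (CommRingCat.ofHom ρ) ≫ genPt 𝓕 = fieldPt χ (exists_X_ne_zero hχ) ≫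
        linearMap MvPolynomial.C (C.bundleMatrix c ε) (C.bundleMatrix_leftInverse c ε) ∧
      Spec.map (CommRingCat.ofHom ρ) ≫ γ =
        fieldPt χ (exists_X_ne_zero hχ) ≫ projSpaceStr n _ ≫ v := by
  have hinj : Function.Injective (χ.comp (C.bundleSubst c ε)) :=
    hχ.comp (C.bundleSubst_injective c ε)
  obtain ⟨ρ, hρ⟩ : ∃ ρ : 𝓕 →+* T, ρ.comp (algebraMap (MvPolynomial (Fin (N + 1)) F) 𝓕) =
      χ.comp (C.bundleSubst c ε) :=
    exists_fractionRing_lift hinj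
  have hX : ∃ l, (χ.comp (C.bundleSubst c ε)) (MvPolynomial.X l) ≠ 0 :=
    exists_X_ne_zero hinj
  have h1 : Spec.map (CommRingCat.ofHom ρ) ≫ genPt 𝓕 =
      fieldPt χ (exists_X_ne_zero hχ) ≫ linearMap MvPolynomial.C (C.bundleMatrix c ε) (C.bundleMatrix_leftInverse c ε) := by
    have h2 : ∃ l, (ρ.comp (algebraMap (MvPolynomial (Fin (N + 1)) F) 𝓕)) (MvPolynomial.X l) ≠ 0 :=
      hρ ▸ hX
    refine (specMap_fieldPt ρ _ _ h2).trans (Eq.trans ?_ (fieldPt_comp_map _ _ _ _ _ hX).symm)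
    congr 1
  refine ⟨ρ, h1, C.weilProj_hom_ext hR ?_ fun σ => ?_⟩
  · rw [Category.assoc, hγs, reassoc_of% h1, linearMap_str]
    simp only [Category.assoc, hvs]
  · obtain ⟨t, rfl⟩ := ε.surjective σ
    have h2 : fieldPt χ (exists_X_ne_zero hχ) ≫ projSpaceStr n (ChartRing F c) =
        Spec.map (CommRingCat.ofHom (χ.comp MvPolynomial.C)) := fieldPt_str _ _
    have h3 : ∃ l, (ρ.comp (C.coord 𝓕 (ε t))) (MvPolynomial.X l) ≠ 0 :=
      exists_X_ne_zero (ρ.injective.comp (C.coord_injective (ε t)))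
    have h4 : IsUnit (((χ.comp MvPolynomial.C).comp (chartHom F c (ε t)))
        (MvPolynomial.X (c (ε t)))) := (isUnit_chartHom c (ε t)).map (χ.comp MvPolynomial.C)
    rw [Category.assoc, hγ, proj, specMap_fieldPt (h' := h3), ← Category.assoc, h2, Category.assoc, hv, chartPt, specMap_pt,
      ← fieldPt_eq _ ⟨_, h4.ne_zero⟩ (X_mem_grading _ F (c (ε t))) one_pos h4]
    -- Both points are given by the same coordinates up to the fibre coordinate with index `t`.
    refine fieldPt_eq_of_scale _ _ (χ (MvPolynomial.X t))
      ((map_ne_zero_iff _ hχ).2 (MvPolynomial.X_ne_zero t)) (apply_eq_pow_mul ?_ fun l => ?_) _ _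
    · refine RingHom.ext fun y => ?_
      change ρ (algebraMap _ 𝓕 (linearSubst (RingHom.id F) (C.D (ε t)) (MvPolynomial.C y))) =
        χ (MvPolynomial.C (chartHom F c (ε t) (MvPolynomial.C y)))
      rw [linearSubst_C, ← RingHom.comp_apply (chartHom F c (ε t)), chartHom_comp_C]
      refine (congrArg (fun f => f (MvPolynomial.C y)) hρ).trans (congrArg χ ?_)
      exact linearSubst_C _ _ y
    · refine (congrArg (fun f => f (linearSubst (RingHom.id F) (C.D (ε t)) (MvPolynomial.X l)))
        hρ).trans ?_
      rw [RingHom.comp_apply, C.bundleSubst_linearSubst_X, map_mul]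
      rfl

/-- Over a product chart, both `Z_F` and the bundle given by `bundleMatrix` are closed in the
product of the chart with `ℙ^N`. A generic point of the bundle factors through the generic point of
`Z_F` and is scheme-theoretically dominant in both, so they agree. -/
theorem isLinearSubbundle (hΦ : Φ.hom ≫ projSpaceStr N F = pullback.snd _ _)
    {η : Spec (CommRingCat.of Ω) ⟶ P}
    (hη : η ≫ p = Spec.map (CommRingCat.ofHom (algebraMap k Ω)))
    {g : Spec (CommRingCat.of Ω) ⟶ R}
    (hg : g ≫ r = Spec.map (CommRingCat.ofHom (algebraMap k Ω)))
    {E : F ⊗[k] Ω →ₐ[F] 𝓕} (hE : Function.Injective E)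
    (hEη : Spec.map (CommRingCat.ofHom (E : F ⊗[k] Ω →+* 𝓕)) ≫ baseChart η hη F ≫ Φ.hom = genPt 𝓕)
    (hEg : ∀ σ, Spec.map (CommRingCat.ofHom (E : F ⊗[k] Ω →+* 𝓕)) ≫ baseChart g hg F ≫
      C.weilProj hR σ = C.proj 𝓕 σ)
    (ε : Fin (n + 1) ≃ (K →ₐ[k] F)) (z : Z ⟶ pullback r p) [IsClosedImmersion z]
    (d : Spec (CommRingCat.of Ω) ⟶ Z) [IsSchemeTheoreticallyDominant d]
    (hd₁ : d ≫ z ≫ pullback.fst r p = g) (hd₂ : d ≫ z ≫ pullback.snd r p = η) :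
    IsLinearSubbundle (pullback.snd r (specExt k F)) n
      (baseChangeMap F (z ≫ pullback.fst r p ≫ r) r (z ≫ pullback.fst r p) (Category.assoc _ _ _))
      (baseChangeMap F (z ≫ pullback.fst r p ≫ r) p (z ≫ pullback.snd r p)
        (by rw [Category.assoc, pullback.condition]) ≫ Φ.hom) := by
  intro x
  set zR := baseChangeMap F (z ≫ pullback.fst r p ≫ r) r (z ≫ pullback.fst r p)
    (Category.assoc _ _ _) with hzR
  set zP := baseChangeMap F (z ≫ pullback.fst r p ≫ r) p (z ≫ pullback.snd r p)
    (by rw [Category.assoc, pullback.condition]) with hzP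
  obtain ⟨c, v, hvo, hxv, hvs, hv⟩ := exists_productChart (C.weilProj hR) (C.weilProj_str hR)
    (fun h hσ => C.weilProj_hom_ext hR h hσ) (fun t h hh => C.exists_hom_weilProj hR t h hh) x
  -- the closed immersion of `Z_F`
  have hzs : zR ≫ pullback.snd r (specExt k F) = (zP ≫ Φ.hom) ≫ projSpaceStr N F := by
    rw [Category.assoc, hΦ, hzR, hzP, baseChangeMap, baseChangeMap, pullback.lift_snd,
      pullback.lift_snd]
  let zB := pullback.lift zR (zP ≫ Φ.hom) hzs
  have hzB : IsClosedImmersion zB := by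
    refine isClosedImmersion_lift_baseChange hΦ z ?_ ?_ ?_
    · rw [pullback.lift_fst_assoc, hzR, baseChangeMap, pullback.lift_fst]
    · rw [pullback.lift_snd_assoc, Category.assoc, Iso.hom_inv_id_assoc, hzP, baseChangeMap,
        pullback.lift_fst]
    · rw [pullback.lift_fst_assoc, hzR, baseChangeMap, pullback.lift_snd]
  -- its restriction to the chart
  let o : pullback (Spec.map (CommRingCat.ofHom (MvPolynomial.C : F →+* ChartRing F c)))
      (projSpaceStr N F) ⟶ pullback (pullback.snd r (specExt k F)) (projSpaceStr N F) :=
    pullback.lift (pullback.fst _ _ ≫ v) (pullback.snd _ _)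
      (by rw [Category.assoc, hvs, pullback.condition])
  have ho : IsPullback o (pullback.fst _ _) (pullback.fst _ _) v := by
    refine IsPullback.of_right ?_ (pullback.lift_fst _ _ _) (IsPullback.of_hasPullback _ _).flip
    rw [pullback.lift_snd, hvs]
    exact (IsPullback.of_hasPullback _ _).flip
  have hY := (IsPullback.of_hasPullback zB o).paste_vert ho
  rw [pullback.lift_fst] at hY
  have hYo : IsOpenImmersion (pullback.fst zB o) :=
    MorphismProperty.of_isPullback (P := @IsOpenImmersion) hY.flip hvo
  -- the two generic points
  obtain ⟨T, _, χ, hχ⟩ : ∃ (T : Type u) (_ : Field T)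
      (χ : MvPolynomial (Fin (n + 1)) (ChartRing F c) →+* T), Function.Injective χ :=
    ⟨FractionRing (MvPolynomial (Fin (n + 1)) (ChartRing F c)), inferInstance,
      algebraMap (MvPolynomial (Fin (n + 1)) (ChartRing F c)) _, IsFractionRing.injective _ _⟩
  have hd : d ≫ z ≫ pullback.fst r p ≫ r = Spec.map (CommRingCat.ofHom (algebraMap k Ω)) := by
    rw [reassoc_of% hd₁, hg]
  have hgR : baseChart d hd F ≫ zR = baseChart g hg F :=
    baseChart_baseChangeMap d hd _ _ hg hd₁ F
  have hηP : baseChart d hd F ≫ zP = baseChart η hη F :=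
    baseChart_baseChangeMap d hd _ _ hη hd₂ F
  obtain ⟨ρ, hρ₁, hρ₂⟩ := C.exists_fieldPt_eq hR c ε hvs hv
    (γ := Spec.map (CommRingCat.ofHom (E : F ⊗[k] Ω →+* 𝓕)) ≫ baseChart g hg F)
    (by rw [← hEη, Category.assoc, Category.assoc, Category.assoc, hΦ, baseChart_snd, baseChart_snd])
    (fun σ => by rw [Category.assoc, hEg]) hχ
  -- The point is dominant in `Z_F`: `d` stays dominant under the flat base change to `F`, and `F ⊗
  -- Ω` embeds in `T`.
  let δ : Spec (CommRingCat.of T) ⟶ pullback (z ≫ pullback.fst r p ≫ r) (specExt k F) :=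
    Spec.map (CommRingCat.ofHom (ρ.comp (E : F ⊗[k] Ω →+* 𝓕))) ≫ baseChart d hd F
  have hδ : IsSchemeTheoreticallyDominant δ := by
    have h1 : IsSchemeTheoreticallyDominant
        (Spec.map (CommRingCat.ofHom (ρ.comp (E : F ⊗[k] Ω →+* 𝓕)))) :=
      isSchemeTheoreticallyDominant_specMap (ρ.injective.comp hE)
    have h2 := flat_specExt k F
    have h3 := quasiCompact_of_field d
    have h4 : IsSchemeTheoreticallyDominant (baseChart d hd F) :=
      .of_isPullback (isPullback_baseChart d hd F).flip
    infer_instance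
  have hδq := quasiCompact_of_field δ
  have hδR : δ ≫ zR = fieldPt χ (exists_X_ne_zero hχ) ≫ projSpaceStr n _ ≫ v := by
    rw [← hρ₂, Category.assoc, hgR, CommRingCat.ofHom_comp, Spec.map_comp, Category.assoc]
  have hδP : δ ≫ zP ≫ Φ.hom = fieldPt χ (exists_X_ne_zero hχ) ≫
      linearMap MvPolynomial.C (C.bundleMatrix c ε) (C.bundleMatrix_leftInverse c ε) := by
    rw [← hρ₁, ← hEη, Category.assoc, reassoc_of% hηP, CommRingCat.ofHom_comp, Spec.map_comp,
      Category.assoc]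
  have hd₀ : IsSchemeTheoreticallyDominant (fieldPt χ (exists_X_ne_zero hχ)) :=
    isSchemeTheoreticallyDominant_fieldPt hχ _
  let c₁ : projSpace n (ChartRing F c) ⟶ pullback (Spec.map (CommRingCat.ofHom
      (MvPolynomial.C : F →+* ChartRing F c))) (projSpaceStr N F) :=
    pullback.lift (projSpaceStr n _) (linearMap MvPolynomial.C (C.bundleMatrix c ε)
      (C.bundleMatrix_leftInverse c ε)) (linearMap_str _ _ _).symm
  have hc₁ : IsClosedImmersion c₁ := isClosedImmersion_of_linearMap _ _ _
    (IsPullback.of_hasPullback _ _) (pullback.lift_fst _ _ _) (pullback.lift_snd _ _ _)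
  let d₂ : Spec (CommRingCat.of T) ⟶ pullback zB o :=
    pullback.lift δ (fieldPt χ (exists_X_ne_zero hχ) ≫ c₁) (by
      apply pullback.hom_ext
      · refine (Category.assoc δ zB _).trans ?_
        rw [pullback.lift_fst, hδR, Category.assoc, Category.assoc, pullback.lift_fst,
          pullback.lift_fst_assoc]
      · refine (Category.assoc δ zB _).trans ?_
        rw [pullback.lift_snd, hδP, Category.assoc, Category.assoc, pullback.lift_snd,
          pullback.lift_snd])
  have hd₂ : IsSchemeTheoreticallyDominant d₂ :=
    isSchemeTheoreticallyDominant_of_mono (pullback.lift_fst _ _ _ : d₂ ≫ pullback.fst zB o = δ)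
  obtain ⟨e, he, -⟩ := exists_iso_of_isClosedImmersion c₁ (pullback.snd zB o) _ d₂
    (pullback.lift_snd _ _ _).symm
  refine ⟨ChartRing F c, inferInstance, v, MvPolynomial.C, C.bundleMatrix c ε,
    C.bundleMatrix_leftInverse c ε, e.hom ≫ pullback.fst zB o, hvo, hxv, hvs, ?_, ?_⟩
  · refine IsPullback.of_iso hY e.symm (Iso.refl _) (Iso.refl _) (Iso.refl _) ?_ ?_ ?_ ?_
    · simp
    · rw [Iso.refl_hom, Category.comp_id, Iso.symm_hom, Iso.eq_inv_comp, reassoc_of% he,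
        pullback.lift_fst]
    · simp
    · simp
  · have h1 : zB ≫ pullback.snd _ _ = zP ≫ Φ.hom := pullback.lift_snd _ _ _
    rw [Category.assoc, ← h1, pullback.condition_assoc, pullback.lift_snd, reassoc_of% he,
      pullback.lift_snd]

end ConjugateData

end SeveriBrauer

/-! ### Conclusion -/

theorem mainTheorem4 {k K : Type u} [Field k] [Field K] [Algebra k K]
    [FiniteDimensional k K] [Algebra.IsSeparable k K]
    {N : ℕ} {P : Scheme.{u}} (p : P ⟶ Spec (CommRingCat.of k))
    (hP : SeveriBrauer.IsSeveriBrauer p N)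
    {L : Scheme.{u}} (i : L ⟶ pullback p (SeveriBrauer.specExt k K))
    (hL : SeveriBrauer.IsTwistedLinear (pullback.snd p (SeveriBrauer.specExt k K)) N i)
    (hconj : SeveriBrauer.ConjugatesSpanIndependently p N i)
    {R : Scheme.{u}} (r : R ⟶ Spec (CommRingCat.of k))
    (ev : pullback r (SeveriBrauer.specExt k K) ⟶ L)
    (hR : SeveriBrauer.IsWeilRestriction (i ≫ pullback.snd p (SeveriBrauer.specExt k K)) r ev) :
    ∃ (Z : Scheme.{u}) (z : Z ⟶ pullback r p),
      SeveriBrauer.IsTwistedLinearSubbundle r p N z ∧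
      SeveriBrauer.IsBirationalMorphism (z ≫ pullback.snd r p) := by
  obtain ⟨⟨_, _, _, _⟩, -⟩ := hP
  have := hL.isClosedImmersion
  obtain ⟨φ, ⟨C⟩⟩ := hconj.exists_conjugateData
  obtain ⟨Ω, _, _, η, hη⟩ := SeveriBrauer.exists_isGenericPoint p
  let 𝓕 := FractionRing (MvPolynomial (Fin (N + 1)) (AlgebraicClosure k))
  obtain ⟨D, hD, hcharts⟩ := SeveriBrauer.exists_rationalCharts (𝓕 := 𝓕) φ.iso φ.isOver hη
  obtain ⟨A, _, _, j, a, _, hj, haj, ha, h, hh, hσ⟩ :=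
    C.exists_rational_map φ.isOver hη D hD hcharts
  obtain ⟨u, hu, hev⟩ := hR.exists_affine h hh
  have hdom := SeveriBrauer.isSchemeTheoreticallyDominant_specMap (f := (a : A →+* Ω)) ha
  obtain ⟨Z, z, hz, ⟨d, hd, hd₁, hd₂⟩, hbir⟩ :=
    SeveriBrauer.exists_isBirationalMorphism u j (hu.trans hj.symm)
      (Spec.map (CommRingCat.ofHom (a : A →+* Ω)))
  -- The fibres are spans of one point for each embedding, whence the rank. The subtraction is
  -- harmless because there is at least one embedding.
  refine ⟨Z, z, ⟨hz, φ, Fintype.card (K →ₐ[k] AlgebraicClosure k) - 1, ?_⟩, hbir⟩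
  have hcard : Fintype.card (K →ₐ[k] AlgebraicClosure k) - 1 + 1 =
      Fintype.card (K →ₐ[k] AlgebraicClosure k) :=
    Nat.sub_add_cancel (Fintype.card_pos_iff.2 ⟨IsAlgClosed.lift⟩)
  have hg : (Spec.map (CommRingCat.ofHom (a : A →+* Ω)) ≫ u) ≫ r =
      Spec.map (CommRingCat.ofHom (algebraMap k Ω)) := by
    rw [Category.assoc, hu, ← Spec.map_comp, ← CommRingCat.ofHom_comp, a.comp_algebraMap]
  exact C.isLinearSubbundle hR φ.isOver hη.isOver hg D.injective hD
    (fun σ => C.specMap_baseChart_weilProj hR D.E a hu hg rfl σ (by rw [hev, hσ]))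
    ((finCongr hcard).trans (Fintype.equivFin _).symm) z d hd₁ (hd₂.trans haj)
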